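/- \textbf{Setting.} Let $(X,\tilde Y)$ be a random pair with $X\in\mathbb{R}^p$ and $\tilde Y\in\{1,\dots,H\}$, such that $\mathbb{P}(\tilde Y=h)\ge p_{\min}$ and $X\mid(\tilde Y=h)\sim\mathcal{N}_p(\mu_h,\Sigma_h)$ for every $h$, and $\mathrm{Cov}(X)=I_p$. Write $\mathrm{Cov}\{\mathbb{E}(X\mid\tilde Y)\}=\beta\,\mathrm{diag}(\lambda_1,\dots,\lambda_d)\,\beta^\top$ with $d\ge1$, $\beta\in\mathbb{R}^{p\times d}$, $\beta^\top\beta=I_d$, and assume (A1) $\kappa\lambda\ge\lambda_1\ge\cdots\ge\lambda_d\ge\lambda>0$, where $\kappa>1$; (A2) $\beta$ has at most $s$ non-zero rows, and the ratio of the largest to the smallest Euclidean norm of its non-zero rows is at most $\mu$. Let $(X_i,\tilde Y_i)_{i\le n}$, $n\ge1$, be i.i.d. copies of $(X,\tilde Y)$, with sample mean $\bar X$. Let $\hat p_h$ and $\bar X_h$ be the proportion and the mean of the observations in slice $h$, and put $\widehat\Sigma=\frac1n\sum_{i}(X_i-\bar X)(X_i-\bar X)^\top$ and $\widehat M=\sum_{h}\hat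 p_h(\bar X_h-\bar X)(\bar X_h-\bar X)^\top$. \textbf{Algorithm (SSIRvRP).} Inputs are $\widehat M$, a matrix $\widehat G$, integers $A,B\ge1$, $k,l\in\{1,\dots,p\}$ and $d$. For $S\subseteq\{1,\dots,p\}$ let $P_S$ be the coordinate projection onto $S$. The generalized eigenvectors of $(P_S\widehat MP_S,P_S\widehat GP_S)$ are taken to be supported on $S$ and orthonormal with respect to $P_S\widehat GP_S$, and are ordered by decreasing eigenvalue. Independently of the data, draw independent uniformly distributed $k$-element sets $S_{a,b}$, $a\le A$, $b\le B$. For each $(a,b)$ compute the $d+1$ leading generalized eigenvalues $\hat\lambda_{a,b;i}$ and eigenvectors $\hat v_{a,b;i}$ of $(P_{S_{a,b}}\widehat MP_{S_{a,b}},P_{S_{a,b}}\widehat GP_{S_{a,b}})$. Let $b^*(a)$ be the smallest maximiser of $b\mapsto\sum_{i=1}^d\hat\lambda_{a,b;i}$, and let $$\hat w^{(j)}=\frac1A\sum_{a=1}^A\sum_{i=1}^d\big(\hat\lambda_{a,b^*(a);i}-\hat\lambda_{a,b^*(a);d+1}\big)\big(\hat v^{(j)}_{a,b^*(a);i}\big)^2,\qquad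 j=1,\dots,p.$$ Let $\hat S$ be the index set of $l$ largest components of $\hat w$. The output $\hat\beta\in\mathbb{R}^{p\times d}$ has as columns the $d$ leading generalized eigenvectors of $(P_{\hat S}\widehat MP_{\hat S},P_{\hat S}\widehat GP_{\hat S})$. Choices left open (ties, eigenvectors) are arbitrary. On the event that the required generalized eigenvectors do not exist, $\hat\beta$ is an arbitrary matrix. \textbf{Loss.} $L(\hat\beta,\beta)=\|\sin\Theta\|_{\rm F}=\big(\sum_{j=1}^d\sin^2\theta_j\big)^{1/2}$, where $\theta_1,\dots,\theta_d$ are the principal angles between the column spaces of $\hat\beta$ and $\beta$: $\theta_j=\arccos\sigma_j$, with $\sigma_j$ the $j$-th singular value of $Q^\top\beta$ and $Q$ the Gram--Schmidt orthonormalisation of the columns of $\hat\beta$ (so $Q=\hat\beta$ if these are orthonormal, and columns of $Q$ at which Gram--Schmidt breaks down are $0$). \textbf{Theorem.} For all $H$, $d$, $\kappa$, $\lambda$, $\mu$ and $p_{\min}>0$ there are constants $K,c>0$ such that the following holds in the setting above, for all $n,p,s,k,l,A,B$, and both for $\widehat G=\widehat\Sigma$ and for $\widehat G=I_p$. If $k\ge\max\{d+1,s\}$,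 $l\ge s$ and $$16K\sqrt{\frac{k\log p}{n}}\le\frac{\lambda_d}{s\mu^2},$$ then $$\mathbb{P}\bigg\{L(\hat\beta,\beta)\le 2K\sqrt{\frac{dl\log p}{n\lambda_d^2}}\bigg\}\ge 1-cp^{-3}-p\exp\bigg(-\frac{A\lambda_d^2}{50p^2\mu^8\lambda_1^2}\bigg),$$ where, if the event on the left is not measurable, the bound holds for some measurable subset of it. -/

import Mathlib

open MeasureTheory ProbabilityTheory Matrix

noncomputable section

/-! ### Population quantities -/

/-- The covariance matrix of a random vector with coordinates `Z · j`. -/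
def covMatrixOf {Ω : Type*} [MeasurableSpace Ω] {p : ℕ} (P : Measure Ω) (Z : Ω → Fin p → ℝ) :
    Matrix (Fin p) (Fin p) ℝ :=
  Matrix.of fun i j => cov[fun ω => Z ω i, fun ω => Z ω j; P]

/-- The sliced inverse regression kernel `Cov(E(X | Y))`, for a discretised response `Y`
with `H` slices. -/
def sirKernel {Ω : Type*} [MeasurableSpace Ω] {p H : ℕ} (P : Measure Ω)
    (X : Ω → EuclideanSpace ℝ (Fin p)) (Y : Ω → Fin H) : Matrix (Fin p) (Fin p) ℝ :=
  covMatrixOf P fun ω j =>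
    (P[fun ω' => X ω' j | MeasurableSpace.comap Y inferInstance]) ω

/-- `(X, Y)` is a population in which every slice has positive probability and, given
`Y = h`, the vector `X` has the normal law with mean `m h` and covariance matrix `C h`. -/
structure IsSlicedGaussian {Ω : Type*} [MeasurableSpace Ω] {p H : ℕ} (P : Measure Ω)
    (X : Ω → EuclideanSpace ℝ (Fin p)) (Y : Ω → Fin H)
    (m : Fin H → EuclideanSpace ℝ (Fin p)) (C : Fin H → Matrix (Fin p) (Fin p) ℝ) : Prop where
  measurable_X : Measurable X
  measurable_Y : Measurable Y
  slice_pos : ∀ h, 0 < P.real (Y ⁻¹' {h})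
  posSemidef : ∀ h, (C h).PosSemidef
  law : ∀ h, (P[|Y ⁻¹' {h}]).map X = multivariateGaussian (m h) (C h)

/-- `V` has orthonormal columns. -/
def HasOrthonormalColumns {p d : ℕ} (V : Matrix (Fin p) (Fin d) ℝ) : Prop := Vᵀ * V = 1

/-- Euclidean norm of the `j`-th row of `V`. -/
def rowNorm {p d : ℕ} (V : Matrix (Fin p) (Fin d) ℝ) (j : Fin p) : ℝ := √(∑ i, V j i ^ 2)

/-- Matrices with orthonormal columns and at most `s` non-zero rows, such that the ratio of the
largest to the smallest norm of a non-zero row is at most `μ`. -/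
structure IsIncoherent {p d : ℕ} (s : ℕ) (μ : ℝ) (V : Matrix (Fin p) (Fin d) ℝ) : Prop where
  orthonormal : HasOrthonormalColumns V
  sparse : {j | V j ≠ 0}.ncard ≤ s
  ratio : ∀ j j', V j ≠ 0 → V j' ≠ 0 → rowNorm V j / rowNorm V j' ≤ μ

/-! ### Sample quantities -/

/-- The sample mean. -/
def sampleMean {n p : ℕ} (x : Fin n → EuclideanSpace ℝ (Fin p)) : Fin p → ℝ :=
  fun j => (n : ℝ)⁻¹ * ∑ i, x i j

/-- The sample covariance matrix (with normalisation `1 / n`). -/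
def sampleCov {n p : ℕ} (x : Fin n → EuclideanSpace ℝ (Fin p)) : Matrix (Fin p) (Fin p) ℝ :=
  (n : ℝ)⁻¹ • ∑ i, vecMulVec (fun j => x i j - sampleMean x j) (fun j => x i j - sampleMean x j)

/-- The sample proportion of slice `h`. -/
def sliceProp {n H : ℕ} (y : Fin n → Fin H) (h : Fin H) : ℝ :=
  (n : ℝ)⁻¹ * ∑ i, if y i = h then 1 else 0

/-- The sample mean of slice `h`. -/
def sliceMean {n p H : ℕ} (x : Fin n → EuclideanSpace ℝ (Fin p)) (y : Fin n → Fin H)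
    (h : Fin H) : Fin p → ℝ :=
  fun j => (sliceProp y h)⁻¹ * (n : ℝ)⁻¹ * ∑ i, if y i = h then x i j else 0

/-- The sample version of `Cov(E(X | Y))`. -/
def sampleKernel {n p H : ℕ} (x : Fin n → EuclideanSpace ℝ (Fin p)) (y : Fin n → Fin H) :
    Matrix (Fin p) (Fin p) ℝ :=
  ∑ h, sliceProp y h •
    vecMulVec (fun j => sliceMean x y h j - sampleMean x j)
      (fun j => sliceMean x y h j - sampleMean x j)

/-! ### The algorithm -/

/-- The coordinate projection `P_S`. -/
def coordProj {p : ℕ} (S : Finset (Fin p)) : Matrix (Fin p) (Fin p) ℝ :=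
  Matrix.diagonal fun j => if j ∈ S then 1 else 0

/-- `lam` and `v` are the `r` largest generalized eigenvalues, in decreasing order and with
multiplicity, and corresponding generalized eigenvectors of the pair `(P_S M P_S, P_S G P_S)`.
The eigenvectors are supported on `S` and normalised with respect to `P_S G P_S`. The field
`top` says that nothing larger is left over in the complement of the chosen eigenvectors. -/
structure IsTopGenEigen {p r : ℕ} (M G : Matrix (Fin p) (Fin p) ℝ) (S : Finset (Fin p))
    (lam : Fin r → ℝ) (v : Fin r → Fin p → ℝ) : Prop where
  supp : ∀ i, ∀ j ∉ S, v i j = 0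
  eig : ∀ i, (coordProj S * M * coordProj S) *ᵥ v i
    = lam i • ((coordProj S * G * coordProj S) *ᵥ v i)
  orth : ∀ i i', v i ⬝ᵥ (coordProj S * G * coordProj S) *ᵥ v i' = if i = i' then 1 else 0
  anti : Antitone lam
  top : ∀ (ν : ℝ) (u : Fin p → ℝ), (∀ j ∉ S, u j = 0) →
    (coordProj S * M * coordProj S) *ᵥ u = ν • ((coordProj S * G * coordProj S) *ᵥ u) →
    u ⬝ᵥ (coordProj S * G * coordProj S) *ᵥ u = 1 →
    (∀ i, v i ⬝ᵥ (coordProj S * G * coordProj S) *ᵥ u = 0) → ∀ i, ν ≤ lam i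

/-- `b` is the smallest maximiser of `f`. -/
def IsSargmax {B : ℕ} (f : Fin B → ℝ) (b : Fin B) : Prop :=
  IsLeast {b | ∀ b', f b' ≤ f b} b

/-- The importance scores: `lam a i` and `v a i` are the `d + 1` leading generalized eigenvalues
and eigenvectors for the projection selected in the `a`-th group. -/
def importanceScore {p A d : ℕ} (lam : Fin A → Fin (d + 1) → ℝ)
    (v : Fin A → Fin (d + 1) → Fin p → ℝ) (j : Fin p) : ℝ :=
  (A : ℝ)⁻¹ * ∑ a, ∑ i : Fin d,
    (lam a i.castSucc - lam a (Fin.last d)) * v a i.castSucc j ^ 2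

/-- `T` consists of the indices of `l` largest components of `w` (ties broken arbitrarily). -/
def IsTopIndexSet {p : ℕ} (l : ℕ) (w : Fin p → ℝ) (T : Finset (Fin p)) : Prop :=
  T.card = l ∧ ∀ j ∈ T, ∀ j' ∉ T, w j' ≤ w j

/-- `βhat` is a possible output of the SSIRvRP algorithm, with input matrices `M` (estimate of
`Cov(E(X | Y))`) and `G` (estimate of `Cov(X)`), tuning parameters `A, B, l, d`, and generated
projections `P_{a,b}`, the coordinate projections onto `S a b`. All choices that the algorithm
leaves open (eigenvectors, ties among the scores) are arbitrary. The `(d+1)`-st generalized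
eigenvalue is taken among those of the pair, so the sets `S a b` are meant to have at least
`d + 1` elements. -/
def IsSSIRvRPOutput {p A B d : ℕ} (M G : Matrix (Fin p) (Fin p) ℝ) (l : ℕ)
    (S : Fin A → Fin B → Finset (Fin p)) (βhat : Matrix (Fin p) (Fin d) ℝ) : Prop :=
  ∃ (lam : Fin A → Fin B → Fin (d + 1) → ℝ) (v : Fin A → Fin B → Fin (d + 1) → Fin p → ℝ)
    (bstar : Fin A → Fin B) (Shat : Finset (Fin p)) (lamhat : Fin d → ℝ),
    (∀ a b, IsTopGenEigen M G (S a b) (lam a b) (v a b)) ∧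
    (∀ a, IsSargmax (fun b => ∑ i : Fin d, lam a b i.castSucc) (bstar a)) ∧
    IsTopIndexSet l
      (importanceScore (fun a => lam a (bstar a)) (fun a => v a (bstar a))) Shat ∧
    IsTopGenEigen M G Shat lamhat (fun i j => βhat j i)

/-! ### The loss -/

/-- The Gram-Schmidt orthonormalisation of the columns of `U`. It does not change a matrix with
orthonormal columns, and it keeps the column space of a matrix with independent columns. -/
def orthonormalize {p d : ℕ} (U : Matrix (Fin p) (Fin d) ℝ) : Matrix (Fin p) (Fin d) ℝ :=
  Matrix.of fun j i =>
    InnerProductSpace.gramSchmidtNormed ℝ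
      (fun i' : Fin d => (WithLp.toLp 2 (fun j' => U j' i') : EuclideanSpace ℝ (Fin p))) i j

/-- On matrices with orthonormal columns the orthonormalisation is the identity. -/
theorem orthonormalize_of_orthonormal {p d : ℕ} {U : Matrix (Fin p) (Fin d) ℝ}
    (hU : HasOrthonormalColumns U) : orthonormalize U = U := by
  have hin : ∀ i i' : Fin d, inner ℝ (WithLp.toLp 2 (fun j' => U j' i) : EuclideanSpace ℝ (Fin p))
      (WithLp.toLp 2 (fun j' => U j' i')) = if i = i' then 1 else 0 := by
    intro i i'
    have := congrFun (congrFun hU i) i'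
    simp only [Matrix.mul_apply, Matrix.transpose_apply, Matrix.one_apply] at this
    rw [← this, PiLp.inner_apply]
    simp [mul_comm]
  have hgs := InnerProductSpace.gramSchmidt_of_orthogonal ℝ
    (f := fun i : Fin d => (WithLp.toLp 2 (fun j' => U j' i) : EuclideanSpace ℝ (Fin p)))
    (fun i i' h => by simpa [h] using hin i i')
  have hn : ∀ i, ‖(WithLp.toLp 2 (fun j' => U j' i) : EuclideanSpace ℝ (Fin p))‖ = 1 := by
    intro i
    have h1 := hin i i
    rw [real_inner_self_eq_norm_sq, if_pos rfl] at h1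
    exact (pow_eq_one_iff_of_nonneg (norm_nonneg _) two_ne_zero).1 h1
  ext j i
  simp [orthonormalize, InnerProductSpace.gramSchmidtNormed, hgs, hn]

/-- The `j`-th principal angle `arccos (σ_j (Uᵀ V))` between the column spaces of two matrices
with orthonormal columns. -/
def principalAngle {p d : ℕ} (U V : Matrix (Fin p) (Fin d) ℝ) (j : Fin d) : ℝ :=
  Real.arccos ((Matrix.toEuclideanLin (Uᵀ * V)).singularValues j)

/-- The loss `‖sin Θ(U, V)‖_F`, where `Θ(U, V)` is the diagonal matrix of the principal angles
between the column spaces of `U` and `V`. -/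
def sinThetaLoss {p d : ℕ} (U V : Matrix (Fin p) (Fin d) ℝ) : ℝ :=
  √(∑ j, Real.sin (principalAngle (orthonormalize U) (orthonormalize V) j) ^ 2)

/-! ### The sampling scheme -/

/-- The random variables that the estimator is computed from: `n` independent copies
`(Xs i, Ys i)` of the population pair `(X, Y)`, and, independently of them, `A * B` independent
uniformly distributed `k`-element index sets `S a b`. -/
structure IsSamplingScheme {Ω₀ Ω : Type*} [MeasurableSpace Ω₀] [MeasurableSpace Ω]
    {n p H A B : ℕ} (P₀ : Measure Ω₀) (P : Measure Ω)
    (X : Ω₀ → EuclideanSpace ℝ (Fin p)) (Y : Ω₀ → Fin H) (k : ℕ)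
    (Xs : Fin n → Ω → EuclideanSpace ℝ (Fin p)) (Ys : Fin n → Ω → Fin H)
    (S : Fin A → Fin B → Ω → Finset (Fin p)) : Prop where
  measurable_Xs : ∀ i, Measurable (Xs i)
  measurable_Ys : ∀ i, Measurable (Ys i)
  measurable_S : ∀ a b, Measurable (S a b)
  identDistrib : ∀ i, IdentDistrib (fun ω => (Xs i ω, Ys i ω)) (fun ω => (X ω, Y ω)) P P₀
  indep_data : iIndepFun (fun i ω => (Xs i ω, Ys i ω)) P
  uniform : ∀ a b, P.map (S a b) = uniformOn {T : Finset (Fin p) | T.card = k}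
  indep_proj : iIndepFun (fun (ab : Fin A × Fin B) ω => S ab.1 ab.2 ω) P
  indep_data_proj : IndepFun (fun ω i => (Xs i ω, Ys i ω))
    (fun ω (ab : Fin A × Fin B) => S ab.1 ab.2 ω) P

end

/-! Let J be the set of non-zero rows of β and m_j = Σ_k λ_k β_jk², the diagonal of Cov(E(X | Y)).
Everything is reduced to one deterministic notion, `NearSpiked`: on vectors supported on an
arbitrary set of size r, for r = k and r = l, the quadratic forms of M̂ and Ĝ are within ε_r |u|² of
those of β diag(λ) βᵀ and of the identity, where ε_r is a constant times √(r log p / n).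

Closeness at size k controls the selection. The criterion of a k-set T, the sum of its d leading
generalized eigenvalues, is the compressed trace Σ_{j ∈ T} m_j up to 4dε
(`NearSpiked.abs_sum_lam_sub_le`). Incoherence gives m_j ≥ λ_d / (sμ²) on J, which dominates ε, so
replacing a noise coordinate by a signal coordinate never lowers the criterion
(`topSum_le_swapSet`). With the data fixed, exchanging the two coordinates in one random set
preserves the law of the sets, so each signal coordinate is selected at least as often as each noise
coordinate (`integral_selInd_le`). A selected set of size k ≥ |J| that misses a given signal
coordinate must contain a noise coordinate, hence the selection probability on J is at least 1/p.
Hoeffding's inequality over the A groups then yields counts with N_j' < 3 N_j for j in J and j'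
outside, except on an event of probability p exp(-A/(2p²)), which is below the asserted term.

The scores need no gap between eigenvalues: with the weights λ_i - λ_{d+1} and λ_{d+1} ≤ 2ε, the
weighted squared loadings reproduce the diagonal entry m_j up to 13ε
(`NearSpiked.abs_score_sub_le`). The score of j, multiplied by A, is therefore (m_j ± 13ε) N_j, and
m_j ≥ 52ε on J makes every signal score exceed every noise score. So Ŝ contains J
(`subset_of_isTopIndexSet`). Closeness at size l then bounds the component of each final eigenvector
outside the column space of β (`NearSpiked.residual_le`), and with it the loss.

Closeness itself holds with probability 1 - O(p⁻³). Given a slice, a linear functional of X is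
normal, and its second moment is bounded through Cov(X) = I and `pmin`; so squared functionals have
exponential moments with uniform constants and Bernstein's inequality applies. A union bound over a
finite grid of sparse vectors makes the estimate uniform over all coordinate sets of the given size.

The data and the sets are combined by Fubini, which requires the criterion to be measurable in the
data. Its superlevel sets are described by open conditions on the matrices (`certifiedAbove`), so no
measurable choice of eigenvectors is involved. -/

noncomputable section

/-! ### Generalized eigenpairs of two bilinear forms on a subspace -/

section GenEigen

variable {p : ℕ}

/-- The diagonal of a bilinear form on `ℝᵖ` is continuous. -/
theorem continuous_bilin_diag (B : LinearMap.BilinForm ℝ (Fin p → ℝ)) :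
    Continuous fun u => B u u := by
  have h : (fun u => B u u) = fun u : Fin p → ℝ => u ⬝ᵥ (LinearMap.BilinForm.toMatrix' B) *ᵥ u := by
    ext u
    rw [← Matrix.toBilin'_apply', Matrix.toBilin'_toMatrix']
  rw [h]
  fun_prop

theorem bilin_cauchy_schwarz {B : LinearMap.BilinForm ℝ (Fin p → ℝ)} (hs : ∀ u w, B u w = B w u)
    {W : Submodule ℝ (Fin p → ℝ)} (hB : ∀ u ∈ W, 0 ≤ B u u) {u w : Fin p → ℝ} (hu : u ∈ W)
    (hw : w ∈ W) : B u w ^ 2 ≤ B u u * B w w := by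
  have h : ∀ t : ℝ, 0 ≤ B w w * (t * t) + (2 * B u w) * t + B u u := by
    intro t
    have := hB (u + t • w) (W.add_mem hu (W.smul_mem t hw))
    simp only [map_add, LinearMap.add_apply, map_smul, LinearMap.smul_apply, smul_eq_mul,
      hs w u] at this
    linarith
  have := discrim_le_zero h
  rw [discrim] at this
  linarith

/-- A maximiser of the Rayleigh quotient of `(M, G)` on `W` is a generalized eigenvector. -/
theorem exists_rayleigh_max {M G : LinearMap.BilinForm ℝ (Fin p → ℝ)} (hM : ∀ u w, M u w = M w u)
    (hG : ∀ u w, G u w = G w u) {W : Submodule ℝ (Fin p → ℝ)} (hW : W ≠ ⊥)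
    (hpos : ∀ u ∈ W, u ≠ 0 → 0 < G u u) :
    ∃ u ∈ W, ∃ ν : ℝ, G u u = 1 ∧ (∀ w ∈ W, M w w ≤ ν * G w w) ∧
      ∀ w ∈ W, M w u = ν * G w u := by
  obtain ⟨z, hzW, hz0⟩ := W.exists_mem_ne_zero_of_ne_bot hW
  have hK : IsCompact ((W : Set (Fin p → ℝ)) ∩ Metric.sphere 0 1) :=
    (isCompact_sphere 0 1).inter_left W.closed_of_finiteDimensional
  have hne : ((W : Set (Fin p → ℝ)) ∩ Metric.sphere 0 1).Nonempty := by
    refine ⟨‖z‖⁻¹ • z, W.smul_mem _ hzW, ?_⟩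
    simp [norm_smul, hz0]
  have hnz : ∀ u ∈ (W : Set (Fin p → ℝ)) ∩ Metric.sphere 0 1, u ≠ 0 := by
    rintro u ⟨-, hu⟩ rfl
    simp at hu
  have hcont : ContinuousOn (fun u => M u u / G u u)
      ((W : Set (Fin p → ℝ)) ∩ Metric.sphere 0 1) :=
    (continuous_bilin_diag M).continuousOn.div (continuous_bilin_diag G).continuousOn
      fun u hu => (hpos u hu.1 (hnz u hu)).ne'
  obtain ⟨u₁, hu₁, hmax⟩ := hK.exists_isMaxOn hne hcont
  have hg : 0 < G u₁ u₁ := hpos u₁ hu₁.1 (hnz u₁ hu₁)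
  set ν := M u₁ u₁ / G u₁ u₁ with hν
  have hle : ∀ w ∈ W, M w w ≤ ν * G w w := by
    intro w hw
    by_cases h0 : w = 0
    · simp [h0]
    have hw' : ‖w‖⁻¹ • w ∈ (W : Set (Fin p → ℝ)) ∩ Metric.sphere 0 1 :=
      ⟨W.smul_mem _ hw, by simp [norm_smul, h0]⟩
    have h1 : M (‖w‖⁻¹ • w) (‖w‖⁻¹ • w) / G (‖w‖⁻¹ • w) (‖w‖⁻¹ • w) ≤ ν := hmax hw'
    rw [div_le_iff₀ (hpos _ hw'.1 (hnz _ hw'))] at h1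
    simp only [map_smul, LinearMap.smul_apply, smul_eq_mul] at h1
    have hn : 0 < ‖w‖⁻¹ := by positivity
    have h2 : ‖w‖⁻¹ * (‖w‖⁻¹ * M w w) ≤ ‖w‖⁻¹ * (‖w‖⁻¹ * (ν * G w w)) := by linarith
    exact le_of_mul_le_mul_left (le_of_mul_le_mul_left h2 hn) hn
  have hM1 : M u₁ u₁ = ν * G u₁ u₁ := by rw [hν]; field_simp
  have heig : ∀ w ∈ W, M w u₁ = ν * G w u₁ := by
    intro w hw
    -- `ν • G - M` is nonnegative on `W` and vanishes at `u₁`; by Cauchy–Schwarz, `u₁` then pairs to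
    -- zero with all of `W`.
    have hcs := bilin_cauchy_schwarz (B := ν • G - M) (W := W) (u := w) (w := u₁)
      (fun a b => by simp [hM a b, hG a b])
      (fun a ha => by simpa using hle a ha) hw hu₁.1
    simp only [LinearMap.sub_apply, LinearMap.smul_apply, smul_eq_mul] at hcs
    rw [hM1, sub_self, mul_zero] at hcs
    nlinarith
  refine ⟨(√(G u₁ u₁))⁻¹ • u₁, W.smul_mem _ hu₁.1, ν, ?_, hle, ?_⟩
  · simp only [map_smul, LinearMap.smul_apply, smul_eq_mul]
    have : √(G u₁ u₁) * √(G u₁ u₁) = G u₁ u₁ := Real.mul_self_sqrt hg.le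
    have h0 : √(G u₁ u₁) ≠ 0 := by positivity
    field_simp
    rw [pow_two, this]
  · intro w hw
    simp only [map_smul, smul_eq_mul, heig w hw]
    ring

/-- `lam` and `v` are the `r` leading generalized eigenpairs of `(M, G)` on `W`. -/
structure TopPairs (M G : LinearMap.BilinForm ℝ (Fin p → ℝ)) (W : Submodule ℝ (Fin p → ℝ)) {r : ℕ}
    (lam : Fin r → ℝ) (v : Fin r → Fin p → ℝ) : Prop where
  mem : ∀ i, v i ∈ W
  eig : ∀ i, ∀ w ∈ W, M w (v i) = lam i * G w (v i)
  orth : ∀ i j, G (v i) (v j) = if i = j then 1 else 0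
  anti : Antitone lam
  compl : ∀ u ∈ W, (∀ i, G (v i) u = 0) → ∀ i, M u u ≤ lam i * G u u

variable {M G : LinearMap.BilinForm ℝ (Fin p → ℝ)} {W : Submodule ℝ (Fin p → ℝ)} {r : ℕ}
  {lam : Fin r → ℝ} {v : Fin r → Fin p → ℝ}

theorem bilin_sum_orth (orth : ∀ i j, G (v i) (v j) = if i = j then 1 else 0) (c : Fin r → ℝ)
    (i : Fin r) : G (v i) (∑ j, c j • v j) = c i := by
  simp [orth]

theorem bilin_sum_sum_orth (orth : ∀ i j, G (v i) (v j) = if i = j then 1 else 0)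
    (c : Fin r → ℝ) : G (∑ j, c j • v j) (∑ j, c j • v j) = ∑ j, c j ^ 2 := by
  simp [orth, pow_two]

/-- The part of `u` that is `G`-orthogonal to the family `v`. -/
def orthPart (G : LinearMap.BilinForm ℝ (Fin p → ℝ)) (v : Fin r → Fin p → ℝ) (u : Fin p → ℝ) :
    Fin p → ℝ := u - ∑ i, G (v i) u • v i

theorem orthPart_mem (mem : ∀ i, v i ∈ W) {u : Fin p → ℝ} (hu : u ∈ W) : orthPart G v u ∈ W :=
  W.sub_mem hu (W.sum_mem fun i _ => W.smul_mem _ (mem i))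

theorem bilin_orthPart (orth : ∀ i j, G (v i) (v j) = if i = j then 1 else 0) (u : Fin p → ℝ)
    (i : Fin r) : G (v i) (orthPart G v u) = 0 := by
  rw [orthPart, map_sub, bilin_sum_orth orth, sub_self]

theorem bilin_eq_sum_add_orthPart (hM : ∀ u w, M u w = M w u) (hG : ∀ u w, G u w = G w u)
    (mem : ∀ i, v i ∈ W) (eig : ∀ i, ∀ w ∈ W, M w (v i) = lam i * G w (v i))
    (orth : ∀ i j, G (v i) (v j) = if i = j then 1 else 0) {u : Fin p → ℝ} (hu : u ∈ W) :
    M u u = ∑ i, lam i * G (v i) u ^ 2 + M (orthPart G v u) (orthPart G v u) := by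
  set o := orthPart G v u with ho
  have hoW : o ∈ W := orthPart_mem mem hu
  set s := ∑ i, G (v i) u • v i with hs
  have hus : u = s + o := by rw [ho, orthPart]; simp [hs]
  have h1 : M s o = 0 := by
    rw [hM, hs, map_sum]
    refine Finset.sum_eq_zero fun i _ => ?_
    rw [map_smul, eig i o hoW, hG o, bilin_orthPart orth]
    simp
  have h2 : M s s = ∑ i, lam i * G (v i) u ^ 2 := by
    have hsW : s ∈ W := W.sum_mem fun i _ => W.smul_mem _ (mem i)
    conv_lhs => rw [hs, map_sum]
    simp only [map_smul]
    refine Finset.sum_congr rfl fun i _ => ?_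
    rw [eig i s hsW, hG s, hs, bilin_sum_orth orth]
    simp only [smul_eq_mul]
    ring
  conv_lhs => rw [hus]
  simp only [map_add, LinearMap.add_apply, hM o s, h1, h2]
  ring

theorem bilin_self_eq_sum_add_orthPart (hG : ∀ u w, G u w = G w u) (mem : ∀ i, v i ∈ W)
    (orth : ∀ i j, G (v i) (v j) = if i = j then 1 else 0) {u : Fin p → ℝ} (hu : u ∈ W) :
    G u u = ∑ i, G (v i) u ^ 2 + G (orthPart G v u) (orthPart G v u) := by
  have := bilin_eq_sum_add_orthPart (lam := fun _ => 1) hG hG mem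
    (fun i w _ => by simp) orth hu
  simpa using this

/-- If nothing larger than the eigenvalues is left over among the eigenvectors in the complement,
then the Rayleigh quotients on the complement are bounded. -/
theorem TopPairs.of_eigen (hM : ∀ u w, M u w = M w u) (hG : ∀ u w, G u w = G w u)
    (hpos : ∀ u ∈ W, u ≠ 0 → 0 < G u u)
    (mem : ∀ i, v i ∈ W) (eig : ∀ i, ∀ w ∈ W, M w (v i) = lam i * G w (v i))
    (orth : ∀ i j, G (v i) (v j) = if i = j then 1 else 0) (anti : Antitone lam)
    (top : ∀ ν : ℝ, ∀ u ∈ W, (∀ w ∈ W, M w u = ν * G w u) → G u u = 1 →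
      (∀ i, G (v i) u = 0) → ∀ i, ν ≤ lam i) : TopPairs M G W lam v := by
  refine ⟨mem, eig, orth, anti, fun u hu huo i => ?_⟩
  by_cases h0 : u = 0
  · simp [h0]
  let W' : Submodule ℝ (Fin p → ℝ) := W ⊓ ⨅ i, LinearMap.ker (G (v i))
  have hW' : ∀ w, w ∈ W' ↔ w ∈ W ∧ ∀ i, G (v i) w = 0 := by
    intro w; simp [W', Submodule.mem_inf, Submodule.mem_iInf]
  have hu' : u ∈ W' := (hW' u).2 ⟨hu, huo⟩
  obtain ⟨z, hz, ν, hz1, hle, hzeig⟩ := exists_rayleigh_max hM hG (W := W')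
    (fun h => h0 (by rw [h] at hu'; simpa using hu')) (fun w hw => hpos w ((hW' w).1 hw).1)
  obtain ⟨hzW, hzo⟩ := (hW' z).1 hz
  have hν : ν ≤ lam i := by
    refine top ν z hzW (fun w hw => ?_) hz1 hzo i
    have h1 := hzeig (orthPart G v w) ((hW' _).2 ⟨orthPart_mem mem hw, bilin_orthPart orth w⟩)
    -- Both forms pair `z` to zero with every `v i`, so the eigenvalue equation on the complement
    -- extends to all of `W`.
    have h2 : ∀ i, M (v i) z = 0 := fun i => by rw [hM, eig i z hzW, hG, hzo]; simp
    simpa [orthPart, h2, hzo] using h1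
  refine (hle u hu').trans (mul_le_mul_of_nonneg_right hν (hpos u hu h0).le)

/-- Induction on `r`: the next pair is a Rayleigh maximiser on the `G`-orthogonal complement of the
vectors found so far. The complement is non-trivial while `r` is below the dimension of `W`, since
otherwise fewer than `finrank W` vectors would span `W`. -/
theorem exists_topPairs (hM : ∀ u w, M u w = M w u) (hG : ∀ u w, G u w = G w u)
    (hpos : ∀ u ∈ W, u ≠ 0 → 0 < G u u) (r : ℕ) (hr : r ≤ Module.finrank ℝ W) :
    ∃ (lam : Fin r → ℝ) (v : Fin r → Fin p → ℝ), TopPairs M G W lam v := by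
  induction r with
  | zero =>
    exact ⟨Fin.elim0, Fin.elim0, ⟨fun i => i.elim0, fun i => i.elim0, fun i => i.elim0,
      fun i => i.elim0, fun _ _ _ i => i.elim0⟩⟩
  | succ r ih =>
    obtain ⟨lam, v, h⟩ := ih (by omega)
    let W' : Submodule ℝ (Fin p → ℝ) := W ⊓ ⨅ i, LinearMap.ker (G (v i))
    have hW' : ∀ w, w ∈ W' ↔ w ∈ W ∧ ∀ i, G (v i) w = 0 := by
      intro w; simp [W', Submodule.mem_inf, Submodule.mem_iInf]
    have hne : W' ≠ ⊥ := by
      intro hbot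
      have hle : W ≤ Submodule.span ℝ (Set.range v) := by
        intro w hw
        have h1 : orthPart G v w ∈ W' :=
          (hW' _).2 ⟨orthPart_mem h.mem hw, bilin_orthPart h.orth w⟩
        rw [hbot, Submodule.mem_bot, orthPart, sub_eq_zero] at h1
        rw [h1]
        exact Submodule.sum_mem _ fun i _ => Submodule.smul_mem _ _
          (Submodule.subset_span ⟨i, rfl⟩)
      have h1 := Submodule.finrank_mono hle
      have h2 := finrank_range_le_card (R := ℝ) v
      rw [Set.finrank, Fintype.card_fin] at h2
      omega
    obtain ⟨z, hz, ν, hz1, hle, hzeig⟩ := exists_rayleigh_max hM hG (W := W') hne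
      (fun w hw => hpos w ((hW' w).1 hw).1)
    obtain ⟨hzW, hzo⟩ := (hW' z).1 hz
    have heig : ∀ w ∈ W, M w z = ν * G w z := by
      intro w hw
      have h1 := hzeig (orthPart G v w)
        ((hW' _).2 ⟨orthPart_mem h.mem hw, bilin_orthPart h.orth w⟩)
      have h2 : ∀ i, M (v i) z = 0 := fun i => by rw [hM, h.eig i z hzW, hG, hzo]; simp
      simpa [orthPart, h2, hzo] using h1
    have hν : ∀ i, ν ≤ lam i := by
      intro i
      have h1 := h.compl z hzW hzo i
      rw [heig z hzW, hz1] at h1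
      linarith
    refine ⟨Fin.snoc lam ν, Fin.snoc (α := fun _ => Fin p → ℝ) v z, ?_, ?_, ?_, ?_, ?_⟩
    · intro i
      refine Fin.lastCases ?_ (fun i => ?_) i
      · simpa using hzW
      · simpa using h.mem i
    · intro i
      refine Fin.lastCases ?_ (fun i => ?_) i
      · simpa using heig
      · simpa using h.eig i
    · intro i j
      refine Fin.lastCases ?_ (fun i => ?_) i <;> refine Fin.lastCases ?_ (fun j => ?_) j
      · simpa using hz1
      · simp [hG z, hzo, (Fin.castSucc_lt_last j).ne']
      · simp [hzo, (Fin.castSucc_lt_last i).ne]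
      · simp [h.orth]
    · intro i j hij
      revert hij
      refine Fin.lastCases ?_ (fun i => ?_) i <;> refine Fin.lastCases ?_ (fun j => ?_) j
      · simp
      · intro hij
        exact absurd hij (not_le.2 (Fin.castSucc_lt_last j))
      · intro _
        simpa using hν i
      · intro hij
        simpa using h.anti (Fin.castSucc_le_castSucc_iff.1 hij)
    · intro u hu huo i
      have huo' : ∀ i, G (v i) u = 0 := fun i => by simpa using huo i.castSucc
      refine Fin.lastCases ?_ (fun i => ?_) i
      · simpa using hle u ((hW' u).2 ⟨hu, huo'⟩)
      · simpa using h.compl u hu huo' i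

/-- Quadratic form bound in terms of the leading eigenpairs. -/
theorem TopPairs.le_sum {d : ℕ} {lam : Fin (d + 1) → ℝ} {v : Fin (d + 1) → Fin p → ℝ}
    (h : TopPairs M G W lam v) (hM : ∀ u w, M u w = M w u) (hG : ∀ u w, G u w = G w u)
    {u : Fin p → ℝ} (hu : u ∈ W) :
    M u u ≤ ∑ i : Fin d, (lam i.castSucc - lam (Fin.last d)) * G (v i.castSucc) u ^ 2
      + lam (Fin.last d) * G u u := by
  rw [bilin_eq_sum_add_orthPart hM hG h.mem h.eig h.orth hu,
    bilin_self_eq_sum_add_orthPart hG h.mem h.orth hu]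
  have h1 := h.compl _ (orthPart_mem h.mem hu) (bilin_orthPart h.orth u) (Fin.last d)
  have h2 : ∑ i, lam i * G (v i) u ^ 2 =
      ∑ i : Fin d, (lam i.castSucc - lam (Fin.last d)) * G (v i.castSucc) u ^ 2
        + lam (Fin.last d) * ∑ i, G (v i) u ^ 2 := by
    rw [Fin.sum_univ_castSucc, Fin.sum_univ_castSucc (fun i => G (v i) u ^ 2)]
    rw [mul_add, Finset.mul_sum, ← add_assoc, ← Finset.sum_add_distrib]
    congr 1
    exact Finset.sum_congr rfl fun i _ => by ring
  rw [h2, mul_add]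
  linarith

/-- Counterpart of `TopPairs.le_sum`: together they pin the weighted sum down to within `lam
(Fin.last d) * G u u` of `M u u`, whatever the gaps between the eigenvalues. Replacing the weights
by `lam i` and adding the remaining part of `u` only increases the sum, because `M` is nonnegative
on `W`. -/
theorem TopPairs.sum_le {d : ℕ} {lam : Fin (d + 1) → ℝ} {v : Fin (d + 1) → Fin p → ℝ}
    (h : TopPairs M G W lam v) (hM : ∀ u w, M u w = M w u) (hG : ∀ u w, G u w = G w u)
    (hpsd : ∀ u ∈ W, 0 ≤ M u u) (hlast : 0 ≤ lam (Fin.last d)) {u : Fin p → ℝ} (hu : u ∈ W) :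
    ∑ i : Fin d, (lam i.castSucc - lam (Fin.last d)) * G (v i.castSucc) u ^ 2 ≤ M u u := by
  rw [bilin_eq_sum_add_orthPart hM hG h.mem h.eig h.orth hu, Fin.sum_univ_castSucc]
  have h1 := hpsd _ (orthPart_mem (G := G) h.mem hu)
  have h2 : ∑ i : Fin d, (lam i.castSucc - lam (Fin.last d)) * G (v i.castSucc) u ^ 2
      ≤ ∑ i : Fin d, lam i.castSucc * G (v i.castSucc) u ^ 2 :=
    Finset.sum_le_sum fun i _ => by nlinarith [sq_nonneg (G (v i.castSucc) u)]
  nlinarith [sq_nonneg (G (v (Fin.last d)) u)]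

theorem TopPairs.lam_eq (h : TopPairs M G W lam v) (i : Fin r) : M (v i) (v i) = lam i := by
  rw [h.eig i _ (h.mem i), h.orth]; simp

/-- The variational upper bound of Ky Fan for the sum of the leading eigenvalues. -/
theorem TopPairs.kyFan {d : ℕ} {lam : Fin (d + 1) → ℝ} {v : Fin (d + 1) → Fin p → ℝ}
    (h : TopPairs M G W lam v) (hM : ∀ u w, M u w = M w u) (hG : ∀ u w, G u w = G w u)
    (hpos : ∀ u ∈ W, 0 ≤ G u u) (hpsd : ∀ u ∈ W, 0 ≤ M u u) {m : ℕ} (hm : m ≤ d)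
    {u : Fin m → Fin p → ℝ}
    (hu : ∀ k, u k ∈ W) {ρ : ℝ} (hρ : 0 ≤ ρ)
    (hB : ∀ c : Fin m → ℝ, G (∑ k, c k • u k) (∑ k, c k • u k) ≤ ρ * ∑ k, c k ^ 2) :
    ∑ k, M (u k) (u k) ≤ ρ * ∑ i : Fin d, lam i.castSucc := by
  have hlast : 0 ≤ lam (Fin.last d) := h.lam_eq (Fin.last d) ▸ hpsd _ (h.mem _)
  have h1 : ∀ i : Fin (d + 1), ∑ k, G (v i) (u k) ^ 2 ≤ ρ := by
    intro i
    set c : Fin m → ℝ := fun k => G (v i) (u k) with hc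
    have hW : ∑ k, c k • u k ∈ W := W.sum_mem fun k _ => W.smul_mem _ (hu k)
    have h2 := bilin_cauchy_schwarz hG hpos (h.mem i) hW
    have h3 : G (v i) (∑ k, c k • u k) = ∑ k, c k ^ 2 := by
      simp [hc, pow_two]
    rw [h3, h.orth, if_pos rfl, one_mul] at h2
    have h4 := h2.trans (hB c)
    have h5 : 0 ≤ ∑ k, c k ^ 2 := Finset.sum_nonneg fun k _ => sq_nonneg _
    rcases h5.eq_or_lt with h6 | h6
    · change ∑ k, c k ^ 2 ≤ ρ
      rw [← h6]
      exact hρ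
    · change ∑ k, c k ^ 2 ≤ ρ
      nlinarith
  have h2 : ∀ k, G (u k) (u k) ≤ ρ := by
    intro k
    have h7 := hB (Pi.single k 1)
    simpa [Pi.single_apply, ite_smul] using h7
  calc ∑ k, M (u k) (u k)
      ≤ ∑ k, (∑ i : Fin d, (lam i.castSucc - lam (Fin.last d)) * G (v i.castSucc) (u k) ^ 2
        + lam (Fin.last d) * G (u k) (u k)) :=
        Finset.sum_le_sum fun k _ => h.le_sum hM hG (hu k)
    _ = ∑ i : Fin d, (lam i.castSucc - lam (Fin.last d)) * ∑ k, G (v i.castSucc) (u k) ^ 2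
        + lam (Fin.last d) * ∑ k, G (u k) (u k) := by
        rw [Finset.sum_add_distrib, Finset.sum_comm, Finset.mul_sum]
        simp only [Finset.mul_sum]
    _ ≤ ∑ i : Fin d, (lam i.castSucc - lam (Fin.last d)) * ρ
        + lam (Fin.last d) * ∑ k : Fin m, ρ := by
        refine add_le_add (Finset.sum_le_sum fun i _ => ?_)
          (mul_le_mul_of_nonneg_left (Finset.sum_le_sum fun k _ => h2 k) hlast)
        exact mul_le_mul_of_nonneg_left (h1 _)
          (sub_nonneg.2 (h.anti (Fin.castSucc_lt_last i).le))
    _ ≤ ρ * ∑ i : Fin d, lam i.castSucc := by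
        rw [← Finset.sum_mul, Finset.sum_sub_distrib]
        simp only [Finset.sum_const, Finset.card_univ, Fintype.card_fin, nsmul_eq_mul]
        -- What is left over is `lam (Fin.last d) * ρ * (m - d)`, which is nonpositive.
        have h3 : (m : ℝ) ≤ d := by exact_mod_cast hm
        nlinarith [mul_nonneg hlast hρ]

theorem linearIndependent_of_bilin_orth (orth : ∀ i j, G (v i) (v j) = if i = j then 1 else 0) :
    LinearIndependent ℝ v := by
  rw [Fintype.linearIndependent_iff]
  intro c hc i
  rw [← bilin_sum_orth (G := G) orth c i, hc, map_zero]

end GenEigen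

/-! ### Perturbation of the leading generalized eigenvalues -/

section Perturbation

variable {p : ℕ}

/-- A symmetric form dominated by `ε |u|²` on `W` is dominated by `ε |u| |w|`. -/
theorem bilin_sq_le_of_abs_le {E : LinearMap.BilinForm ℝ (Fin p → ℝ)} (hs : ∀ u w, E u w = E w u)
    {W : Submodule ℝ (Fin p → ℝ)} {ε : ℝ} (hE : ∀ u ∈ W, |E u u| ≤ ε * (u ⬝ᵥ u))
    {u w : Fin p → ℝ} (hu : u ∈ W) (hw : w ∈ W) :
    E u w ^ 2 ≤ ε ^ 2 * ((u ⬝ᵥ u) * (w ⬝ᵥ w)) := by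
  -- Polarisation and the parallelogram law, from the lower bound at `u + t w` and the upper bound
  -- at `u - t w`. The discriminant of this quadratic in `t` is then nonpositive.
  have h : ∀ t : ℝ, 0 ≤ (ε * (w ⬝ᵥ w)) * (t * t) + (2 * E u w) * t + ε * (u ⬝ᵥ u) := by
    intro t
    have h1 := hE (u + t • w) (W.add_mem hu (W.smul_mem t hw))
    have h2 := hE (u - t • w) (W.sub_mem hu (W.smul_mem t hw))
    rw [abs_le] at h1 h2
    simp only [map_add, map_sub, LinearMap.add_apply, LinearMap.sub_apply, map_smul,
      LinearMap.smul_apply, smul_eq_mul, hs w u, dotProduct_add, add_dotProduct, dotProduct_sub,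
      sub_dotProduct, smul_dotProduct, dotProduct_smul, dotProduct_comm w u] at h1 h2
    linarith [h1.1, h2.2]
  have := discrim_le_zero h
  rw [discrim] at this
  linarith

/-- The Euclidean inner product as a bilinear form. -/
def dotForm (p : ℕ) : LinearMap.BilinForm ℝ (Fin p → ℝ) := Matrix.toBilin' 1

@[simp] theorem dotForm_apply (u w : Fin p → ℝ) : dotForm p u w = u ⬝ᵥ w := by
  simp [dotForm, Matrix.toBilin'_apply']

theorem dot_self_nonneg (u : Fin p → ℝ) : 0 ≤ u ⬝ᵥ u :=
  Finset.sum_nonneg fun i _ => mul_self_nonneg (u i)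

theorem dot_self_pos {u : Fin p → ℝ} (hu : u ≠ 0) : 0 < u ⬝ᵥ u :=
  (dot_self_nonneg u).lt_of_ne fun h => hu (dotProduct_self_eq_zero.1 h.symm)

theorem dot_sq_le (u w : Fin p → ℝ) : (u ⬝ᵥ w) ^ 2 ≤ (u ⬝ᵥ u) * (w ⬝ᵥ w) := by
  have := Finset.sum_mul_sq_le_sq_mul_sq Finset.univ u w
  simpa [dotProduct, pow_two] using this

/-- The form `∑ k, lam k (b k · u) (b k · w)`. -/
def spikeForm {d : ℕ} (lam : Fin d → ℝ) (b : Fin d → Fin p → ℝ) :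
    LinearMap.BilinForm ℝ (Fin p → ℝ) :=
  LinearMap.mk₂ ℝ (fun u w => ∑ k, lam k * ((b k ⬝ᵥ u) * (b k ⬝ᵥ w)))
    (fun u u' w => by simp [dotProduct_add, add_mul, mul_add, Finset.sum_add_distrib])
    (fun c u w => by
      simp only [dotProduct_smul, smul_eq_mul, Finset.mul_sum]
      exact Finset.sum_congr rfl fun _ _ => by ring)
    (fun u w w' => by simp [dotProduct_add, mul_add, Finset.sum_add_distrib])
    (fun c u w => by
      simp only [dotProduct_smul, smul_eq_mul, Finset.mul_sum]
      exact Finset.sum_congr rfl fun _ _ => by ring)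

theorem spikeForm_apply {d : ℕ} (lam : Fin d → ℝ) (b : Fin d → Fin p → ℝ) (u w : Fin p → ℝ) :
    spikeForm lam b u w = ∑ k, lam k * ((b k ⬝ᵥ u) * (b k ⬝ᵥ w)) := rfl

theorem sum_sq_dot_le {d : ℕ} {b : Fin d → Fin p → ℝ}
    (orth : ∀ i j, b i ⬝ᵥ b j = if i = j then 1 else 0) (u : Fin p → ℝ) :
    ∑ k, (b k ⬝ᵥ u) ^ 2 ≤ u ⬝ᵥ u := by
  have h := bilin_self_eq_sum_add_orthPart (G := dotForm p) (W := ⊤) (v := b) (u := u)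
    (fun u w => by simp [dotProduct_comm]) (fun _ => trivial) (by simpa using orth) trivial
  simp only [dotForm_apply] at h
  linarith [dot_self_nonneg (orthPart (dotForm p) b u)]

/-- `Mh` and `Gh` are, on the subspace `W`, within `ε` of the forms with matrices
`∑ k, lam k b_k b_kᵀ` and `1`, where the `b_k` are orthonormal and `0 ≤ lam ≤ 1`. -/
structure NearSpiked {d : ℕ} (lam : Fin d → ℝ) (b : Fin d → Fin p → ℝ)
    (Mh Gh : LinearMap.BilinForm ℝ (Fin p → ℝ)) (W : Submodule ℝ (Fin p → ℝ)) (ε : ℝ) : Prop where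
  symm_M : ∀ u w, Mh u w = Mh w u
  symm_G : ∀ u w, Gh u w = Gh w u
  orth : ∀ i j, b i ⬝ᵥ b j = if i = j then 1 else 0
  nonneg : ∀ k, 0 ≤ lam k
  le_one : ∀ k, lam k ≤ 1
  psd : ∀ u ∈ W, 0 ≤ Mh u u
  near_M : ∀ u ∈ W, |Mh u u - spikeForm lam b u u| ≤ ε * (u ⬝ᵥ u)
  near_G : ∀ u ∈ W, |Gh u u - u ⬝ᵥ u| ≤ ε * (u ⬝ᵥ u)
  pos : 0 < ε
  le_half : ε ≤ 1 / 2

namespace NearSpiked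

variable {d : ℕ} {lam₀ : Fin d → ℝ} {b : Fin d → Fin p → ℝ}
  {Mh Gh : LinearMap.BilinForm ℝ (Fin p → ℝ)} {W : Submodule ℝ (Fin p → ℝ)} {ε : ℝ}
  {r : ℕ} {lam : Fin r → ℝ} {v : Fin r → Fin p → ℝ}

theorem spike_nonneg (H : NearSpiked lam₀ b Mh Gh W ε) (u : Fin p → ℝ) :
    0 ≤ spikeForm lam₀ b u u := by
  rw [spikeForm_apply]
  exact Finset.sum_nonneg fun k _ => mul_nonneg (H.nonneg k) (mul_self_nonneg _)

theorem spike_le (H : NearSpiked lam₀ b Mh Gh W ε) (u : Fin p → ℝ) :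
    spikeForm lam₀ b u u ≤ u ⬝ᵥ u := by
  rw [spikeForm_apply]
  refine le_trans (Finset.sum_le_sum fun k _ => ?_) (sum_sq_dot_le H.orth u)
  nlinarith [H.le_one k, mul_self_nonneg (b k ⬝ᵥ u)]

theorem le_G (H : NearSpiked lam₀ b Mh Gh W ε) {u : Fin p → ℝ} (hu : u ∈ W) :
    (1 - ε) * (u ⬝ᵥ u) ≤ Gh u u := by linarith [(abs_le.1 (H.near_G u hu)).1]

theorem G_le (H : NearSpiked lam₀ b Mh Gh W ε) {u : Fin p → ℝ} (hu : u ∈ W) :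
    Gh u u ≤ (1 + ε) * (u ⬝ᵥ u) := by linarith [(abs_le.1 (H.near_G u hu)).2]

theorem G_pos (H : NearSpiked lam₀ b Mh Gh W ε) {u : Fin p → ℝ} (hu : u ∈ W) (h0 : u ≠ 0) :
    0 < Gh u u := by
  have := dot_self_pos h0
  nlinarith [H.le_G hu, H.le_half]

theorem G_nonneg (H : NearSpiked lam₀ b Mh Gh W ε) {u : Fin p → ℝ} (hu : u ∈ W) :
    0 ≤ Gh u u := by
  nlinarith [H.le_G hu, H.le_half, dot_self_nonneg u]

theorem dot_self_le_two (H : NearSpiked lam₀ b Mh Gh W ε) {u : Fin p → ℝ} (hu : u ∈ W) :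
    u ⬝ᵥ u ≤ 2 * Gh u u := by
  nlinarith [H.le_G hu, H.le_half, dot_self_nonneg u]

/-- Bessel's inequality for a `Gh`-orthonormal family. -/
theorem bessel (H : NearSpiked lam₀ b Mh Gh W ε) (mem : ∀ i, v i ∈ W)
    (orth : ∀ i j, Gh (v i) (v j) = if i = j then 1 else 0) (u : Fin p → ℝ) :
    (1 - ε) * ∑ i, (v i ⬝ᵥ u) ^ 2 ≤ u ⬝ᵥ u := by
  set c : Fin r → ℝ := fun i => v i ⬝ᵥ u with hc
  set s := ∑ i, c i • v i with hs
  have hsW : s ∈ W := W.sum_mem fun i _ => W.smul_mem _ (mem i)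
  have h1 : s ⬝ᵥ u = ∑ i, c i ^ 2 := by simp [hs, sum_dotProduct, hc, pow_two]
  have h2 := H.le_G hsW
  rw [hs, bilin_sum_sum_orth orth, ← hs] at h2
  have h3 := dot_sq_le s u
  rw [h1] at h3
  have h5 : 0 ≤ ∑ i, c i ^ 2 := Finset.sum_nonneg fun k _ => sq_nonneg _
  change (1 - ε) * ∑ i, c i ^ 2 ≤ u ⬝ᵥ u
  have hε := H.le_half
  rcases h5.eq_or_lt with h6 | h6
  · rw [← h6]; simpa using dot_self_nonneg u
  · have h7 : (1 - ε) * ((s ⬝ᵥ s) * (u ⬝ᵥ u)) ≤ (∑ i, c i ^ 2) * (u ⬝ᵥ u) := by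
      nlinarith [dot_self_nonneg u]
    have h8 : (∑ i, c i ^ 2) * ((1 - ε) * ∑ i, c i ^ 2) ≤ (∑ i, c i ^ 2) * (u ⬝ᵥ u) := by
      nlinarith
    exact le_of_mul_le_mul_left h8 h6

/-- The eigenvalue is at most (1 + ε)|v|², where ε ≤ 1/2 and |v|² ≤ 2 by normalisation. The bound
serves only to control the weights in the scores. -/
theorem lam_le_three (H : NearSpiked lam₀ b Mh Gh W ε) (h : TopPairs Mh Gh W lam v) (i : Fin r) :
    lam i ≤ 3 := by
  rw [← h.lam_eq i]
  have h1 := (abs_le.1 (H.near_M _ (h.mem i))).2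
  have h2 := H.spike_le (v i)
  have h3 := H.dot_self_le_two (h.mem i)
  rw [h.orth, if_pos rfl] at h3
  nlinarith [H.le_half, dot_self_nonneg (v i)]

theorem lam_nonneg (H : NearSpiked lam₀ b Mh Gh W ε) (h : TopPairs Mh Gh W lam v) (i : Fin r) :
    0 ≤ lam i := by
  rw [← h.lam_eq i]
  exact H.psd _ (h.mem i)

/-- The eigenvalue after the `d` leading ones is small. -/
theorem lam_last_le {lam : Fin (d + 1) → ℝ} {v : Fin (d + 1) → Fin p → ℝ}
    (H : NearSpiked lam₀ b Mh Gh W ε) (h : TopPairs Mh Gh W lam v) :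
    lam (Fin.last d) ≤ 2 * ε := by
  -- By counting dimensions, the span of the `d + 1` eigenvectors contains some `u ≠ 0` orthogonal
  -- to all `b k`. There the spiked form vanishes, so `Mh u u` is at most ε|u|² ≤ 2ε `Gh u u`, while
  -- it is at least `lam (Fin.last d) * Gh u u`.
  let L : (Fin (d + 1) → ℝ) →ₗ[ℝ] (Fin d → ℝ) :=
    LinearMap.pi fun k => ∑ i, (b k ⬝ᵥ v i) • LinearMap.proj i
  have hL : LinearMap.ker L ≠ ⊥ := LinearMap.ker_ne_bot_of_finrank_lt (by simp)
  obtain ⟨c, hc, hc0⟩ := (LinearMap.ker L).exists_mem_ne_zero_of_ne_bot hL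
  set u := ∑ i, c i • v i with hu
  have huW : u ∈ W := W.sum_mem fun i _ => W.smul_mem _ (h.mem i)
  have hbu : ∀ k, b k ⬝ᵥ u = 0 := by
    intro k
    have h1 := congrFun (LinearMap.mem_ker.1 hc) k
    simp only [L, LinearMap.pi_apply, LinearMap.sum_apply, LinearMap.smul_apply,
      LinearMap.proj_apply, smul_eq_mul, Pi.zero_apply] at h1
    rw [hu, dotProduct_sum, ← h1]
    exact Finset.sum_congr rfl fun i _ => by rw [dotProduct_smul, smul_eq_mul, mul_comm]
  have hM0 : spikeForm lam₀ b u u = 0 := by simp [spikeForm_apply, hbu]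
  have hGu : Gh u u = ∑ i, c i ^ 2 := bilin_sum_sum_orth h.orth c
  have hMu : Mh u u = ∑ i, lam i * c i ^ 2 + Mh (orthPart Gh v u) (orthPart Gh v u) := by
    rw [bilin_eq_sum_add_orthPart H.symm_M H.symm_G h.mem h.eig h.orth huW]
    simp only [hu, bilin_sum_orth h.orth]
  have hlow : lam (Fin.last d) * ∑ i, c i ^ 2 ≤ Mh u u := by
    rw [hMu, Finset.mul_sum]
    have := H.psd _ (orthPart_mem (G := Gh) h.mem huW)
    have h2 : ∑ i, lam (Fin.last d) * c i ^ 2 ≤ ∑ i, lam i * c i ^ 2 :=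
      Finset.sum_le_sum fun i _ => mul_le_mul_of_nonneg_right (h.anti (Fin.le_last i)) (sq_nonneg _)
    linarith
  have hup := (abs_le.1 (H.near_M u huW)).2
  have h2 := H.dot_self_le_two huW
  rw [hGu] at h2
  have hpos : 0 < ∑ i, c i ^ 2 := by
    obtain ⟨i, hi⟩ := Function.ne_iff.1 hc0
    exact Finset.sum_pos' (fun i _ => sq_nonneg _) ⟨i, Finset.mem_univ i, by
      have : c i ≠ 0 := hi
      positivity⟩
  have h3 : lam (Fin.last d) * ∑ i, c i ^ 2 ≤ (2 * ε) * ∑ i, c i ^ 2 := by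
    nlinarith [H.pos]
  exact le_of_mul_le_mul_right h3 hpos

/-- The mass of the spiked form on `W`. -/
def spikeMass (lam₀ : Fin d → ℝ) (b' : Fin d → Fin p → ℝ) : ℝ := ∑ k, lam₀ k * (b' k ⬝ᵥ b' k)

/-- The sum of the `d` leading generalized eigenvalues is close to the trace of the spiked form
on `W`. The vectors `b'` represent the vectors `b` on `W`. -/
theorem abs_sum_lam_sub_le {lam : Fin (d + 1) → ℝ} {v : Fin (d + 1) → Fin p → ℝ}
    (H : NearSpiked lam₀ b Mh Gh W ε) (h : TopPairs Mh Gh W lam v) {b' : Fin d → Fin p → ℝ}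
    (hb'W : ∀ k, b' k ∈ W) (hb' : ∀ k, ∀ u ∈ W, b k ⬝ᵥ u = b' k ⬝ᵥ u) :
    |∑ i : Fin d, lam i.castSucc - spikeMass lam₀ b'| ≤ 4 * d * ε := by
  have hε := H.le_half
  have hε0 := H.pos
  have hb1 : ∀ k, b' k ⬝ᵥ b' k ≤ 1 := by
    intro k
    have h1 := hb' k _ (hb'W k)
    have h2 := dot_sq_le (b k) (b' k)
    rw [H.orth, if_pos rfl, h1] at h2
    nlinarith
  have hT0 : 0 ≤ spikeMass lam₀ b' :=
    Finset.sum_nonneg fun k _ => mul_nonneg (H.nonneg k) (dot_self_nonneg _)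
  have hTd : spikeMass lam₀ b' ≤ d := by
    calc spikeMass lam₀ b' ≤ ∑ k : Fin d, (1 : ℝ) := Finset.sum_le_sum fun k _ =>
          mul_le_one₀ (H.le_one k) (dot_self_nonneg _) (hb1 k)
      _ = d := by simp
  have hF : ∑ i : Fin d, lam i.castSucc = ∑ i : Fin d, Mh (v i.castSucc) (v i.castSucc) :=
    Finset.sum_congr rfl fun i _ => (h.lam_eq _).symm
  have hd0 : (0 : ℝ) ≤ d := by positivity
  rw [abs_le]
  constructor
  · set W' := Submodule.span ℝ (Set.range b')
    have hW'W : W' ≤ W := Submodule.span_le.2 (by rintro _ ⟨k, rfl⟩; exact hb'W k)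
    -- Lower bound: the Euclidean form paired with itself supplies an orthonormal basis `o` of the
    -- span of `b'`. The trace of the spiked form over `o` is the full mass, and Ky Fan's bound
    -- applies with ρ = 1 + ε. The span may have dimension below `d`.
    obtain ⟨l, o, ho⟩ := exists_topPairs (M := dotForm p) (G := dotForm p) (W := W')
      (fun u w => by simp [dotProduct_comm]) (fun u w => by simp [dotProduct_comm])
      (fun u _ hu => by simpa using dot_self_pos hu) (Module.finrank ℝ W') le_rfl
    have hm : Module.finrank ℝ W' ≤ d := by
      have := finrank_range_le_card (R := ℝ) b'
      rwa [Set.finrank, Fintype.card_fin] at this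
    have hspan : Submodule.span ℝ (Set.range o) = W' := by
      refine Submodule.eq_of_le_of_finrank_eq
        (Submodule.span_le.2 (by rintro _ ⟨k, rfl⟩; exact ho.mem k)) ?_
      rw [finrank_span_eq_card (linearIndependent_of_bilin_orth ho.orth), Fintype.card_fin]
    have hbo : ∀ k, b' k ⬝ᵥ b' k = ∑ i, (b' k ⬝ᵥ o i) ^ 2 := by
      intro k
      have h1 : b' k ∈ Submodule.span ℝ (Set.range o) := by
        rw [hspan]; exact Submodule.subset_span ⟨k, rfl⟩
      obtain ⟨c, hc⟩ := (Submodule.mem_span_range_iff_exists_fun ℝ).1 h1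
      have h2 := bilin_sum_sum_orth ho.orth c
      have h3 := fun i => bilin_sum_orth ho.orth c i
      rw [hc] at h2 h3
      simp only [dotForm_apply] at h2 h3
      rw [h2]
      exact Finset.sum_congr rfl fun i _ => by rw [dotProduct_comm, h3]
    have hkf := h.kyFan H.symm_M H.symm_G (fun u hu => H.G_nonneg hu) H.psd hm
      (fun k => hW'W (ho.mem k)) (ρ := 1 + ε) (by linarith) (fun c => by
        have hcW : ∑ k, c k • o k ∈ W := W.sum_mem fun k _ => W.smul_mem _ (hW'W (ho.mem k))
        have h1 := H.G_le hcW
        have h2 := bilin_sum_sum_orth ho.orth c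
        rw [dotForm_apply] at h2
        rwa [h2] at h1)
    have hlow : spikeMass lam₀ b' - d * ε ≤ ∑ k, Mh (o k) (o k) := by
      have h1 : spikeMass lam₀ b' = ∑ i, spikeForm lam₀ b (o i) (o i) := by
        simp only [spikeMass, spikeForm_apply]
        rw [Finset.sum_comm]
        refine Finset.sum_congr rfl fun k _ => ?_
        rw [hbo, Finset.mul_sum]
        refine Finset.sum_congr rfl fun i _ => ?_
        rw [hb' k _ (hW'W (ho.mem i))]
        ring
      have h2 : ∀ i, spikeForm lam₀ b (o i) (o i) - ε ≤ Mh (o i) (o i) := by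
        intro i
        have h3 := (abs_le.1 (H.near_M _ (hW'W (ho.mem i)))).1
        have h4 := ho.orth i i
        rw [dotForm_apply, if_pos rfl] at h4
        rw [h4] at h3
        linarith
      have h3 := Finset.sum_le_sum fun i (_ : i ∈ Finset.univ) => h2 i
      rw [Finset.sum_sub_distrib, ← h1] at h3
      simp only [Finset.sum_const, Finset.card_univ, Fintype.card_fin, nsmul_eq_mul] at h3
      have : (Module.finrank ℝ W' : ℝ) ≤ d := by exact_mod_cast hm
      nlinarith
    have hF0 : 0 ≤ ∑ i : Fin d, lam i.castSucc := Finset.sum_nonneg fun i _ => H.lam_nonneg h _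
    -- Ky Fan gives (1 + ε)F ≥ T - dε for the sum F and the mass T. If F were below T - 4dε, it
    -- would be at most d, so that εF ≤ dε and F ≥ T - 2dε.
    by_contra hcon
    push Not at hcon
    have h5 : (0 : ℝ) ≤ d * ε := by positivity
    have h6 : ∑ i : Fin d, lam i.castSucc ≤ d := by linarith
    have h7 := mul_le_mul_of_nonneg_left h6 hε0.le
    linarith
  · have h1 : ∀ i : Fin d, Mh (v i.castSucc) (v i.castSucc)
        ≤ spikeForm lam₀ b (v i.castSucc) (v i.castSucc) + 2 * ε := by
      intro i
      have h2 := (abs_le.1 (H.near_M _ (h.mem i.castSucc))).2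
      have h3 := H.dot_self_le_two (h.mem i.castSucc)
      rw [h.orth, if_pos rfl] at h3
      nlinarith
    -- Upper bound: Bessel's inequality for the eigenvectors, applied to each `b' k` and weighted by
    -- `lam₀ k`.
    have h2 : (1 - ε) * ∑ i : Fin d, spikeForm lam₀ b (v i.castSucc) (v i.castSucc)
        ≤ spikeMass lam₀ b' := by
      have h3 : ∑ i : Fin d, spikeForm lam₀ b (v i.castSucc) (v i.castSucc)
          = ∑ k, lam₀ k * ∑ i : Fin d, (v i.castSucc ⬝ᵥ b' k) ^ 2 := by
        simp only [spikeForm_apply, Finset.mul_sum]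
        rw [Finset.sum_comm]
        refine Finset.sum_congr rfl fun k _ => Finset.sum_congr rfl fun i _ => ?_
        rw [hb' k _ (h.mem _), dotProduct_comm]
        ring
      rw [h3, Finset.mul_sum]
      refine Finset.sum_le_sum fun k _ => ?_
      have h4 := H.bessel (v := fun i : Fin d => v i.castSucc) (fun i => h.mem _)
        (fun i j => by rw [h.orth]; simp) (b' k)
      nlinarith [H.nonneg k]
    have h3 := Finset.sum_le_sum fun i (_ : i ∈ Finset.univ) => h1 i
    rw [← hF, Finset.sum_add_distrib] at h3
    simp only [Finset.sum_const, Finset.card_univ, Fintype.card_fin, nsmul_eq_mul] at h3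
    set Q := ∑ i : Fin d, spikeForm lam₀ b (v i.castSucc) (v i.castSucc)
    -- From (1 - ε)Q ≤ T first Q ≤ 2T, then Q ≤ T + εQ ≤ T + 2εT, and T ≤ d.
    have hQ : Q ≤ spikeMass lam₀ b' + 2 * ε * d := by
      have hQ0 : Q ≤ 2 * spikeMass lam₀ b' := by
        have : 0 ≤ Q := Finset.sum_nonneg fun i _ => H.spike_nonneg _
        nlinarith
      nlinarith
    linarith

end NearSpiked

end Perturbation

/-! ### Loadings and residuals of the leading eigenvectors -/

section Scores

variable {p : ℕ}

namespace NearSpiked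

variable {d : ℕ} {lam₀ : Fin d → ℝ} {b : Fin d → Fin p → ℝ}
  {Mh Gh : LinearMap.BilinForm ℝ (Fin p → ℝ)} {W : Submodule ℝ (Fin p → ℝ)} {ε : ℝ}
  {r : ℕ} {lam : Fin r → ℝ} {v : Fin r → Fin p → ℝ}

theorem G_sub_dot_sq_le (H : NearSpiked lam₀ b Mh Gh W ε) {u w : Fin p → ℝ} (hu : u ∈ W)
    (hw : w ∈ W) : (Gh u w - u ⬝ᵥ w) ^ 2 ≤ ε ^ 2 * ((u ⬝ᵥ u) * (w ⬝ᵥ w)) := by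
  have := bilin_sq_le_of_abs_le (E := Gh - dotForm p)
    (fun u w => by simp [H.symm_G u w, dotProduct_comm]) (W := W) (ε := ε)
    (fun u hu => by simpa using H.near_G u hu) hu hw
  simpa using this

theorem M_sub_spike_sq_le (H : NearSpiked lam₀ b Mh Gh W ε) {u w : Fin p → ℝ} (hu : u ∈ W)
    (hw : w ∈ W) :
    (Mh u w - spikeForm lam₀ b u w) ^ 2 ≤ ε ^ 2 * ((u ⬝ᵥ u) * (w ⬝ᵥ w)) := by
  have hs : ∀ u w, spikeForm lam₀ b u w = spikeForm lam₀ b w u := fun u w => by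
    simp only [spikeForm_apply]
    exact Finset.sum_congr rfl fun _ _ => by ring
  have := bilin_sq_le_of_abs_le (E := Mh - spikeForm lam₀ b)
    (fun u w => by simp [H.symm_M u w, hs u w]) (W := W) (ε := ε)
    (fun u hu => by simpa using H.near_M u hu) hu hw
  simpa using this

/-- The weighted squared loadings along a unit vector approximate the spiked form. -/
theorem abs_score_sub_le {lam : Fin (d + 1) → ℝ} {v : Fin (d + 1) → Fin p → ℝ}
    (H : NearSpiked lam₀ b Mh Gh W ε) (h : TopPairs Mh Gh W lam v) {e : Fin p → ℝ} (he : e ∈ W)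
    (he1 : e ⬝ᵥ e = 1) :
    |∑ i : Fin d, (lam i.castSucc - lam (Fin.last d)) * (v i.castSucc ⬝ᵥ e) ^ 2
      - spikeForm lam₀ b e e| ≤ 13 * ε := by
  have hε := H.le_half
  have hε0 := H.pos
  set m := spikeForm lam₀ b e e with hm
  have hm0 : 0 ≤ m := H.spike_nonneg e
  have hm1 : m ≤ 1 := he1 ▸ H.spike_le e
  have hlast0 : 0 ≤ lam (Fin.last d) := H.lam_nonneg h _
  have hlast := H.lam_last_le h
  set wt : Fin d → ℝ := fun i => lam i.castSucc - lam (Fin.last d) with hwt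
  have hwt0 : ∀ i, 0 ≤ wt i := fun i => sub_nonneg.2 (h.anti (Fin.castSucc_lt_last i).le)
  have hwt3 : ∀ i, wt i ≤ 3 := fun i => by
    have h1 := H.lam_le_three h i.castSucc
    simp only [hwt]
    linarith
  set B := ∑ i, wt i * Gh (v i.castSucc) e ^ 2 with hB
  have hMe := abs_le.1 (H.near_M e he)
  have hGe := H.G_le he
  rw [he1] at hMe hGe
  have hB1 : B ≤ m + ε := by
    have := h.sum_le H.symm_M H.symm_G H.psd hlast0 he
    linarith [hMe.2]
  have hB2 : m - 5 * ε ≤ B := by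
    have h1 := h.le_sum H.symm_M H.symm_G he
    have h2 : lam (Fin.last d) * Gh e e ≤ 2 * ε * 2 := by
      apply mul_le_mul hlast (by linarith) (H.G_nonneg he) (by linarith)
    linarith [hMe.1]
  -- The spectral bounds control the `Gh`-loadings, whereas the scores use Euclidean loadings; `c`
  -- is the difference.
  set c : Fin d → ℝ := fun i => Gh (v i.castSucc) e - v i.castSucc ⬝ᵥ e with hc
  have hcsum : ∑ i, c i ^ 2 ≤ 2 * ε ^ 2 := by
    -- Self-bounding: Σ c² is the value of `Gh - dot` at `(s, e)`, hence at most ε|s|, and |s|² ≤ 2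
    -- Σ c².
    set s := ∑ i : Fin d, c i • v i.castSucc with hs
    have hsW : s ∈ W := W.sum_mem fun i _ => W.smul_mem _ (h.mem _)
    have h1 : Gh s e - s ⬝ᵥ e = ∑ i, c i ^ 2 := by
      simp only [hs, map_sum, LinearMap.sum_apply, sum_dotProduct, map_smul, LinearMap.smul_apply,
        smul_dotProduct, smul_eq_mul, ← Finset.sum_sub_distrib]
      exact Finset.sum_congr rfl fun i _ => by simp only [hc]; ring
    have h2 := H.G_sub_dot_sq_le hsW he
    rw [h1, he1, mul_one] at h2
    have h3 := H.dot_self_le_two hsW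
    have h4 := bilin_sum_sum_orth (G := Gh) (v := fun i : Fin d => v i.castSucc)
      (fun i j => by rw [h.orth]; simp) c
    rw [← hs] at h4
    rw [h4] at h3
    have h5 : 0 ≤ ∑ i, c i ^ 2 := Finset.sum_nonneg fun k _ => sq_nonneg _
    rcases h5.eq_or_lt with h6 | h6
    · rw [← h6]; positivity
    · have h7 : (∑ i, c i ^ 2) * (∑ i, c i ^ 2) ≤ (2 * ε ^ 2) * ∑ i, c i ^ 2 := by
        nlinarith [sq_nonneg ε]
      exact le_of_mul_le_mul_right h7 h6
  have hC : ∑ i, wt i * c i ^ 2 ≤ 6 * ε ^ 2 := by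
    calc ∑ i, wt i * c i ^ 2 ≤ ∑ i, 3 * c i ^ 2 :=
          Finset.sum_le_sum fun i _ => mul_le_mul_of_nonneg_right (hwt3 i) (sq_nonneg _)
      _ ≤ 6 * ε ^ 2 := by rw [← Finset.mul_sum]; linarith
  have hve : ∀ i : Fin d, v i.castSucc ⬝ᵥ e = Gh (v i.castSucc) e - c i := fun i => by
    simp only [hc]; ring
  have hCε : ε⁻¹ * ∑ i, wt i * c i ^ 2 ≤ 6 * ε := by
    rw [inv_mul_le_iff₀ hε0]; linarith
  -- Young's inequality with parameter ε: (x - c)² ≤ (1 + ε)x² + (1 + 1/ε)c², and below (x - c)² ≥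
  -- (1 - ε)x² - c²/ε. As Σ `wt` c² is of order ε², the division by ε costs only order ε.
  have hup : ∑ i, wt i * (v i.castSucc ⬝ᵥ e) ^ 2
      ≤ (1 + ε) * B + (∑ i, wt i * c i ^ 2 + ε⁻¹ * ∑ i, wt i * c i ^ 2) := by
    rw [hB, Finset.mul_sum, Finset.mul_sum, ← Finset.sum_add_distrib, ← Finset.sum_add_distrib]
    refine Finset.sum_le_sum fun i _ => ?_
    rw [hve]
    have h1 : 0 ≤ ε⁻¹ * (ε * Gh (v i.castSucc) e + c i) ^ 2 := by positivity
    have h2 : ε⁻¹ * (ε * Gh (v i.castSucc) e + c i) ^ 2 = ε * Gh (v i.castSucc) e ^ 2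
        + 2 * Gh (v i.castSucc) e * c i + ε⁻¹ * c i ^ 2 := by field_simp; ring
    rw [h2] at h1
    nlinarith [mul_nonneg (hwt0 i) h1]
  have hlow : (1 - ε) * B - ε⁻¹ * ∑ i, wt i * c i ^ 2
      ≤ ∑ i, wt i * (v i.castSucc ⬝ᵥ e) ^ 2 := by
    rw [hB, Finset.mul_sum, Finset.mul_sum, ← Finset.sum_sub_distrib]
    refine Finset.sum_le_sum fun i _ => ?_
    rw [hve]
    have h1 : 0 ≤ ε⁻¹ * (ε * Gh (v i.castSucc) e - c i) ^ 2 := by positivity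
    have h2 : ε⁻¹ * (ε * Gh (v i.castSucc) e - c i) ^ 2 = ε * Gh (v i.castSucc) e ^ 2
        - 2 * Gh (v i.castSucc) e * c i + ε⁻¹ * c i ^ 2 := by field_simp; ring
    rw [h2] at h1
    nlinarith [mul_nonneg (hwt0 i) h1, mul_nonneg (hwt0 i) (sq_nonneg (c i))]
  -- With m - 5ε ≤ B ≤ m + ε, m ≤ 1 and ε ≤ 1/2, the lower error is at most 12ε and the upper one at
  -- most 8ε + 7ε², both below 13ε.
  rw [abs_le]
  constructor
  · nlinarith
  · nlinarith

/-- If `b` lies in `W`, the leading `d` eigenvalues are bounded below. -/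
theorem half_le_lam {lam v} (hd : 0 < d) (H : NearSpiked lam₀ b Mh Gh W ε)
    (h : TopPairs (r := d) Mh Gh W lam v) (hb : ∀ k, b k ∈ W) {l : ℝ} (hl : ∀ k, l ≤ lam₀ k)
    (hεl : ε ≤ l / 4) (i : Fin d) : l / 2 ≤ lam i := by
  obtain ⟨m, rfl⟩ : ∃ m, d = m + 1 := ⟨d - 1, by omega⟩
  refine le_trans ?_ (h.anti (Fin.le_last i))
  -- By counting dimensions, the span of the `b k` contains some `u ≠ 0` that is `Gh`-orthogonal to
  -- all eigenvectors but the last. There `Mh u u` is at most the last eigenvalue times `Gh u u`,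
  -- and at least (l - ε)|u|².
  let L : (Fin (m + 1) → ℝ) →ₗ[ℝ] (Fin m → ℝ) :=
    LinearMap.pi fun j => ∑ k, (Gh (v j.castSucc) (b k)) • LinearMap.proj k
  have hL : LinearMap.ker L ≠ ⊥ := LinearMap.ker_ne_bot_of_finrank_lt (by simp)
  obtain ⟨c, hc, hc0⟩ := (LinearMap.ker L).exists_mem_ne_zero_of_ne_bot hL
  set u := ∑ i, c i • b i with hu
  have huW : u ∈ W := W.sum_mem fun i _ => W.smul_mem _ (hb i)
  have hvu : ∀ j : Fin m, Gh (v j.castSucc) u = 0 := by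
    intro j
    have h1 := congrFun (LinearMap.mem_ker.1 hc) j
    simp only [L, LinearMap.pi_apply, LinearMap.sum_apply, LinearMap.smul_apply,
      LinearMap.proj_apply, smul_eq_mul, Pi.zero_apply] at h1
    rw [hu, map_sum, ← h1]
    exact Finset.sum_congr rfl fun i _ => by rw [map_smul, smul_eq_mul, mul_comm]
  have horth : ∀ i j, dotForm p (b i) (b j) = if i = j then 1 else 0 := by simpa using H.orth
  have huu : u ⬝ᵥ u = ∑ i, c i ^ 2 := by
    rw [← dotForm_apply]
    exact bilin_sum_sum_orth horth c
  have hbu : ∀ k, b k ⬝ᵥ u = c k := fun k => by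
    rw [← dotForm_apply]
    exact bilin_sum_orth horth c k
  have hsp : l * ∑ i, c i ^ 2 ≤ spikeForm lam₀ b u u := by
    rw [spikeForm_apply, Finset.mul_sum]
    refine Finset.sum_le_sum fun k _ => ?_
    rw [hbu, ← pow_two]
    exact mul_le_mul_of_nonneg_right (hl k) (sq_nonneg _)
  have hup : Mh u u ≤ lam (Fin.last m) * Gh u u := by
    rw [bilin_eq_sum_add_orthPart H.symm_M H.symm_G h.mem h.eig h.orth huW,
      bilin_self_eq_sum_add_orthPart H.symm_G h.mem h.orth huW, Fin.sum_univ_castSucc,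
      Fin.sum_univ_castSucc]
    simp only [hvu]
    have := h.compl _ (orthPart_mem h.mem huW) (bilin_orthPart h.orth u) (Fin.last m)
    simp
    linarith
  have hlow := (abs_le.1 (H.near_M u huW)).1
  have hG := H.G_le huW
  rw [huu] at hlow hG
  have hpos : 0 < ∑ i, c i ^ 2 := by
    obtain ⟨i, hi⟩ := Function.ne_iff.1 hc0
    exact Finset.sum_pos' (fun i _ => sq_nonneg _) ⟨i, Finset.mem_univ i, by
      have : c i ≠ 0 := hi
      positivity⟩
  have h0 := H.lam_nonneg h (Fin.last m)
  have hl1 : l ≤ 1 := (hl 0).trans (H.le_one 0)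
  have hε0 := H.pos
  have h3 : (l - ε) * ∑ i, c i ^ 2 ≤ (lam (Fin.last m) * (1 + ε)) * ∑ i, c i ^ 2 := by
    nlinarith
  have h4 := le_of_mul_le_mul_right h3 hpos
  nlinarith

/-- The component of a leading eigenvector outside the column space of `b` is small. -/
theorem residual_le {lam v} (hd : 0 < d) (H : NearSpiked lam₀ b Mh Gh W ε)
    (h : TopPairs (r := d) Mh Gh W lam v) (hb : ∀ k, b k ∈ W) {l : ℝ} (hl : ∀ k, l ≤ lam₀ k)
    (hl0 : 0 < l) (hεl : ε ≤ l / 4) (i : Fin d) :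
    orthPart (dotForm p) b (v i) ⬝ᵥ orthPart (dotForm p) b (v i) ≤ 18 * ε ^ 2 / l ^ 2 := by
  set w := orthPart (dotForm p) b (v i) with hw
  have hwW : w ∈ W := orthPart_mem hb (h.mem i)
  have horth : ∀ i j, dotForm p (b i) (b j) = if i = j then 1 else 0 := by simpa using H.orth
  have hbw : ∀ k, b k ⬝ᵥ w = 0 := fun k => by simpa using bilin_orthPart horth (v i) k
  have hwv : w ⬝ᵥ v i = w ⬝ᵥ w := by
    have h1 : v i = w + ∑ k, (b k ⬝ᵥ v i) • b k := by rw [hw, orthPart]; simp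
    conv_lhs => rw [h1]
    rw [dotProduct_add, dotProduct_sum]
    simp [dotProduct_comm w, hbw]
  -- The spiked form does not see `w`, so the eigenvalue equation leaves `lam i * Gh w (v i)` of
  -- order ε|w|. But `Gh w (v i)` is close to the Euclidean product, which is |w|². As `lam i ≥ l /
  -- 2`, this forces |w| to be of order ε/l.
  have hsp : spikeForm lam₀ b w (v i) = 0 := by simp [spikeForm_apply, hbw]
  have h1 := H.M_sub_spike_sq_le hwW (h.mem i)
  rw [hsp, sub_zero, h.eig i w hwW] at h1
  have h2 := H.G_sub_dot_sq_le hwW (h.mem i)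
  rw [hwv] at h2
  have h3 := H.dot_self_le_two (h.mem i)
  rw [h.orth, if_pos rfl, mul_one] at h3
  have hlam := H.half_le_lam hd h hb hl hεl i
  have hl1 : l ≤ 1 := (hl i).trans (H.le_one i)
  have hε0 := H.pos
  set g := Gh w (v i)
  set x := w ⬝ᵥ w with hx
  have hx0 : 0 ≤ x := dot_self_nonneg w
  set D := ε ^ 2 * (x * (v i ⬝ᵥ v i)) with hD
  have hD2 : D ≤ 2 * ε ^ 2 * x := by
    have : x * (v i ⬝ᵥ v i) ≤ x * 2 := mul_le_mul_of_nonneg_left h3 hx0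
    nlinarith [sq_nonneg ε]
  have hg : l ^ 2 * g ^ 2 ≤ 4 * D := by
    have : (l / 2) ^ 2 ≤ lam i ^ 2 := by gcongr
    nlinarith [sq_nonneg g]
  have hgx : l ^ 2 * (g - x) ^ 2 ≤ D := by
    have : l ^ 2 ≤ 1 := by nlinarith
    nlinarith [sq_nonneg (g - x)]
  -- The triangle inequality for l x = l g - l (g - x), whose two terms are at most 2√D and √D in
  -- modulus; the square `h7` bounds the cross term without taking roots.
  have hx2 : l ^ 2 * x ^ 2 ≤ 9 * D := by
    have h5 : (l * g) ^ 2 ≤ 4 * D := by nlinarith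
    have h6 : (l * (g - x)) ^ 2 ≤ D := by nlinarith
    have h7 : 0 ≤ (l * g + 2 * (l * (g - x))) ^ 2 := sq_nonneg _
    nlinarith
  rw [le_div_iff₀ (by positivity)]
  rcases hx0.eq_or_lt with h6 | h6
  · rw [← h6, zero_mul]; positivity
  · have : x * (x * l ^ 2) ≤ x * (18 * ε ^ 2) := by nlinarith
    exact le_of_mul_le_mul_left this h6

end NearSpiked

end Scores

/-! ### The sine-theta loss -/

section Loss

variable {p d : ℕ}

theorem orthonormalize_col_dot {U : Matrix (Fin p) (Fin d) ℝ}
    (hU : LinearIndependent ℝ fun i j => U j i) (i i' : Fin d) :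
    (fun j => orthonormalize U j i) ⬝ᵥ (fun j => orthonormalize U j i')
      = if i = i' then 1 else 0 := by
  have hli : LinearIndependent ℝ
      (fun i' : Fin d => (WithLp.toLp 2 (fun j' => U j' i') : EuclideanSpace ℝ (Fin p))) :=
    hU.map' (WithLp.linearEquiv 2 ℝ (Fin p → ℝ)).symm.toLinearMap (LinearEquiv.ker _)
  have h := InnerProductSpace.gramSchmidtNormed_orthonormal hli
  rw [orthonormal_iff_ite] at h
  have h1 := h i i'
  rw [PiLp.inner_apply] at h1
  simpa [orthonormalize, dotProduct, mul_comm] using h1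

theorem orthonormalize_col_mem_span (U : Matrix (Fin p) (Fin d) ℝ) (i : Fin d) :
    (fun j => orthonormalize U j i) ∈ Submodule.span ℝ (Set.range fun i j => U j i) := by
  set f : Fin d → EuclideanSpace ℝ (Fin p) := fun i' => WithLp.toLp 2 (fun j' => U j' i') with hf
  have h1 : InnerProductSpace.gramSchmidtNormed ℝ f i ∈ Submodule.span ℝ (Set.range f) := by
    rw [← InnerProductSpace.span_gramSchmidt, ← InnerProductSpace.span_gramSchmidtNormed_range]
    exact Submodule.subset_span ⟨i, rfl⟩
  have h2 := Submodule.mem_map_of_mem (f := (WithLp.linearEquiv 2 ℝ (Fin p → ℝ)).toLinearMap) h1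
  rw [Submodule.map_span, ← Set.range_comp] at h2
  exact h2

/-- Valid for arbitrary matrices, including those on which Gram–Schmidt breaks down; it settles the
case in which the asserted bound exceeds √d. -/
theorem sinThetaLoss_le_sqrt (U V : Matrix (Fin p) (Fin d) ℝ) : sinThetaLoss U V ≤ √d := by
  refine Real.sqrt_le_sqrt ?_
  calc _ ≤ ∑ j : Fin d, (1 : ℝ) := Finset.sum_le_sum fun j _ => Real.sin_sq_le_one _
    _ = d := by simp

/-- For orthonormal families, the loss is controlled by the residuals of the projection onto the
column space of `V`. -/
theorem sinThetaLoss_sq_le {U V : Matrix (Fin p) (Fin d) ℝ} (hV : HasOrthonormalColumns V)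
    (hU : LinearIndependent ℝ fun i j => U j i) :
    sinThetaLoss U V ^ 2 ≤ ∑ i, (1 - ∑ k, ((fun j => V j k) ⬝ᵥ fun j => orthonormalize U j i) ^ 2) := by
  rw [sinThetaLoss, orthonormalize_of_orthonormal hV,
    Real.sq_sqrt (Finset.sum_nonneg fun _ _ => sq_nonneg _)]
  set Q := orthonormalize U with hQ
  set T := Matrix.toEuclideanLin (Qᵀ * V) with hT
  have hfr : Module.finrank ℝ (EuclideanSpace ℝ (Fin d)) = d := by simp
  have hTapp : ∀ x : EuclideanSpace ℝ (Fin d), ∀ i,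
      T x i = (fun j => Q j i) ⬝ᵥ (V *ᵥ x.ofLp) := by
    intro x i
    rw [hT, Matrix.toLpLin_apply, ← Matrix.mulVec_mulVec]
    rfl
  have hle : ∀ x : EuclideanSpace ℝ (Fin d), ‖T x‖ ^ 2 ≤ ‖x‖ ^ 2 := by
    intro x
    rw [EuclideanSpace.norm_sq_eq, EuclideanSpace.norm_sq_eq]
    simp only [Real.norm_eq_abs, sq_abs, hTapp]
    refine (sum_sq_dot_le (b := fun i j => Q j i) (orthonormalize_col_dot hU) _).trans_eq ?_
    rw [Matrix.dotProduct_mulVec, Matrix.vecMul_mulVec, hV, Matrix.vecMul_one]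
    simp [dotProduct, pow_two]
  -- `T` is a contraction, so 1 - σ² is nonnegative and the square of sin (arccos σ) = √(1 - σ²) is
  -- not truncated.
  have hσ : ∀ j : Fin d, T.singularValues j ^ 2 ≤ 1 := by
    intro j
    obtain ⟨x, hx⟩ := (T.hasEigenvalue_adjoint_comp_self_sq_singularValues
      (n := j) (by rw [hfr]; exact j.2)).exists_hasEigenvector
    have h1 := hx.apply_eq_smul
    have h2 : inner ℝ (T x) (T x) = T.singularValues j ^ 2 * inner ℝ x x := by
      rw [← LinearMap.adjoint_inner_left, ← LinearMap.comp_apply, h1, inner_smul_left]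
      simp
    rw [real_inner_self_eq_norm_sq, real_inner_self_eq_norm_sq] at h2
    have h3 := hle x
    have h4 : 0 < ‖x‖ ^ 2 := by have := norm_pos_iff.2 hx.2; positivity
    rw [h2] at h3
    by_contra hcon
    push Not at hcon
    nlinarith
  -- Both sides are the trace of T*T: on the left through its eigenvalues, on the right in the
  -- standard basis.
  have hsum : ∑ j : Fin d, T.singularValues j ^ 2
      = ∑ i, ∑ k, ((fun j => V j k) ⬝ᵥ fun j => Q j i) ^ 2 := by
    have h1 := T.isSymmetric_adjoint_comp_self.trace_eq_sum_eigenvalues hfr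
    simp only [RCLike.ofReal_real_eq_id, id] at h1
    rw [Finset.sum_congr rfl fun j _ => T.sq_singularValues_fin hfr j, ← h1,
      LinearMap.trace_eq_sum_inner _ (EuclideanSpace.basisFun (Fin d) ℝ), Finset.sum_comm]
    refine Finset.sum_congr rfl fun k _ => ?_
    rw [LinearMap.comp_apply, LinearMap.adjoint_inner_right, real_inner_self_eq_norm_sq,
      EuclideanSpace.norm_sq_eq]
    refine Finset.sum_congr rfl fun i _ => ?_
    rw [hTapp, Real.norm_eq_abs, sq_abs, dotProduct_comm]
    congr 2
    ext j
    simp [Matrix.mulVec, dotProduct, EuclideanSpace.basisFun_apply]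
  rw [Finset.sum_sub_distrib, ← hsum, ← Finset.sum_sub_distrib]
  refine Finset.sum_le_sum fun j _ => ?_
  rw [principalAngle, Real.sin_arccos, Real.sq_sqrt (by linarith [hσ j])]

theorem dot_sum_smul_self_le {r : ℕ} (c : Fin r → ℝ) (x : Fin r → Fin p → ℝ) :
    (∑ l, c l • x l) ⬝ᵥ (∑ l, c l • x l) ≤ (∑ l, c l ^ 2) * ∑ l, x l ⬝ᵥ x l := by
  have h1 : ∀ j, (∑ l, c l • x l) j * (∑ l, c l • x l) j ≤ (∑ l, c l ^ 2) * ∑ l, x l j ^ 2 := by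
    intro j
    have := Finset.sum_mul_sq_le_sq_mul_sq Finset.univ c fun l => x l j
    simpa [← pow_two] using this
  refine (Finset.sum_le_sum fun j _ => h1 j).trans_eq ?_
  rw [← Finset.mul_sum, Finset.sum_comm]
  simp [dotProduct, pow_two]

/-- Perturbation bound for the loss of the leading generalized eigenvectors. -/
theorem NearSpiked.sinThetaLoss_le {lam₀ lam : Fin d → ℝ} {V U : Matrix (Fin p) (Fin d) ℝ}
    {Mh Gh : LinearMap.BilinForm ℝ (Fin p → ℝ)} {W : Submodule ℝ (Fin p → ℝ)} {ε : ℝ} (hd : 0 < d)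
    (hV : HasOrthonormalColumns V) (H : NearSpiked lam₀ (fun k j => V j k) Mh Gh W ε)
    (h : TopPairs Mh Gh W lam fun i j => U j i) (hb : ∀ k, (fun j => V j k) ∈ W) {l : ℝ}
    (hl : ∀ k, l ≤ lam₀ k) (hl0 : 0 < l) (hεl : ε ≤ l / 4) :
    sinThetaLoss U V ≤ 6 * d * ε / l := by
  have hli := linearIndependent_of_bilin_orth h.orth
  refine le_of_sq_le_sq ?_ (by have := H.pos; positivity)
  refine (sinThetaLoss_sq_le hV hli).trans ?_
  set b : Fin d → Fin p → ℝ := fun k j => V j k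
  set v : Fin d → Fin p → ℝ := fun i j => U j i
  set q : Fin d → Fin p → ℝ := fun i j => orthonormalize U j i with hq
  have horth : ∀ i j, dotForm p (b i) (b j) = if i = j then 1 else 0 := by simpa using H.orth
  have hi : ∀ i, 1 - ∑ k, (b k ⬝ᵥ q i) ^ 2 ≤ 2 * (d * (18 * ε ^ 2 / l ^ 2)) := by
    intro i
    have hqq : q i ⬝ᵥ q i = 1 := by simpa using orthonormalize_col_dot hli i i
    have h1 := bilin_self_eq_sum_add_orthPart (G := dotForm p) (W := ⊤) (v := b) (u := q i)
      (fun u w => by simp [dotProduct_comm]) (fun _ => trivial) horth trivial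
    simp only [dotForm_apply, hqq] at h1
    have h2 : 1 - ∑ k, (b k ⬝ᵥ q i) ^ 2
        = orthPart (dotForm p) b (q i) ⬝ᵥ orthPart (dotForm p) b (q i) := by linarith
    rw [h2]
    obtain ⟨c, hc⟩ := (Submodule.mem_span_range_iff_exists_fun ℝ).1
      (orthonormalize_col_mem_span U i)
    have hqW : q i ∈ W := by
      rw [hq]; simp only; rw [← hc]
      exact W.sum_mem fun k _ => W.smul_mem _ (h.mem k)
    -- The eigenvectors are orthonormal for `Gh`, so Σ c² is `Gh (q i) (q i)`, at most 1 + ε. Taking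
    -- the residual is linear, so the bounds for the `v k` pass to `q i`.
    have hcs : ∑ k, c k ^ 2 ≤ 2 := by
      have h3 := bilin_sum_sum_orth h.orth c
      rw [hc] at h3
      rw [← h3]
      have h4 := H.G_le hqW
      rw [hqq] at h4
      have := H.le_half
      change Gh (q i) (q i) ≤ 2
      linarith
    have h5 : orthPart (dotForm p) b (q i) = ∑ k, c k • orthPart (dotForm p) b (v k) := by
      have h6 : q i = ∑ k, c k • v k := hc.symm
      simp only [orthPart, h6, smul_sub, Finset.sum_sub_distrib, dotForm_apply]
      congr 1
      simp only [Finset.smul_sum, dotProduct_sum, Finset.sum_smul, smul_smul]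
      rw [Finset.sum_comm]
      simp only [dotProduct_smul, smul_eq_mul]
    rw [h5]
    refine (dot_sum_smul_self_le c _).trans ?_
    have h7 : ∑ k, orthPart (dotForm p) b (v k) ⬝ᵥ orthPart (dotForm p) b (v k)
        ≤ d * (18 * ε ^ 2 / l ^ 2) := by
      refine (Finset.sum_le_sum fun k _ => H.residual_le hd h hb hl hl0 hεl k).trans_eq ?_
      simp
    exact mul_le_mul hcs h7 (Finset.sum_nonneg fun k _ => dot_self_nonneg _) (by norm_num)
  -- The total is d · 2 · d · 18ε²/l² = (6dε/l)².
  refine (Finset.sum_le_sum fun i _ => hi i).trans_eq ?_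
  simp only [Finset.sum_const, Finset.card_univ, Fintype.card_fin, nsmul_eq_mul]
  field_simp
  ring

end Loss

/-! ### Compressed matrices as forms on supported vectors, and measurability of the criterion -/

section Bridge

variable {p : ℕ}

/-- The vectors supported on `S`. -/
def suppOn (S : Finset (Fin p)) : Submodule ℝ (Fin p → ℝ) where
  carrier := {u | ∀ j ∉ S, u j = 0}
  add_mem' hu hw j hj := by simp [hu j hj, hw j hj]
  zero_mem' _ _ := rfl
  smul_mem' c u hu j hj := by simp [hu j hj]

theorem single_mem_suppOn {S : Finset (Fin p)} {j : Fin p} (hj : j ∈ S) (c : ℝ) :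
    Pi.single j c ∈ suppOn S := fun j' hj' => by
  rw [Pi.single_eq_of_ne]
  rintro rfl
  exact hj' hj

theorem card_le_finrank_suppOn (S : Finset (Fin p)) : S.card ≤ Module.finrank ℝ (suppOn S) := by
  have h : LinearIndependent ℝ
      (fun j : S => (⟨Pi.single j.1 1, single_mem_suppOn j.2 1⟩ : suppOn S)) := by
    refine LinearIndependent.of_comp (suppOn S).subtype ?_
    exact (Pi.linearIndependent_single_one (Fin p) ℝ).comp _ Subtype.val_injective
  simpa using h.fintype_card_le_finrank

theorem coordProj_mulVec (S : Finset (Fin p)) (u : Fin p → ℝ) (j : Fin p) :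
    (coordProj S *ᵥ u) j = if j ∈ S then u j else 0 := by
  simp [coordProj, Matrix.mulVec_diagonal]

theorem coordProj_mulVec_of_mem {S : Finset (Fin p)} {u : Fin p → ℝ} (hu : u ∈ suppOn S) :
    coordProj S *ᵥ u = u := by
  ext j
  rw [coordProj_mulVec]
  split_ifs with h
  · rfl
  · exact (hu j h).symm

theorem compress_mulVec {S : Finset (Fin p)} {u : Fin p → ℝ} (hu : u ∈ suppOn S)
    (M : Matrix (Fin p) (Fin p) ℝ) (j : Fin p) :
    ((coordProj S * M * coordProj S) *ᵥ u) j = if j ∈ S then (M *ᵥ u) j else 0 := by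
  rw [← Matrix.mulVec_mulVec, ← Matrix.mulVec_mulVec, coordProj_mulVec_of_mem hu, coordProj_mulVec]

theorem dot_compress_mulVec {S : Finset (Fin p)} {u w : Fin p → ℝ} (hu : u ∈ suppOn S)
    (hw : w ∈ suppOn S) (M : Matrix (Fin p) (Fin p) ℝ) :
    w ⬝ᵥ (coordProj S * M * coordProj S) *ᵥ u = Matrix.toBilin' M w u := by
  rw [Matrix.toBilin'_apply']
  refine Finset.sum_congr rfl fun j _ => ?_
  rw [compress_mulVec hu]
  split_ifs with h
  · rfl
  · rw [hw j h]; simp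

theorem compress_eig_iff {S : Finset (Fin p)} {u : Fin p → ℝ} (hu : u ∈ suppOn S)
    (M G : Matrix (Fin p) (Fin p) ℝ) (l : ℝ) :
    (coordProj S * M * coordProj S) *ᵥ u = l • ((coordProj S * G * coordProj S) *ᵥ u) ↔
      ∀ w ∈ suppOn S, Matrix.toBilin' M w u = l * Matrix.toBilin' G w u := by
  constructor
  · intro h w hw
    rw [← dot_compress_mulVec hu hw, ← dot_compress_mulVec hu hw, h, dotProduct_smul, smul_eq_mul]
  · intro h
    ext j
    rw [Pi.smul_apply, compress_mulVec hu, compress_mulVec hu]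
    split_ifs with hj
    · have := h _ (single_mem_suppOn hj 1)
      simpa [Matrix.toBilin'_apply'] using this
    · simp

theorem toBilin'_symm {M : Matrix (Fin p) (Fin p) ℝ} (hM : M.IsSymm) (u w : Fin p → ℝ) :
    Matrix.toBilin' M u w = Matrix.toBilin' M w u := by
  rw [Matrix.toBilin'_apply', Matrix.toBilin'_apply', Matrix.dotProduct_mulVec,
    ← Matrix.mulVec_transpose, hM, dotProduct_comm]

/-- On vectors supported on `S` the compressed matrices act as the full forms. The field `top` of
`IsTopGenEigen` speaks of eigenvectors only; positivity of `G` turns it into a Rayleigh bound on the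
whole complement, by `TopPairs.of_eigen`. -/
theorem isTopGenEigen_iff {M G : Matrix (Fin p) (Fin p) ℝ} (hM : M.IsSymm) (hG : G.IsSymm)
    {S : Finset (Fin p)} (hpos : ∀ u ∈ suppOn S, u ≠ 0 → 0 < Matrix.toBilin' G u u) {r : ℕ}
    {lam : Fin r → ℝ} {v : Fin r → Fin p → ℝ} :
    IsTopGenEigen M G S lam v ↔
      TopPairs (Matrix.toBilin' M) (Matrix.toBilin' G) (suppOn S) lam v := by
  constructor
  · intro h
    refine TopPairs.of_eigen (toBilin'_symm hM) (toBilin'_symm hG) hpos h.supp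
      (fun i => (compress_eig_iff (h.supp i) M G _).1 (h.eig i)) (fun i j => ?_) h.anti ?_
    · rw [← dot_compress_mulVec (h.supp j) (h.supp i), h.orth]
    · intro ν u hu heig hu1 huo
      refine h.top ν u hu ((compress_eig_iff hu M G _).2 heig) ?_ fun i => ?_
      · rw [dot_compress_mulVec hu hu, hu1]
      · rw [dot_compress_mulVec hu (h.supp i), huo]
  · intro h
    refine ⟨h.mem, fun i => (compress_eig_iff (h.mem i) M G _).2 (h.eig i), fun i j => ?_, h.anti,
      fun ν u hu heig hu1 huo i => ?_⟩
    · rw [dot_compress_mulVec (h.mem j) (h.mem i), h.orth]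
    · rw [dot_compress_mulVec hu hu] at hu1
      have h1 := h.compl u hu (fun i => by rw [← dot_compress_mulVec hu (h.mem i), huo]) i
      rw [(compress_eig_iff hu M G _).1 heig u hu, hu1] at h1
      linarith

/-- The sum of the `d` leading generalized eigenvalues, provided that `d + 1` generalized
eigenpairs exist. -/
def topSum (d : ℕ) (M G : Matrix (Fin p) (Fin p) ℝ) (S : Finset (Fin p)) : ℝ :=
  open Classical in
  if h : ∃ (lam : Fin (d + 1) → ℝ) (v : Fin (d + 1) → Fin p → ℝ), IsTopGenEigen M G S lam v then
    ∑ i : Fin d, h.choose i.castSucc else 0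

/-- The pairs of matrices admitting an almost orthonormal family on `S` that certifies a lower
bound for the sum of the leading generalized eigenvalues. -/
def certifiedAbove (d : ℕ) (S : Finset (Fin p)) (c : ℝ) :
    Set (Matrix (Fin p) (Fin p) ℝ × Matrix (Fin p) (Fin p) ℝ) :=
  {MG | ∃ η > 0, ∃ u : Fin d → Fin p → ℝ, (∀ k, u k ∈ suppOn S) ∧
    (∀ k k', |u k ⬝ᵥ MG.2 *ᵥ u k' - if k = k' then 1 else 0| < η) ∧
    c * (1 + d * η) < ∑ k, u k ⬝ᵥ MG.1 *ᵥ u k}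

/-- For each fixed certificate the conditions on the matrices are finitely many strict inequalities
between continuous functions. The union over certificates is uncountable but still open. -/
theorem isOpen_certifiedAbove (d : ℕ) (S : Finset (Fin p)) (c : ℝ) :
    IsOpen (certifiedAbove d S c) := by
  have h : certifiedAbove d S c = ⋃ η ∈ Set.Ioi (0 : ℝ), ⋃ u ∈ {u : Fin d → Fin p → ℝ |
      ∀ k, u k ∈ suppOn S}, ((⋂ k, ⋂ k', {MG : Matrix (Fin p) (Fin p) ℝ × Matrix (Fin p) (Fin p) ℝ |
        |u k ⬝ᵥ MG.2 *ᵥ u k' - if k = k' then 1 else 0| < η}) ∩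
        {MG | c * (1 + d * η) < ∑ k, u k ⬝ᵥ MG.1 *ᵥ u k}) := by
    ext MG
    simp [certifiedAbove, and_left_comm]
  rw [h]
  refine isOpen_biUnion fun η _ => isOpen_biUnion fun u _ => IsOpen.inter ?_ ?_
  · refine isOpen_iInter_of_finite fun k => isOpen_iInter_of_finite fun k' => ?_
    exact isOpen_lt (by fun_prop) continuous_const
  · exact isOpen_lt continuous_const (by fun_prop)

/-- The eigenvectors themselves are a certificate with zero error, leaving room for a small η;
conversely a certificate has Gram form at most 1 + dη, and Ky Fan's bound applies. The right side
mentions no eigenvectors, which gives both uniqueness and measurability of the sum. -/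
theorem lt_sum_lam_iff {d : ℕ} {M G : Matrix (Fin p) (Fin p) ℝ} (hM : M.IsSymm) (hG : G.IsSymm)
    {S : Finset (Fin p)} (hpos : ∀ u ∈ suppOn S, u ≠ 0 → 0 < Matrix.toBilin' G u u)
    (hpsd : ∀ u ∈ suppOn S, 0 ≤ Matrix.toBilin' M u u) {lam : Fin (d + 1) → ℝ}
    {v : Fin (d + 1) → Fin p → ℝ} (h : IsTopGenEigen M G S lam v) {c : ℝ} (hc : 0 ≤ c) :
    c < ∑ i : Fin d, lam i.castSucc ↔ (M, G) ∈ certifiedAbove d S c := by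
  have h' := (isTopGenEigen_iff hM hG hpos).1 h
  constructor
  · intro hlt
    set F := ∑ i : Fin d, lam i.castSucc with hF
    -- With this η the loss c d η is at most (F - c)/2; the `+ 1` keeps the denominator positive
    -- when `d * c = 0`.
    refine ⟨(F - c) / (d * c + 1) / 2, by have := sub_pos.2 hlt; positivity,
      fun i => v i.castSucc, fun k => h'.mem _, fun k k' => ?_, ?_⟩
    · rw [← Matrix.toBilin'_apply', h'.orth]
      have := sub_pos.2 hlt
      simp only [Fin.castSucc_inj, sub_self, abs_zero]
      positivity
    · have h1 : ∑ k : Fin d, v k.castSucc ⬝ᵥ M *ᵥ v k.castSucc = F := by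
        refine Finset.sum_congr rfl fun k _ => ?_
        rw [← Matrix.toBilin'_apply', h'.lam_eq]
      change c * (1 + d * ((F - c) / (d * c + 1) / 2)) < ∑ k : Fin d, v k.castSucc ⬝ᵥ M *ᵥ v k.castSucc
      rw [h1]
      have h2 : c * d * ((F - c) / (d * c + 1)) ≤ F - c := by
        rw [mul_div_assoc', div_le_iff₀ (by positivity)]
        nlinarith [sub_pos.2 hlt]
      nlinarith [sub_pos.2 hlt]
  · rintro ⟨η, hη, u, huW, horth, hlt⟩
    have hk := h'.kyFan (toBilin'_symm hM) (toBilin'_symm hG) (fun w hw => by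
      by_cases h0 : w = 0
      · simp [h0]
      · exact (hpos w hw h0).le) hpsd le_rfl huW (ρ := 1 + d * η) (by positivity) (fun a => by
        simp only [map_sum, LinearMap.sum_apply, map_smul, LinearMap.smul_apply, smul_eq_mul]
        have h1 : ∀ k k', a k * (a k' * Matrix.toBilin' G (u k') (u k)) ≤
            a k * (a k' * if k' = k then 1 else 0) + η * ((a k ^ 2 + a k' ^ 2) / 2) := by
          intro k k'
          have h2 := horth k' k
          rw [← Matrix.toBilin'_apply'] at h2
          set x := Matrix.toBilin' G (u k') (u k) - if k' = k then (1 : ℝ) else 0 with hx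
          have h3 : Matrix.toBilin' G (u k') (u k) = x + if k' = k then (1 : ℝ) else 0 := by
            rw [hx]; ring
          rw [h3]
          -- Entrywise errors below η, with |a a'| ≤ (a² + a'²)/2; summing over both indices gives
          -- dη Σ a².
          have h4 : a k' * a k * x ≤ η * ((a k ^ 2 + a k' ^ 2) / 2) := by
            calc a k' * a k * x ≤ |a k' * a k| * |x| := by rw [← abs_mul]; exact le_abs_self _
              _ ≤ ((a k ^ 2 + a k' ^ 2) / 2) * η := by
                refine mul_le_mul ?_ h2.le (abs_nonneg _) (by positivity)
                rw [abs_mul]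
                nlinarith [sq_nonneg (|a k'| - |a k|), sq_abs (a k), sq_abs (a k')]
              _ = _ := mul_comm _ _
          nlinarith
        simp only [Finset.mul_sum]
        refine (Finset.sum_le_sum fun k _ => Finset.sum_le_sum fun k' _ => h1 k k').trans_eq ?_
        simp only [Finset.sum_add_distrib, ← Finset.mul_sum, ← Finset.sum_div]
        simp [pow_two, ← Finset.mul_sum]
        ring)
    simp only [Matrix.toBilin'_apply'] at hk
    have h1 : (1 + d * η) * c < (1 + d * η) * ∑ i : Fin d, lam i.castSucc := by linarith
    exact lt_of_mul_lt_mul_left h1 (by positivity)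

/-- The pairs chosen in `topSum` are arbitrary, but by `lt_sum_lam_iff` the nonnegative numbers
strictly below the sum depend on the matrices alone, and the sum is nonnegative. -/
theorem topSum_eq {d : ℕ} {M G : Matrix (Fin p) (Fin p) ℝ} (hM : M.IsSymm) (hG : G.IsSymm)
    {S : Finset (Fin p)} (hpos : ∀ u ∈ suppOn S, u ≠ 0 → 0 < Matrix.toBilin' G u u)
    (hpsd : ∀ u ∈ suppOn S, 0 ≤ Matrix.toBilin' M u u) {lam : Fin (d + 1) → ℝ}
    {v : Fin (d + 1) → Fin p → ℝ} (h : IsTopGenEigen M G S lam v) :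
    topSum d M G S = ∑ i : Fin d, lam i.castSucc := by
  have hex : ∃ (lam : Fin (d + 1) → ℝ) (v : Fin (d + 1) → Fin p → ℝ),
    IsTopGenEigen M G S lam v := ⟨lam, v, h⟩
  rw [topSum, dif_pos hex]
  obtain ⟨v', h'⟩ := hex.choose_spec
  have hnn : ∀ {lam : Fin (d + 1) → ℝ} {v : Fin (d + 1) → Fin p → ℝ}, IsTopGenEigen M G S lam v →
      0 ≤ ∑ i : Fin d, lam i.castSucc := fun {lam v} h => by
    have h' := (isTopGenEigen_iff hM hG hpos).1 h
    exact Finset.sum_nonneg fun i _ => h'.lam_eq i.castSucc ▸ hpsd _ (h'.mem _)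
  refine le_antisymm (le_of_forall_lt fun c hc => ?_) (le_of_forall_lt fun c hc => ?_)
  · rcases lt_or_ge c 0 with h0 | h0
    · exact h0.trans_le (hnn h)
    · exact (lt_sum_lam_iff hM hG hpos hpsd h h0).2 ((lt_sum_lam_iff hM hG hpos hpsd h' h0).1 hc)
  · rcases lt_or_ge c 0 with h0 | h0
    · exact h0.trans_le (hnn h')
    · exact (lt_sum_lam_iff hM hG hpos hpsd h' h0).2 ((lt_sum_lam_iff hM hG hpos hpsd h h0).1 hc)

/-- The sum of the leading generalized eigenvalues depends measurably on the matrices. -/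
theorem measurable_topSum {𝓓 : Type*} [MeasurableSpace 𝓓] {d : ℕ}
    {M G : 𝓓 → Matrix (Fin p) (Fin p) ℝ} (hMm : Measurable fun x i j => M x i j)
    (hGm : Measurable fun x i j => G x i j) {D : Set 𝓓} (hD : MeasurableSet D)
    {S : Finset (Fin p)} (hM : ∀ x ∈ D, (M x).IsSymm) (hG : ∀ x ∈ D, (G x).IsSymm)
    (hpos : ∀ x ∈ D, ∀ u ∈ suppOn S, u ≠ 0 → 0 < Matrix.toBilin' (G x) u u)
    (hpsd : ∀ x ∈ D, ∀ u ∈ suppOn S, 0 ≤ Matrix.toBilin' (M x) u u) (hS : d + 1 ≤ S.card) :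
    Measurable (D.indicator fun x => topSum d (M x) (G x) S) := by
  have hex : ∀ x ∈ D, ∃ (lam : Fin (d + 1) → ℝ) (v : Fin (d + 1) → Fin p → ℝ),
      IsTopGenEigen (M x) (G x) S lam v := by
    intro x hx
    obtain ⟨lam, v, h⟩ := exists_topPairs (toBilin'_symm (hM x hx)) (toBilin'_symm (hG x hx))
      (hpos x hx) (d + 1) (hS.trans (card_le_finrank_suppOn S))
    exact ⟨lam, v, (isTopGenEigen_iff (hM x hx) (hG x hx) (hpos x hx)).2 h⟩
  have hnn : ∀ x, 0 ≤ D.indicator (fun x => topSum d (M x) (G x) S) x := by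
    intro x
    refine Set.indicator_nonneg (fun x hx => ?_) x
    obtain ⟨lam, v, h⟩ := hex x hx
    rw [topSum_eq (hM x hx) (hG x hx) (hpos x hx) (hpsd x hx) h]
    have h' := (isTopGenEigen_iff (hM x hx) (hG x hx) (hpos x hx)).1 h
    exact Finset.sum_nonneg fun i _ => h'.lam_eq i.castSucc ▸ hpsd x hx _ (h'.mem _)
  refine measurable_of_Ioi fun c => ?_
  rcases lt_or_ge c 0 with h0 | h0
  · convert MeasurableSet.univ
    ext x
    simp [h0.trans_le (hnn x)]
  · have h1 : D.indicator (fun x => topSum d (M x) (G x) S) ⁻¹' Set.Ioi c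
        = D ∩ (fun x => ((fun i j => M x i j : Fin p → Fin p → ℝ),
          (fun i j => G x i j : Fin p → Fin p → ℝ))) ⁻¹' (certifiedAbove d S c) := by
      ext x
      by_cases hx : x ∈ D
      · obtain ⟨lam, v, h⟩ := hex x hx
        simp only [Set.mem_preimage, Set.indicator_of_mem hx, Set.mem_Ioi, Set.mem_inter_iff, hx,
          true_and, topSum_eq (hM x hx) (hG x hx) (hpos x hx) (hpsd x hx) h]
        exact lt_sum_lam_iff (hM x hx) (hG x hx) (hpos x hx) (hpsd x hx) h h0
      · simp [hx, h0]
    rw [h1]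
    have hopen : IsOpen (X := (Fin p → Fin p → ℝ) × (Fin p → Fin p → ℝ)) (certifiedAbove d S c) :=
      isOpen_certifiedAbove d S c
    exact hD.inter ((hMm.prodMk hGm) hopen.measurableSet)

end Bridge

/-! ### How often a coordinate belongs to the selected random set -/

section Selection

open Classical in
/-- The indicator that the selected set among `σ 0, …, σ (B - 1)` contains `j`. -/
def selInd {p B : ℕ} (f : Finset (Fin p) → ℝ) (j : Fin p) (σ : Fin B → Finset (Fin p)) : ℝ :=
  ∑ b, if IsSargmax (fun b => f (σ b)) b ∧ j ∈ σ b then 1 else 0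

variable {p A B : ℕ}

theorem isSargmax_unique {f : Fin B → ℝ} {b b' : Fin B} (h : IsSargmax f b) (h' : IsSargmax f b') :
    b = b' := IsLeast.unique h h'

theorem exists_isSargmax (hB : 0 < B) (f : Fin B → ℝ) : ∃ b, IsSargmax f b := by
  have : Nonempty (Fin B) := ⟨⟨0, hB⟩⟩
  obtain ⟨b, hb⟩ := Finite.exists_max f
  have hne : ({b | ∀ b', f b' ≤ f b} : Set (Fin B)).Nonempty := ⟨b, hb⟩
  exact ⟨_, (Set.toFinite _).isWF.min_mem hne, fun c hc => Set.IsWF.min_le _ hne hc⟩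

open Classical in
theorem selInd_eq {f : Finset (Fin p) → ℝ} {σ : Fin B → Finset (Fin p)} {b : Fin B}
    (hb : IsSargmax (fun b => f (σ b)) b) (j : Fin p) :
    selInd f j σ = if j ∈ σ b then 1 else 0 := by
  rw [selInd, Finset.sum_eq_single b]
  · simp [hb]
  · intro c _ hc
    rw [if_neg]
    rintro ⟨h, -⟩
    exact hc (isSargmax_unique h hb)
  · simp

theorem selInd_mem_Icc (hB : 0 < B) (f : Finset (Fin p) → ℝ) (j : Fin p)
    (σ : Fin B → Finset (Fin p)) : selInd f j σ ∈ Set.Icc (0 : ℝ) 1 := by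
  obtain ⟨b, hb⟩ := exists_isSargmax hB fun b => f (σ b)
  rw [selInd_eq hb]
  split_ifs <;> simp

/-- The law of a uniformly distributed `k`-element set. -/
abbrev unifSets (p k : ℕ) : Measure (Finset (Fin p)) :=
  uniformOn {T : Finset (Fin p) | T.card = k}

theorem isProbabilityMeasure_unifSets {k : ℕ} (hk : k ≤ p) :
    IsProbabilityMeasure (unifSets p k) := by
  refine isProbabilityMeasure_uniformOn (Set.toFinite _) ?_
  obtain ⟨T, -, hT⟩ := Finset.exists_subset_card_eq (s := (Finset.univ : Finset (Fin p))) (n := k)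
    (by simpa using hk)
  exact ⟨T, hT⟩

theorem ae_card_unifSets (k : ℕ) : ∀ᵐ T ∂unifSets p k, T.card = k :=
  ae_cond_mem (MeasurableSet.of_discrete)

/-- Exchange of the elements `j` and `j'`. -/
abbrev swapSet (j j' : Fin p) : Finset (Fin p) ≃ Finset (Fin p) := (Equiv.swap j j').finsetCongr

theorem measurePreserving_swapSet (j j' : Fin p) (k : ℕ) :
    MeasurePreserving (swapSet j j') (unifSets p k) (unifSets p k) := by
  refine ⟨Measurable.of_discrete, ?_⟩
  ext s -
  rw [Measure.map_apply Measurable.of_discrete MeasurableSet.of_discrete, unifSets, uniformOn,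
    cond_apply MeasurableSet.of_discrete, cond_apply MeasurableSet.of_discrete]
  congr 1
  have h : {T : Finset (Fin p) | T.card = k} ∩ swapSet j j' ⁻¹' s
      = (swapSet j j').symm '' ({T : Finset (Fin p) | T.card = k} ∩ s) := by
    rw [Equiv.image_symm_eq_preimage]
    ext T
    simp [Equiv.finsetCongr_apply]
  rw [h, Measure.count_injective_image (swapSet j j').symm.injective]

/-- The law of `B` independent uniformly distributed `k`-element sets. -/
abbrev groupLaw (p B k : ℕ) : Measure (Fin B → Finset (Fin p)) :=
  Measure.pi fun _ => unifSets p k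

theorem mem_swapSet {j j' i : Fin p} {T : Finset (Fin p)} :
    i ∈ swapSet j j' T ↔ Equiv.swap j j' i ∈ T := by
  rw [Equiv.finsetCongr_apply, Finset.mem_map_equiv, Equiv.symm_swap]

/-- If replacing `j'` by `j` never decreases the criterion, `j` is selected at least as often. -/
theorem integral_selInd_le {k : ℕ} (hk : k ≤ p) {f : Finset (Fin p) → ℝ}
    {j j' : Fin p} (hf : ∀ T : Finset (Fin p), T.card = k → j ∉ T → j' ∈ T →
      f T ≤ f (swapSet j j' T)) :
    ∫ σ, selInd f j' σ ∂groupLaw p B k ≤ ∫ σ, selInd f j σ ∂groupLaw p B k := by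
  classical
  have := isProbabilityMeasure_unifSets hk
  let g : Fin p → Fin p → Fin B → (Fin B → Finset (Fin p)) → ℝ := fun i i' b σ =>
    if IsSargmax (fun b => f (σ b)) b ∧ i ∈ σ b ∧ i' ∉ σ b then 1 else 0
  -- Selected sets containing both or neither of `j`, `j'` cancel.
  have hdiff : ∀ σ, selInd f j' σ - selInd f j σ = ∑ b, g j' j b σ - ∑ b, g j j' b σ := by
    intro σ
    simp only [selInd, ← Finset.sum_sub_distrib]
    refine Finset.sum_congr rfl fun b _ => ?_
    by_cases h1 : IsSargmax (fun b => f (σ b)) b <;> by_cases h2 : j ∈ σ b <;>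
      by_cases h3 : j' ∈ σ b <;> simp [g, h1, h2, h3]
  -- `Φ b` exchanges `j` and `j'` in the set with index `b` only.
  let Φ : Fin B → (Fin B → Finset (Fin p)) → (Fin B → Finset (Fin p)) := fun b σ c =>
    (if c = b then swapSet j j' else Equiv.refl _) (σ c)
  have hΦ : ∀ b, MeasurePreserving (Φ b) (groupLaw p B k) (groupLaw p B k) := by
    intro b
    refine ⟨Measurable.of_discrete, ?_⟩
    have hm : ∀ c, (unifSets p k).map (fun T => (if c = b then swapSet j j' else Equiv.refl _) T)
        = unifSets p k := by
      intro c
      split_ifs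
      · exact (measurePreserving_swapSet j j' k).map_eq
      · exact Measure.map_id
    have : ∀ c, SigmaFinite ((unifSets p k).map
        (fun T => (if c = b then swapSet j j' else Equiv.refl _) T)) := fun c => by
      rw [hm]; infer_instance
    have h := Measure.pi_map_pi (μ := fun _ : Fin B => unifSets p k)
      (f := fun c T => (if c = b then swapSet j j' else Equiv.refl _) T)
      (fun c => (Measurable.of_discrete).aemeasurable)
    simp only [hm] at h
    exact h
  have hcard : ∀ᵐ σ ∂groupLaw p B k, ∀ b, (σ b).card = k := by
    rw [ae_all_iff]
    intro b
    exact (Measure.quasiMeasurePreserving_eval (fun _ : Fin B => unifSets p k) b).ae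
      (ae_card_unifSets k)
  have hle : ∀ b, ∫ σ, g j' j b σ ∂groupLaw p B k ≤ ∫ σ, g j j' b σ ∂groupLaw p B k := by
    intro b
    have h2 : ∫ σ, g j j' b (Φ b σ) ∂groupLaw p B k = ∫ σ, g j j' b σ ∂groupLaw p B k := by
      have h := integral_map (μ := groupLaw p B k) (φ := Φ b) (f := g j j' b)
        (Measurable.of_discrete).aemeasurable (by
          exact (Measurable.of_discrete).aestronglyMeasurable)
      rw [(hΦ b).map_eq] at h
      exact h.symm
    rw [← h2]
    refine integral_mono_ae Integrable.of_finite Integrable.of_finite ?_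
    filter_upwards [hcard] with σ hσ
    simp only [g]
    split_ifs with h3 h4
    · exact le_rfl
    -- The exchange does not lower the value at `b` and leaves the others unchanged, so `b` remains
    -- a maximiser. Any other maximiser after the exchange was one before, so `b` is still the
    -- smallest.
    · refine absurd ⟨?_, ?_, ?_⟩ h4
      · have hself : Φ b σ b = swapSet j j' (σ b) := by simp [Φ]
        have hother : ∀ c, c ≠ b → Φ b σ c = σ c := fun c hc => by simp [Φ, hc]
        have hinc : f (σ b) ≤ f (Φ b σ b) := by
          rw [hself]; exact hf _ (hσ b) h3.2.2 h3.2.1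
        refine ⟨fun c => ?_, fun c hc => ?_⟩
        · by_cases hcb : c = b
          · rw [hcb]
          · simp only [hother c hcb]
            exact (h3.1.1 c).trans hinc
        · by_cases hcb : c = b
          · exact hcb.ge
          · refine h3.1.2 fun c' => ?_
            have h5 := hc b
            have h6 : f (σ b) ≤ f (σ c) := by
              simp only [hother c hcb] at h5
              exact hinc.trans h5
            exact (h3.1.1 c').trans h6
      · simp only [Φ, if_true, mem_swapSet, Equiv.swap_apply_left]
        exact h3.2.1
      · simp only [Φ, if_true, mem_swapSet, Equiv.swap_apply_right]
        exact h3.2.2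
    · exact zero_le_one
    · exact le_rfl
  have h1 : ∫ σ, (selInd f j' σ - selInd f j σ) ∂groupLaw p B k ≤ 0 := by
    simp only [hdiff]
    rw [integral_sub Integrable.of_finite Integrable.of_finite,
      integral_finsetSum _ fun _ _ => Integrable.of_finite,
      integral_finsetSum _ fun _ _ => Integrable.of_finite]
    exact sub_nonpos.2 (Finset.sum_le_sum fun b _ => hle b)
  rw [integral_sub Integrable.of_finite Integrable.of_finite] at h1
  linarith

/-- A coordinate that is preferred to every coordinate outside `J` is selected with
probability at least `1 / p`. -/
theorem inv_le_integral_selInd {k : ℕ} (hk : k ≤ p) (hB : 0 < B) {f : Finset (Fin p) → ℝ}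
    {J : Finset (Fin p)} (hJ : J.card ≤ k) {j : Fin p} (hj : j ∈ J)
    (hf : ∀ j' ∉ J, ∀ T : Finset (Fin p), T.card = k → j ∉ T → j' ∈ T →
      f T ≤ f (swapSet j j' T)) :
    (p : ℝ)⁻¹ ≤ ∫ σ, selInd f j σ ∂groupLaw p B k := by
  classical
  have := isProbabilityMeasure_unifSets hk
  have hcard : ∀ᵐ σ ∂groupLaw p B k, ∀ b, (σ b).card = k := by
    rw [ae_all_iff]
    intro b
    exact (Measure.quasiMeasurePreserving_eval (fun _ : Fin B => unifSets p k) b).ae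
      (ae_card_unifSets k)
  have h1 : ∀ᵐ σ ∂groupLaw p B k, 1 ≤ selInd f j σ + ∑ j' ∈ Jᶜ, selInd f j' σ := by
    filter_upwards [hcard] with σ hσ
    obtain ⟨b, hb⟩ := exists_isSargmax hB fun b => f (σ b)
    simp only [selInd_eq hb]
    by_cases hjb : j ∈ σ b
    · rw [if_pos hjb]
      have : (0 : ℝ) ≤ ∑ j' ∈ Jᶜ, if j' ∈ σ b then 1 else 0 :=
        Finset.sum_nonneg fun _ _ => by split_ifs <;> norm_num
      linarith
    · obtain ⟨j', hj', hj'J⟩ : ∃ j' ∈ σ b, j' ∉ J := by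
        by_contra hcon
        push Not at hcon
        have h2 : σ b ⊆ J.erase j := fun x hx =>
          Finset.mem_erase.2 ⟨fun h => hjb (h ▸ hx), hcon x hx⟩
        have h3 := Finset.card_le_card h2
        rw [hσ b, Finset.card_erase_of_mem hj] at h3
        have h4 : 0 < J.card := Finset.card_pos.2 ⟨j, hj⟩
        omega
      have h2 := Finset.single_le_sum (f := fun j' => if j' ∈ σ b then (1 : ℝ) else 0)
        (s := Jᶜ) (fun _ _ => by split_ifs <;> norm_num) (Finset.mem_compl.2 hj'J)
      rw [if_neg hjb]
      simp only [if_pos hj'] at h2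
      linarith
  have h2 : (1 : ℝ) ≤ ∫ σ, (selInd f j σ + ∑ j' ∈ Jᶜ, selInd f j' σ) ∂groupLaw p B k := by
    have h := integral_mono_ae (μ := groupLaw p B k) (f := fun _ => (1 : ℝ))
      Integrable.of_finite Integrable.of_finite h1
    simpa using h
  rw [integral_add Integrable.of_finite Integrable.of_finite,
    integral_finsetSum _ fun _ _ => Integrable.of_finite] at h2
  set q := ∫ σ, selInd f j σ ∂groupLaw p B k
  have h3 : ∑ j' ∈ Jᶜ, ∫ σ, selInd f j' σ ∂groupLaw p B k ≤ ∑ j' ∈ Jᶜ, q :=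
    Finset.sum_le_sum fun j' hj' => integral_selInd_le hk (hf j' (Finset.mem_compl.1 hj'))
  rw [Finset.sum_const, nsmul_eq_mul] at h3
  have hq : 0 ≤ q := integral_nonneg fun σ => (selInd_mem_Icc hB f j σ).1
  -- At most p events, `j` selected or some element outside `J` selected, cover everything, and each
  -- has probability at most q; hence p q ≥ 1.
  have h4 : (Jᶜ.card : ℝ) + 1 ≤ p := by
    have h5 : Jᶜ.card + J.card = p := by rw [Finset.card_compl_add_card]; simp
    have h6 : 0 < J.card := Finset.card_pos.2 ⟨j, hj⟩
    exact_mod_cast (by omega : Jᶜ.card + 1 ≤ p)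
  have hp : (0 : ℝ) < p := by have : (0 : ℝ) ≤ Jᶜ.card := by positivity
                              linarith
  rw [inv_le_iff_one_le_mul₀ hp]
  nlinarith

/-- Hoeffding's inequality for the number of groups whose selected set contains `j`. -/
theorem measure_sum_selInd_ge_le {k : ℕ} (hk : k ≤ p) (hB : 0 < B) (f : Finset (Fin p) → ℝ)
    (j : Fin p) (c : ℝ) {t : ℝ} (ht : 0 ≤ t) (hc : c = 1 ∨ c = -1) :
    (Measure.pi fun _ : Fin A => groupLaw p B k).real {σ | A * t ≤
      ∑ a, c * (selInd f j (σ a) - ∫ τ, selInd f j τ ∂groupLaw p B k)} ≤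
      Real.exp (-(2 * A * t ^ 2)) := by
  have := isProbabilityMeasure_unifSets hk
  set q := ∫ τ, selInd f j τ ∂groupLaw p B k with hq
  have hind := iIndepFun_pi (μ := fun _ : Fin A => groupLaw p B k)
    (X := fun _ τ => c * (selInd f j τ - q)) (fun _ => (Measurable.of_discrete).aemeasurable)
  have hsub : HasSubgaussianMGF (fun τ => c * (selInd f j τ - q)) (1 / 4) (groupLaw p B k) := by
    have h1 := hasSubgaussianMGF_of_mem_Icc (μ := groupLaw p B k) (X := selInd f j) (a := 0)
      (b := 1) (Measurable.of_discrete).aemeasurable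
      (Filter.Eventually.of_forall fun τ => selInd_mem_Icc hB f j τ)
    -- Variance proxy 1/4 for values in [0, 1]; the exponent (At)²/(2 · A/4) is 2At².
    have h2 : (‖(1 : ℝ) - 0‖₊ / 2) ^ 2 = (1 / 4 : NNReal) := by
      rw [sub_zero, nnnorm_one]; norm_num
    rw [h2] at h1
    rcases hc with rfl | rfl
    · simpa using h1
    · have h3 := h1.neg
      convert h3 using 1
      ext τ
      simp [hq]
  have hsubA : ∀ a ∈ (Finset.univ : Finset (Fin A)), HasSubgaussianMGF
      (fun σ : Fin A → Fin B → Finset (Fin p) => c * (selInd f j (σ a) - q)) (1 / 4)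
      (Measure.pi fun _ : Fin A => groupLaw p B k) := by
    intro a _
    refine HasSubgaussianMGF.of_map (X := fun τ => c * (selInd f j τ - q))
      (Y := fun σ : Fin A → Fin B → Finset (Fin p) => σ a) (Measurable.of_discrete).aemeasurable ?_
    have h := (measurePreserving_eval (fun _ : Fin A => groupLaw p B k) a).map_eq
    have h' : (Measure.pi fun _ : Fin A => groupLaw p B k).map
        (fun σ : Fin A → Fin B → Finset (Fin p) => σ a) = groupLaw p B k := h
    rwa [h']
  have h := HasSubgaussianMGF.measure_sum_ge_le_of_iIndepFun hind hsubA (ε := A * t) (by positivity)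
  refine h.trans ?_
  rcases Nat.eq_zero_or_pos A with h0 | h0
  · simp [h0]
  · apply Real.exp_le_exp.2
    simp only [Finset.sum_const, Finset.card_univ, Fintype.card_fin, nsmul_eq_mul]
    push_cast
    have : (0 : ℝ) < A := by exact_mod_cast h0
    apply le_of_eq
    field_simp
    ring

/-- With high probability, every coordinate in `J` is selected more than a third as often as
every coordinate outside `J`. -/
theorem measure_selection_fails_le {k : ℕ} (hk : k ≤ p) (hB : 0 < B) {f : Finset (Fin p) → ℝ}
    {J : Finset (Fin p)} (hJ : J.card ≤ k) (hJne : J.Nonempty)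
    (hf : ∀ j ∈ J, ∀ j' ∉ J, ∀ T : Finset (Fin p), T.card = k → j ∉ T → j' ∈ T →
      f T ≤ f (swapSet j j' T)) :
    (Measure.pi fun _ : Fin A => groupLaw p B k).real {σ | ¬ ∀ j ∈ J, ∀ j' ∉ J,
      ∑ a, selInd f j' (σ a) < 3 * ∑ a, selInd f j (σ a)} ≤
      p * Real.exp (-(A / (2 * (p : ℝ) ^ 2))) := by
  have := isProbabilityMeasure_unifSets hk
  set μ := Measure.pi fun _ : Fin A => groupLaw p B k
  set Q : Fin p → ℝ := fun j => ∫ σ, selInd f j σ ∂groupLaw p B k with hQ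
  obtain ⟨j₀, hj₀, hmin⟩ := Finset.exists_min_image J Q hJne
  have hq := inv_le_integral_selInd hk hB hJ hj₀ (hf j₀ hj₀)
  change (p : ℝ)⁻¹ ≤ Q j₀ at hq
  have hp : (0 : ℝ) < p := by
    have : 0 < p := j₀.pos
    exact_mod_cast this
  have hq0 : 0 < Q j₀ := (inv_pos.2 hp).trans_le hq
  classical
  -- Deviations are measured against q = `Q j₀`, the least probability on `J`. Off the bad events
  -- counts on `J` exceed A(q - q/2) and counts outside stay below A(q + q/2), which is the ratio 3.
  -- As q ≥ 1/p, each tail is at most exp(-A/(2p²)).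
  let bad : Fin p → Set (Fin A → Fin B → Finset (Fin p)) := fun j => {σ | A * (Q j₀ / 2) ≤
      ∑ a, (if j ∈ J then -1 else 1) * (selInd f j (σ a) - Q j)}
  have hbad : ∀ j, μ.real (bad j) ≤ Real.exp (-(A / (2 * (p : ℝ) ^ 2))) := by
    intro j
    refine (measure_sum_selInd_ge_le hk hB f j (if j ∈ J then -1 else 1) (by positivity)
      (by split_ifs <;> simp)).trans (Real.exp_le_exp.2 (neg_le_neg ?_))
    have h1 : ((p : ℝ)⁻¹) ^ 2 ≤ Q j₀ ^ 2 := by gcongr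
    calc (A : ℝ) / (2 * (p : ℝ) ^ 2) = A / 2 * ((p : ℝ)⁻¹) ^ 2 := by field_simp
      _ ≤ A / 2 * Q j₀ ^ 2 := by gcongr
      _ = 2 * A * (Q j₀ / 2) ^ 2 := by ring
  have hsubset : {σ | ¬ ∀ j ∈ J, ∀ j' ∉ J, ∑ a, selInd f j' (σ a) < 3 * ∑ a, selInd f j (σ a)}
      ⊆ ⋃ j, bad j := by
    intro σ hσ
    by_contra hcon
    simp only [Set.mem_iUnion, not_exists] at hcon
    refine hσ fun j hj j' hj' => ?_
    have h1 := hcon j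
    have h2 := hcon j'
    simp only [bad, Set.mem_ofPred_eq, if_pos hj, if_neg hj', not_le, ← Finset.mul_sum,
      Finset.sum_sub_distrib, Finset.sum_const, Finset.card_univ, Fintype.card_fin,
      nsmul_eq_mul] at h1 h2
    have h3 : Q j₀ ≤ Q j := hmin j hj
    have h4 : Q j' ≤ Q j₀ := integral_selInd_le hk (hf j₀ hj₀ j' hj')
    have hA : (0 : ℝ) ≤ A := by positivity
    nlinarith
  calc _ ≤ μ.real (⋃ j, bad j) := measureReal_mono hsubset
    _ ≤ ∑ j, μ.real (bad j) := measureReal_iUnion_fintype_le _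
    _ ≤ ∑ j : Fin p, Real.exp (-(A / (2 * (p : ℝ) ^ 2))) := Finset.sum_le_sum fun j _ => hbad j
    _ = _ := by simp

/-- Independent uniformly distributed sets have the product law. -/
theorem map_sets_eq {Ω : Type*} [MeasurableSpace Ω] {P : Measure Ω} [IsProbabilityMeasure P] {k : ℕ}
    (hA : 0 < A) (hB : 0 < B) {S : Fin A → Fin B → Ω → Finset (Fin p)} (hS : ∀ a b, Measurable (S a b))
    (hu : ∀ a b, P.map (S a b) = unifSets p k)
    (hind : iIndepFun (fun (ab : Fin A × Fin B) ω => S ab.1 ab.2 ω) P) :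
    P.map (fun ω a b => S a b ω) = Measure.pi fun _ : Fin A => groupLaw p B k := by
  have hprob : IsProbabilityMeasure (unifSets p k) := by
    rw [← hu ⟨0, hA⟩ ⟨0, hB⟩]
    exact Measure.isProbabilityMeasure_map (hS _ _).aemeasurable
  have h1 := hind.map_fun_eq_pi_map (fun ab : Fin A × Fin B => (hS ab.1 ab.2).aemeasurable)
  simp only [hu] at h1
  have h2 : (fun ω a b => S a b ω) = MeasurableEquiv.curry (Fin A) (Fin B) (Finset (Fin p)) ∘
      fun ω (ab : Fin A × Fin B) => S ab.1 ab.2 ω := rfl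
  rw [h2, ← Measure.map_map (MeasurableEquiv.measurable _)
    (measurable_pi_iff.2 fun ab : Fin A × Fin B => hS ab.1 ab.2), h1]
  have h3 := Measure.infinitePi_map_curry (fun (_ : Fin A) (_ : Fin B) => unifSets p k)
  simpa only [Measure.infinitePi_eq_pi] using h3

end Selection

/-! ### Concentration of averages of subexponential variables -/

section Bernstein

theorem Real.exp_le_one_add_add_sq_mul (x : ℝ) : Real.exp x ≤ 1 + x + x ^ 2 * Real.exp |x| := by
  rcases le_or_gt 0 x with hx | hx
  · have h1 : Real.exp x ≤ 1 + x * Real.exp x := by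
      have h2 := Real.add_one_le_exp (-x)
      have h3 : Real.exp x * Real.exp (-x) = 1 := by rw [← Real.exp_add]; simp
      nlinarith [Real.exp_pos x]
    rw [abs_of_nonneg hx]
    nlinarith
  · have h1 : 1 ≤ Real.exp |x| := Real.one_le_exp (abs_nonneg x)
    have h2 := Real.add_one_le_exp (-x)
    have h3 : Real.exp x * Real.exp (-x) = 1 := by rw [← Real.exp_add]; simp
    -- For x < 0, (1 + x + x²)(1 - x) = 1 - x³ ≥ 1, whereas exp x · (1 - x) ≤ 1.
    have h4 : Real.exp x ≤ 1 + x + x ^ 2 := by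
      have h5 : Real.exp x * (1 - x) ≤ 1 := by nlinarith [Real.exp_pos x]
      have h6 : 0 < 1 - x := by linarith
      have h7 : Real.exp x * (1 - x) ≤ (1 + x + x ^ 2) * (1 - x) := by nlinarith [pow_pos h6 3, sq_nonneg x]
      exact le_of_mul_le_mul_right h7 h6
    nlinarith [sq_nonneg x]

/-- The variance proxy of a centred variable `g` with `E exp (a |g|) ≤ C`. -/
def bernsteinVar (a C : ℝ) : ℝ := 8 * C * Real.exp C / a ^ 2

variable {Ω : Type*} [MeasurableSpace Ω] {P : Measure Ω} {g : Ω → ℝ} {a C : ℝ}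

theorem integrable_of_integrable_exp (hg : AEMeasurable g P) (ha : 0 < a)
    (hint : Integrable (fun ω => Real.exp (a * |g ω|)) P) : Integrable g P := by
  refine (hint.const_mul a⁻¹).mono' hg.aestronglyMeasurable (Filter.Eventually.of_forall fun ω => ?_)
  rw [Real.norm_eq_abs, le_inv_mul_iff₀ ha]
  linarith [Real.add_one_le_exp (a * |g ω|)]

variable [IsProbabilityMeasure P]

/-- Second-order expansion of the exponential; centring removes the linear term. In the remainder y²
exp |ty|, half of the exponent a|y| bounds exp |ty| and the other half absorbs y² at the price 8/a².
Passing from y back to g costs exp (a |E g|) ≤ exp C. This is the source of `bernsteinVar`. -/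
theorem mgf_centered_le (hg : AEMeasurable g P) (ha : 0 < a)
    (hint : Integrable (fun ω => Real.exp (a * |g ω|)) P)
    (hC : ∫ ω, Real.exp (a * |g ω|) ∂P ≤ C) {t : ℝ} (ht : |t| ≤ a / 2) :
    Integrable (fun ω => Real.exp (t * (g ω - P[g]))) P ∧
      mgf (fun ω => g ω - P[g]) P t ≤ Real.exp (bernsteinVar a C * t ^ 2) := by
  have hgi := integrable_of_integrable_exp hg ha hint
  set m := P[g] with hm
  have hm1 : a * |m| ≤ C := by
    refine le_trans ?_ hC
    calc a * |m| ≤ a * ∫ ω, |g ω| ∂P := by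
          gcongr; exact abs_integral_le_integral_abs
      _ = ∫ ω, a * |g ω| ∂P := (integral_const_mul _ _).symm
      _ ≤ _ := integral_mono (hgi.abs.const_mul a) hint fun ω => by
          change a * |g ω| ≤ Real.exp (a * |g ω|)
          linarith [Real.add_one_le_exp (a * |g ω|)]
  have hbound : ∀ ω, Real.exp (t * (g ω - m)) ≤ 1 + t * (g ω - m)
      + 8 * Real.exp C / a ^ 2 * t ^ 2 * Real.exp (a * |g ω|) := by
    intro ω
    set y := g ω - m with hy
    have h1 : |t * y| ≤ a / 2 * |y| := by rw [abs_mul]; gcongr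
    have h2 : y ^ 2 ≤ 8 / a ^ 2 * Real.exp (a / 2 * |y|) := by
      have h3 := Real.quadratic_le_exp_of_nonneg (x := a / 2 * |y|) (by positivity)
      have h4 : (a / 2 * |y|) ^ 2 / 2 = a ^ 2 / 8 * y ^ 2 := by rw [mul_pow, sq_abs]; ring
      rw [h4] at h3
      have h5 : 0 ≤ a / 2 * |y| := by positivity
      rw [div_mul_eq_mul_div, le_div_iff₀ (by positivity)]
      linarith
    have h6 : Real.exp (a / 2 * |y|) * Real.exp (a / 2 * |y|) ≤
        Real.exp C * Real.exp (a * |g ω|) := by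
      rw [← Real.exp_add, ← Real.exp_add, Real.exp_le_exp]
      have : |y| ≤ |g ω| + |m| := abs_sub _ _
      nlinarith
    calc Real.exp (t * y) ≤ 1 + t * y + (t * y) ^ 2 * Real.exp |t * y| :=
          Real.exp_le_one_add_add_sq_mul _
      _ ≤ 1 + t * y + t ^ 2 * (8 / a ^ 2 * Real.exp (a / 2 * |y|)) * Real.exp (a / 2 * |y|) := by
          rw [mul_pow]
          gcongr
      _ = 1 + t * y + t ^ 2 * (8 / a ^ 2) * (Real.exp (a / 2 * |y|) * Real.exp (a / 2 * |y|)) := by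
          ring
      _ ≤ 1 + t * y + t ^ 2 * (8 / a ^ 2) * (Real.exp C * Real.exp (a * |g ω|)) := by gcongr
      _ = _ := by ring
  have hlin : Integrable (fun ω => 1 + t * (g ω - m)) P :=
    (integrable_const _).add ((hgi.sub (integrable_const _)).const_mul t)
  have hmaj : Integrable (fun ω => 1 + t * (g ω - m)
      + 8 * Real.exp C / a ^ 2 * t ^ 2 * Real.exp (a * |g ω|)) P := hlin.add (hint.const_mul _)
  have hexp : Integrable (fun ω => Real.exp (t * (g ω - m))) P := by
    refine hmaj.mono' (by fun_prop) (Filter.Eventually.of_forall fun ω => ?_)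
    rw [Real.norm_eq_abs, abs_of_pos (Real.exp_pos _)]
    exact hbound ω
  refine ⟨hexp, ?_⟩
  calc mgf (fun ω => g ω - m) P t ≤ ∫ ω, (1 + t * (g ω - m)
      + 8 * Real.exp C / a ^ 2 * t ^ 2 * Real.exp (a * |g ω|)) ∂P := integral_mono hexp hmaj hbound
    _ = 1 + 8 * Real.exp C / a ^ 2 * t ^ 2 * ∫ ω, Real.exp (a * |g ω|) ∂P := by
        rw [integral_add hlin (hint.const_mul _), integral_const_mul,
          integral_add (g := fun ω => t * (g ω - m)) (integrable_const _)
            ((hgi.sub (integrable_const _)).const_mul t),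
          integral_const_mul, integral_sub hgi (integrable_const _)]
        simp [← hm]
    _ ≤ 1 + 8 * Real.exp C / a ^ 2 * t ^ 2 * C := by gcongr
    _ = bernsteinVar a C * t ^ 2 + 1 := by rw [bernsteinVar]; ring
    _ ≤ _ := Real.add_one_le_exp _

variable {Ω' : Type*} [MeasurableSpace Ω'] {P' : Measure Ω'} [IsProbabilityMeasure P'] {n : ℕ}
  {U : Fin n → Ω' → ℝ}

theorem measure_mean_ge_le (hn : 0 < n) (hC0 : 0 < C) (ha : 0 < a) (hg : AEMeasurable g P)
    (hint : Integrable (fun ω => Real.exp (a * |g ω|)) P)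
    (hC : ∫ ω, Real.exp (a * |g ω|) ∂P ≤ C) (hUm : ∀ i, Measurable (U i))
    (hU : iIndepFun U P')
    (hid : ∀ i, IdentDistrib (U i) g P' P) {t : ℝ} (ht0 : 0 ≤ t) (ht : t ≤ a * bernsteinVar a C) :
    P'.real {ω | t ≤ (n : ℝ)⁻¹ * ∑ i, U i ω - P[g]} ≤
      Real.exp (-(n * t ^ 2 / (4 * bernsteinVar a C))) := by
  have hV : 0 < bernsteinVar a C := by unfold bernsteinVar; positivity
  set V := bernsteinVar a C
  have hn' : (0 : ℝ) < n := by exact_mod_cast hn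
  -- Minimiser of -s t + V s². The restriction t ≤ aV is exactly s ≤ a/2, the range in which the
  -- moment generating function is controlled.
  set s := t / (2 * V) with hs
  have hs0 : 0 ≤ s := by positivity
  have hs1 : |s| ≤ a / 2 := by
    rw [abs_of_nonneg hs0, hs, div_le_iff₀ (by positivity)]
    linarith
  obtain ⟨h1, h2⟩ := mgf_centered_le hg ha hint hC hs1
  set m := P[g]
  have hidc : ∀ i, IdentDistrib (fun ω => U i ω - m) (fun ω => g ω - m) P' P :=
    fun i => (hid i).comp (u := fun x => x - m) (by fun_prop)
  have hmeas : ∀ i, AEMeasurable (fun ω => U i ω - m) P' := fun i => (hidc i).aemeasurable_fst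
  have hind : iIndepFun (fun i ω => U i ω - m) P' :=
    hU.comp (fun _ x => x - m) (fun _ => by fun_prop)
  have hmgf : mgf (∑ i, fun ω => U i ω - m) P' s ≤ Real.exp (n * (V * s ^ 2)) := by
    rw [hind.mgf_sum₀ hmeas]
    calc ∏ i, mgf (fun ω => U i ω - m) P' s ≤ ∏ i : Fin n, Real.exp (V * s ^ 2) := by
          refine Finset.prod_le_prod (fun i _ => mgf_nonneg) fun i _ => ?_
          refine le_trans (le_of_eq ?_) h2
          exact ((hidc i).comp (u := fun x => Real.exp (s * x)) (by fun_prop)).integral_eq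
      _ = _ := by
          rw [Finset.prod_const, Finset.card_univ, Fintype.card_fin, ← Real.exp_nat_mul]
  have hexp : Integrable (fun ω => Real.exp (s * (∑ i, fun ω => U i ω - m) ω)) P' := by
    have h3 : ∀ i ∈ (Finset.univ : Finset (Fin n)),
        Integrable (fun ω => Real.exp (s * (U i ω - m))) P' := fun i _ =>
      ((hidc i).comp (u := fun x => Real.exp (s * x)) (by fun_prop)).integrable_iff.2 h1
    exact hind.integrable_exp_mul_sum (fun i => (hUm i).sub_const m) h3
  have hch := measure_ge_le_exp_mul_mgf (μ := P') (X := ∑ i, fun ω => U i ω - m) (t := s) (n * t)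
    hs0 hexp
  have hset : {ω | t ≤ (n : ℝ)⁻¹ * ∑ i, U i ω - m} =
      {ω | n * t ≤ (∑ i, fun ω => U i ω - m) ω} := by
    ext ω
    simp only [Set.mem_ofPred_eq, Finset.sum_apply, Finset.sum_sub_distrib, Finset.sum_const,
      Finset.card_univ, Fintype.card_fin, nsmul_eq_mul]
    rw [← mul_le_mul_iff_right₀ hn']
    rw [mul_sub, mul_inv_cancel_left₀ hn'.ne']
  rw [hset]
  refine hch.trans ?_
  calc Real.exp (-s * (n * t)) * mgf (∑ i, fun ω => U i ω - m) P' s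
      ≤ Real.exp (-s * (n * t)) * Real.exp (n * (V * s ^ 2)) := by gcongr
    _ = Real.exp (-(n * t ^ 2 / (4 * V))) := by
        rw [← Real.exp_add]
        congr 1
        rw [hs]
        field_simp
        ring

/-- Bernstein's inequality for the mean of independent copies of a variable `g` with
`E exp (a |g|) ≤ C`. -/
theorem measure_abs_mean_ge_le (hn : 0 < n) (hC0 : 0 < C) (ha : 0 < a) (hg : AEMeasurable g P)
    (hint : Integrable (fun ω => Real.exp (a * |g ω|)) P)
    (hC : ∫ ω, Real.exp (a * |g ω|) ∂P ≤ C) (hUm : ∀ i, Measurable (U i))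
    (hU : iIndepFun U P')
    (hid : ∀ i, IdentDistrib (U i) g P' P) {t : ℝ} (ht0 : 0 ≤ t) (ht : t ≤ a * bernsteinVar a C) :
    P'.real {ω | t ≤ |(n : ℝ)⁻¹ * ∑ i, U i ω - P[g]|} ≤
      2 * Real.exp (-(n * t ^ 2 / (4 * bernsteinVar a C))) := by
  have h1 := measure_mean_ge_le hn hC0 ha hg hint hC hUm hU hid ht0 ht
  have h2 := measure_mean_ge_le (g := fun ω => -g ω) (U := fun i ω => -U i ω) hn hC0 ha hg.neg
    (by simpa using hint) (by simpa using hC) (fun i => (hUm i).neg) (hU.comp (fun _ x => -x) (fun _ => by fun_prop))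
    (fun i => (hid i).comp (u := fun x => -x) (by fun_prop)) ht0 ht
  have hsub : {ω | t ≤ |(n : ℝ)⁻¹ * ∑ i, U i ω - P[g]|} ⊆
      {ω | t ≤ (n : ℝ)⁻¹ * ∑ i, U i ω - P[g]} ∪
        {ω | t ≤ (n : ℝ)⁻¹ * ∑ i, -U i ω - P[fun ω => -g ω]} := by
    intro ω hω
    simp only [Set.mem_union, Set.mem_ofPred_eq, Finset.sum_neg_distrib, mul_neg,
      integral_neg] at hω ⊢
    rcases le_abs.1 hω with h | h
    · exact Or.inl h
    · exact Or.inr (by linarith)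
  refine (measureReal_mono hsub).trans ((measureReal_union_le _ _).trans ?_)
  linarith

end Bernstein

/-! ### Gaussian mixtures -/

section Mixture

/-- The exponential moment of the square of a normal variable is bounded in terms of its second
moment. -/
theorem exists_exp_sq_gaussianReal_le : ∃ τ > 0, ∃ C > 0, ∀ (m : ℝ) (v : NNReal) (c : ℝ), 0 ≤ c →
    c * (m ^ 2 + v) ≤ τ → Integrable (fun x => Real.exp (c * x ^ 2)) (gaussianReal m v) ∧
      ∫ x, Real.exp (c * x ^ 2) ∂gaussianReal m v ≤ C := by
  obtain ⟨τ, hτ, hint⟩ := IsGaussian.exists_integrable_exp_sq (gaussianReal 0 1)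
  -- Write the variable as m + √v x with x standard normal. Since (m + √v x)² ≤ 2m² + 2v x², half of
  -- the Fernique exponent τ of the standard normal suffices, with a constant free of m and v.
  refine ⟨τ / 2, by positivity, Real.exp τ * ∫ x, Real.exp (τ * ‖x‖ ^ 2) ∂gaussianReal 0 1, ?_, ?_⟩
  · exact mul_pos (Real.exp_pos _) (integral_exp_pos hint)
  intro m v c hc hle
  have hmap : gaussianReal m v = (gaussianReal 0 1).map (fun x => m + √(v : ℝ) * x) := by
    have h1 : (gaussianReal 0 1).map (fun x => √(v : ℝ) * x) = gaussianReal 0 v := by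
      rw [gaussianReal_map_const_mul]
      congr 1
      · simp
      · ext; simp
    have h2 := gaussianReal_map_const_add (μ := 0) (v := v) m
    rw [← h1, Measure.map_map (by fun_prop) (by fun_prop), zero_add] at h2
    exact h2.symm
  have hbound : ∀ x : ℝ, Real.exp (c * (m + √(v : ℝ) * x) ^ 2) ≤
      Real.exp τ * Real.exp (τ * ‖x‖ ^ 2) := by
    intro x
    rw [← Real.exp_add, Real.exp_le_exp, Real.norm_eq_abs, sq_abs]
    have h1 : (m + √(v : ℝ) * x) ^ 2 ≤ 2 * m ^ 2 + 2 * v * x ^ 2 := by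
      have h2 : √(v : ℝ) ^ 2 = v := Real.sq_sqrt v.2
      have h3 := sq_nonneg (m - √(v : ℝ) * x)
      have h4 : (√(v : ℝ) * x) ^ 2 = v * x ^ 2 := by rw [mul_pow, h2]
      nlinarith
    have h5 : c * m ^ 2 ≤ τ / 2 := by nlinarith [mul_nonneg hc v.2, show (v : ℝ) = v.1 from rfl]
    have h6 : c * v ≤ τ / 2 := by nlinarith [mul_nonneg hc (sq_nonneg m)]
    have h7 := mul_le_mul_of_nonneg_left h1 hc
    have h8 := mul_le_mul_of_nonneg_right h6 (sq_nonneg x)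
    nlinarith
  have hi : Integrable (fun x => Real.exp (c * (m + √(v : ℝ) * x) ^ 2)) (gaussianReal 0 1) := by
    refine (hint.const_mul (Real.exp τ)).mono' (by fun_prop) (Filter.Eventually.of_forall fun x => ?_)
    rw [Real.norm_eq_abs, abs_of_pos (Real.exp_pos _)]
    exact hbound x
  rw [hmap]
  constructor
  · rw [integrable_map_measure (by fun_prop) (by fun_prop)]
    exact hi
  · rw [integral_map (by fun_prop) (by fun_prop), ← integral_const_mul]
    exact integral_mono hi (hint.const_mul _) hbound

end Mixture

/-! ### Moments of the sliced Gaussian population -/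

section Population

/-- Coordinatewise mean of a random vector. -/
def popMean {Ω₀ : Type*} [MeasurableSpace Ω₀] {p : ℕ} (P₀ : Measure Ω₀)
    (X : Ω₀ → EuclideanSpace ℝ (Fin p)) : Fin p → ℝ := fun j => ∫ ω, X ω j ∂P₀

/-- The integral of the centred random vector over a slice. -/
def sliceMoment {Ω₀ : Type*} [MeasurableSpace Ω₀] {p H : ℕ} (P₀ : Measure Ω₀)
    (X : Ω₀ → EuclideanSpace ℝ (Fin p)) (Y : Ω₀ → Fin H) (h : Fin H) : Fin p → ℝ :=
  fun j => ∫ ω, (if Y ω = h then X ω j - popMean P₀ X j else 0) ∂P₀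

variable {Ω₀ : Type*} [MeasurableSpace Ω₀] {p H : ℕ} {P₀ : Measure Ω₀}
  {X : Ω₀ → EuclideanSpace ℝ (Fin p)} {Y : Ω₀ → Fin H} {m : Fin H → EuclideanSpace ℝ (Fin p)}
  {C : Fin H → Matrix (Fin p) (Fin p) ℝ}

theorem integral_ite_slice (hY : Measurable Y) (h : Fin H) (hpos : 0 < P₀.real (Y ⁻¹' {h}))
    (f : Ω₀ → ℝ) : ∫ ω, (if Y ω = h then f ω else 0) ∂P₀
      = P₀.real (Y ⁻¹' {h}) * ∫ ω, f ω ∂P₀[|Y ⁻¹' {h}] := by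
  have h1 : (fun ω => if Y ω = h then f ω else 0) = (Y ⁻¹' {h}).indicator f := by
    ext ω
    by_cases hω : Y ω = h <;> simp [hω]
  rw [h1, integral_indicator (hY (measurableSet_singleton h)), ProbabilityTheory.cond,
    integral_smul_measure, ENNReal.toReal_inv, smul_eq_mul, ← mul_assoc]
  rw [Measure.real] at hpos ⊢
  rw [mul_inv_cancel₀ hpos.ne', one_mul]

namespace IsSlicedGaussian

/-- Given a slice, linear functionals of the random vector are normal. -/
theorem exists_law (HG : IsSlicedGaussian P₀ X Y m C) (w : Fin p → ℝ) (c : ℝ) (h : Fin H) :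
    ∃ (a : ℝ) (v : NNReal), (P₀[|Y ⁻¹' {h}]).map (fun ω => w ⬝ᵥ (X ω).ofLp - c)
      = gaussianReal a v := by
  have hgauss : IsGaussian ((P₀[|Y ⁻¹' {h}]).map X) := by rw [HG.law h]; infer_instance
  have h1 := IsGaussian.map_eq_gaussianReal (μ := (P₀[|Y ⁻¹' {h}]).map X)
    (innerSL ℝ (WithLp.toLp 2 w : EuclideanSpace ℝ (Fin p)))
  have hL : (fun ω => w ⬝ᵥ (X ω).ofLp - c) = (fun x => x - c) ∘
      ((innerSL ℝ (WithLp.toLp 2 w : EuclideanSpace ℝ (Fin p))) ∘ X) := by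
    ext ω
    simp [PiLp.inner_apply, dotProduct, mul_comm]
  rw [hL, ← Measure.map_map (by fun_prop)
    ((ContinuousLinearMap.measurable _).comp HG.measurable_X),
    ← Measure.map_map (ContinuousLinearMap.measurable _) HG.measurable_X, h1,
    gaussianReal_map_sub_const]
  exact ⟨_, _, rfl⟩

theorem measurable_dot (HG : IsSlicedGaussian P₀ X Y m C) (w : Fin p → ℝ) :
    Measurable fun ω => w ⬝ᵥ (X ω).ofLp := by
  have h1 := HG.measurable_X
  have h2 : ∀ j, Measurable fun ω => X ω j := fun j => by fun_prop
  unfold dotProduct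
  exact Finset.measurable_sum _ fun j _ => (h2 j).const_mul _

theorem dot_sub_popMean (w : Fin p → ℝ) (ω : Ω₀) :
    w ⬝ᵥ (X ω).ofLp - w ⬝ᵥ popMean P₀ X = ∑ j, w j * (X ω j - popMean P₀ X j) := by
  simp [dotProduct, mul_sub, Finset.sum_sub_distrib]

/-- Given a slice, linear functionals have the first two moments of a normal variable. -/
theorem exists_slice_moments (HG : IsSlicedGaussian P₀ X Y m C) (w : Fin p → ℝ) (c : ℝ)
    (h : Fin H) : ∃ (a : ℝ) (v : NNReal),
      (P₀[|Y ⁻¹' {h}]).map (fun ω => w ⬝ᵥ (X ω).ofLp - c) = gaussianReal a v ∧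
      Integrable (fun ω => w ⬝ᵥ (X ω).ofLp - c) (P₀[|Y ⁻¹' {h}]) ∧
      Integrable (fun ω => (w ⬝ᵥ (X ω).ofLp - c) ^ 2) (P₀[|Y ⁻¹' {h}]) ∧
      ∫ ω, (w ⬝ᵥ (X ω).ofLp - c) ∂P₀[|Y ⁻¹' {h}] = a ∧
      ∫ ω, (w ⬝ᵥ (X ω).ofLp - c) ^ 2 ∂P₀[|Y ⁻¹' {h}] = a ^ 2 + v := by
  obtain ⟨a, v, hav⟩ := HG.exists_law w c h
  have hm : AEMeasurable (fun ω => w ⬝ᵥ (X ω).ofLp - c) (P₀[|Y ⁻¹' {h}]) :=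
    ((HG.measurable_dot w).sub_const c).aemeasurable
  have hL2 : MemLp (fun x : ℝ => x) 2 (gaussianReal a v) := memLp_id_gaussianReal 2
  have hvar := variance_fun_id_gaussianReal (μ := a) (v := v)
  rw [variance_eq_sub hL2] at hvar
  simp only [Pi.pow_apply, integral_id_gaussianReal] at hvar
  refine ⟨a, v, hav, ?_, ?_, ?_, ?_⟩
  · have := hL2.integrable one_le_two
    rw [← hav, integrable_map_measure (by fun_prop) hm] at this
    exact this
  · have := hL2.integrable_sq
    rw [← hav, integrable_map_measure (by fun_prop) hm] at this
    exact this
  · have h1 := integral_map (μ := P₀[|Y ⁻¹' {h}]) hm (f := fun x => x) (by fun_prop)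
    rw [hav, integral_id_gaussianReal] at h1
    exact h1.symm
  · have h1 := integral_map (μ := P₀[|Y ⁻¹' {h}]) hm (f := fun x => x ^ 2) (by fun_prop)
    rw [hav] at h1
    rw [← h1]
    linarith

end IsSlicedGaussian

variable [IsProbabilityMeasure P₀]

theorem integrable_of_slices (hY : Measurable Y) {f : Ω₀ → ℝ}
    (hf : ∀ h, Integrable f (P₀[|Y ⁻¹' {h}])) : Integrable f P₀ := by
  rw [← sum_meas_smul_cond_fiber hY P₀, integrable_finsetSum_measure]
  exact fun h _ => (hf h).smul_measure (measure_ne_top _ _)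

theorem integral_eq_sum_slices (hY : Measurable Y) {f : Ω₀ → ℝ}
    (hf : ∀ h, Integrable f (P₀[|Y ⁻¹' {h}])) :
    ∫ ω, f ω ∂P₀ = ∑ h, P₀.real (Y ⁻¹' {h}) * ∫ ω, f ω ∂P₀[|Y ⁻¹' {h}] := by
  conv_lhs => rw [← sum_meas_smul_cond_fiber hY P₀]
  rw [integral_finsetSum_measure fun h _ => (hf h).smul_measure (measure_ne_top _ _)]
  refine Finset.sum_congr rfl fun h _ => ?_
  rw [integral_smul_measure]
  rfl

namespace IsSlicedGaussian

theorem integrable_dot_sub (HG : IsSlicedGaussian P₀ X Y m C) (w : Fin p → ℝ) (c : ℝ) :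
    Integrable (fun ω => w ⬝ᵥ (X ω).ofLp - c) P₀ :=
  integrable_of_slices HG.measurable_Y fun h => by
    obtain ⟨_, _, _, h1, _⟩ := HG.exists_slice_moments w c h
    exact h1

theorem integrable_coord (HG : IsSlicedGaussian P₀ X Y m C) (j : Fin p) :
    Integrable (fun ω => X ω j) P₀ := by
  simpa using HG.integrable_dot_sub (Pi.single j 1) 0

theorem memLp_coord (HG : IsSlicedGaussian P₀ X Y m C) (j : Fin p) :
    MemLp (fun ω => X ω j) 2 P₀ := by
  rw [memLp_two_iff_integrable_sq (HG.integrable_coord j).aestronglyMeasurable]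
  refine integrable_of_slices HG.measurable_Y fun h => ?_
  obtain ⟨_, _, _, _, h1, _⟩ := HG.exists_slice_moments (Pi.single j 1) 0 h
  simpa using h1

theorem integral_dot_sq (HG : IsSlicedGaussian P₀ X Y m C)
    (hcov : covMatrixOf P₀ (fun ω j => X ω j) = 1) (w : Fin p → ℝ) :
    ∫ ω, (w ⬝ᵥ (X ω).ofLp - w ⬝ᵥ popMean P₀ X) ^ 2 ∂P₀ = w ⬝ᵥ w := by
  have hc : ∀ i j, ∫ ω, (X ω i - popMean P₀ X i) * (X ω j - popMean P₀ X j) ∂P₀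
      = if i = j then 1 else 0 := by
    intro i j
    have h1 := congrFun (congrFun hcov i) j
    rw [Matrix.one_apply] at h1
    exact h1
  have hint : ∀ i j, Integrable
      (fun ω => (X ω i - popMean P₀ X i) * (X ω j - popMean P₀ X j)) P₀ := fun i j =>
    ((HG.memLp_coord i).sub (memLp_const _)).integrable_mul
      ((HG.memLp_coord j).sub (memLp_const _))
  have h1 : ∀ ω, (w ⬝ᵥ (X ω).ofLp - w ⬝ᵥ popMean P₀ X) ^ 2 = ∑ i, ∑ j, w i * w j *
      ((X ω i - popMean P₀ X i) * (X ω j - popMean P₀ X j)) := by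
    intro ω
    rw [dot_sub_popMean, pow_two, Finset.sum_mul_sum]
    exact Finset.sum_congr rfl fun i _ => Finset.sum_congr rfl fun j _ => by ring
  simp only [h1]
  rw [integral_finsetSum _ fun i _ => integrable_finsetSum _ fun j _ => (hint i j).const_mul _]
  refine Finset.sum_congr rfl fun i _ => ?_
  rw [integral_finsetSum _ fun j _ => (hint i j).const_mul _]
  simp [integral_const_mul, hc]

/-- The moments of a linear functional given a slice are bounded by its overall second moment. -/
theorem exists_slice_moments_le (HG : IsSlicedGaussian P₀ X Y m C)
    (hcov : covMatrixOf P₀ (fun ω j => X ω j) = 1) (w : Fin p → ℝ) (h : Fin H) :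
    ∃ (a : ℝ) (v : NNReal), (P₀[|Y ⁻¹' {h}]).map
        (fun ω => w ⬝ᵥ (X ω).ofLp - w ⬝ᵥ popMean P₀ X) = gaussianReal a v ∧
      ∫ ω, (w ⬝ᵥ (X ω).ofLp - w ⬝ᵥ popMean P₀ X) ∂P₀[|Y ⁻¹' {h}] = a ∧
      P₀.real (Y ⁻¹' {h}) * (a ^ 2 + v) ≤ w ⬝ᵥ w := by
  choose a v hlaw hint hint2 ha hv using HG.exists_slice_moments w (w ⬝ᵥ popMean P₀ X)
  refine ⟨a h, v h, hlaw h, ha h, ?_⟩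
  rw [← HG.integral_dot_sq hcov w, integral_eq_sum_slices HG.measurable_Y hint2, ← hv h]
  -- The overall second moment is a sum of nonnegative slice contributions, each therefore bounded
  -- by the total.
  exact Finset.single_le_sum (f := fun h => P₀.real (Y ⁻¹' {h}) *
    ∫ ω, (w ⬝ᵥ (X ω).ofLp - w ⬝ᵥ popMean P₀ X) ^ 2 ∂P₀[|Y ⁻¹' {h}])
    (fun h _ => mul_nonneg measureReal_nonneg (integral_nonneg fun _ => sq_nonneg _))
    (Finset.mem_univ h)

theorem sum_prob (HG : IsSlicedGaussian P₀ X Y m C) : ∑ h, P₀.real (Y ⁻¹' {h}) = 1 := by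
  have h1 := integral_eq_sum_slices (P₀ := P₀) HG.measurable_Y (f := fun _ => (1 : ℝ))
    (fun h => integrable_const _)
  have h2 : ∀ h, IsProbabilityMeasure (P₀[|Y ⁻¹' {h}]) := fun h =>
    cond_isProbabilityMeasure fun h0 => by
      have := HG.slice_pos h
      simp [Measure.real, h0] at this
  simp only [integral_const, probReal_univ, smul_eq_mul, mul_one] at h1
  exact h1.symm

/-- Exponential moments of squared linear functionals. -/
theorem exp_sq_le (HG : IsSlicedGaussian P₀ X Y m C)
    (hcov : covMatrixOf P₀ (fun ω j => X ω j) = 1) {pmin : ℝ} (hp0 : 0 < pmin)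
    (hpmin : ∀ h, pmin ≤ P₀.real (Y ⁻¹' {h})) {τ Cg : ℝ}
    (hτ : ∀ (m : ℝ) (v : NNReal) (c : ℝ), 0 ≤ c → c * (m ^ 2 + v) ≤ τ →
      Integrable (fun x => Real.exp (c * x ^ 2)) (gaussianReal m v) ∧
      ∫ x, Real.exp (c * x ^ 2) ∂gaussianReal m v ≤ Cg) {w : Fin p → ℝ} {c : ℝ} (hc : 0 ≤ c)
    (hcw : c * (w ⬝ᵥ w) ≤ τ * pmin) :
    Integrable (fun ω => Real.exp (c * (w ⬝ᵥ (X ω).ofLp - w ⬝ᵥ popMean P₀ X) ^ 2)) P₀ ∧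
      ∫ ω, Real.exp (c * (w ⬝ᵥ (X ω).ofLp - w ⬝ᵥ popMean P₀ X) ^ 2) ∂P₀ ≤ Cg := by
  have hsl : ∀ h, Integrable (fun ω => Real.exp (c * (w ⬝ᵥ (X ω).ofLp - w ⬝ᵥ popMean P₀ X) ^ 2))
      (P₀[|Y ⁻¹' {h}]) ∧
      ∫ ω, Real.exp (c * (w ⬝ᵥ (X ω).ofLp - w ⬝ᵥ popMean P₀ X) ^ 2) ∂P₀[|Y ⁻¹' {h}] ≤ Cg := by
    intro h
    obtain ⟨a, v, hlaw, -, hav⟩ := HG.exists_slice_moments_le hcov w h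
    -- This is where `pmin` enters: within a slice the second moment of the functional is at most
    -- `(w ⬝ᵥ w) / pmin`.
    have h1 : c * (a ^ 2 + v) ≤ τ := by
      have h2 : pmin * (a ^ 2 + v) ≤ w ⬝ᵥ w :=
        (mul_le_mul_of_nonneg_right (hpmin h) (by positivity)).trans hav
      have h3 : pmin * (c * (a ^ 2 + v)) ≤ pmin * τ := by
        nlinarith [mul_le_mul_of_nonneg_left h2 hc]
      exact le_of_mul_le_mul_left h3 hp0
    obtain ⟨h2, h3⟩ := hτ a v c hc h1
    have hm : AEMeasurable (fun ω => w ⬝ᵥ (X ω).ofLp - w ⬝ᵥ popMean P₀ X) (P₀[|Y ⁻¹' {h}]) :=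
      ((HG.measurable_dot w).sub_const _).aemeasurable
    rw [← hlaw] at h2 h3
    rw [integrable_map_measure (by fun_prop) hm] at h2
    rw [integral_map hm (by fun_prop)] at h3
    exact ⟨h2, h3⟩
  refine ⟨integrable_of_slices HG.measurable_Y fun h => (hsl h).1, ?_⟩
  rw [integral_eq_sum_slices HG.measurable_Y fun h => (hsl h).1]
  calc _ ≤ ∑ h, P₀.real (Y ⁻¹' {h}) * Cg :=
        Finset.sum_le_sum fun h _ => mul_le_mul_of_nonneg_left (hsl h).2 measureReal_nonneg
    _ = Cg := by rw [← Finset.sum_mul, HG.sum_prob, one_mul]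

theorem dot_sliceMoment (HG : IsSlicedGaussian P₀ X Y m C) (w : Fin p → ℝ) (h : Fin H) :
    w ⬝ᵥ sliceMoment P₀ X Y h = P₀.real (Y ⁻¹' {h}) *
      ∫ ω, (w ⬝ᵥ (X ω).ofLp - w ⬝ᵥ popMean P₀ X) ∂P₀[|Y ⁻¹' {h}] := by
  have hint : ∀ j, Integrable (fun ω => w j * (X ω j - popMean P₀ X j)) (P₀[|Y ⁻¹' {h}]) := by
    intro j
    obtain ⟨_, _, _, h1, _⟩ := HG.exists_slice_moments (Pi.single j 1) (popMean P₀ X j) h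
    simpa using h1.const_mul (w j)
  simp only [dot_sub_popMean]
  rw [integral_finsetSum _ fun j _ => hint j, Finset.mul_sum]
  refine Finset.sum_congr rfl fun j _ => ?_
  rw [sliceMoment, integral_ite_slice HG.measurable_Y h (HG.slice_pos h), integral_const_mul]
  ring

theorem sq_dot_sliceMoment_le (HG : IsSlicedGaussian P₀ X Y m C)
    (hcov : covMatrixOf P₀ (fun ω j => X ω j) = 1) (w : Fin p → ℝ) (h : Fin H) :
    (w ⬝ᵥ sliceMoment P₀ X Y h) ^ 2 ≤ w ⬝ᵥ w := by
  obtain ⟨a, v, -, ha, hav⟩ := HG.exists_slice_moments_le hcov w h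
  rw [HG.dot_sliceMoment, ha, mul_pow]
  have h1 : P₀.real (Y ⁻¹' {h}) ≤ 1 := measureReal_le_one
  have h2 := HG.slice_pos h
  have h3 := v.2
  have h4 : P₀.real (Y ⁻¹' {h}) * a ^ 2 ≤ w ⬝ᵥ w := by
    refine le_trans ?_ hav
    gcongr
    exact le_add_of_nonneg_right h3
  nlinarith [sq_nonneg a, mul_nonneg h2.le (sq_nonneg a)]

/-- Centring at the population mean is what makes the squared sample mean in the sample forms a
higher-order term. -/
theorem sum_sliceMoment (HG : IsSlicedGaussian P₀ X Y m C) (j : Fin p) :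
    ∑ h, sliceMoment P₀ X Y h j = 0 := by
  have hint : ∀ h, Integrable (fun ω => X ω j - popMean P₀ X j) (P₀[|Y ⁻¹' {h}]) := by
    intro h
    obtain ⟨_, _, _, h1, _⟩ := HG.exists_slice_moments (Pi.single j 1) (popMean P₀ X j) h
    simpa using h1
  have h1 := integral_eq_sum_slices HG.measurable_Y hint
  rw [integral_sub (HG.integrable_coord j) (integrable_const _)] at h1
  simp only [integral_const, probReal_univ, one_smul] at h1
  rw [show ∫ ω, X ω j ∂P₀ = popMean P₀ X j from rfl, sub_self] at h1
  rw [h1]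
  exact Finset.sum_congr rfl fun h _ =>
    integral_ite_slice HG.measurable_Y h (HG.slice_pos h) _

/-- The sliced inverse regression kernel in terms of the slice moments. -/
theorem sirKernel_apply (HG : IsSlicedGaussian P₀ X Y m C) (i j : Fin p) :
    sirKernel P₀ X Y i j = ∑ h, sliceMoment P₀ X Y h i * sliceMoment P₀ X Y h j
      / P₀.real (Y ⁻¹' {h}) := by
  have hcomap : MeasurableSpace.comap Y inferInstance ≤ (inferInstance : MeasurableSpace Ω₀) :=
    HG.measurable_Y.comap_le
  -- The conditional expectation is measurable with respect to `Y`, hence a function of `Y`; its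
  -- value on a slice is determined by integrating over that slice.
  have hfac : ∀ j, ∃ φ : Fin H → ℝ,
      P₀[fun ω' => X ω' j | MeasurableSpace.comap Y inferInstance] = φ ∘ Y := by
    intro j
    obtain ⟨φ, -, hφ⟩ := (stronglyMeasurable_condExp (μ := P₀) (f := fun ω' => X ω' j)
      (m := MeasurableSpace.comap Y inferInstance)).measurable.exists_eq_measurable_comp
    exact ⟨φ, hφ⟩
  choose φ hφ using hfac
  have hφh : ∀ j h, P₀.real (Y ⁻¹' {h}) * (φ j h - popMean P₀ X j) = sliceMoment P₀ X Y h j := by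
    intro j h
    have h1 := setIntegral_condExp (μ := P₀) hcomap (HG.integrable_coord j) (s := Y ⁻¹' {h})
      ⟨{h}, measurableSet_singleton h, rfl⟩
    rw [hφ] at h1
    have h2 : ∫ ω in Y ⁻¹' {h}, (φ j ∘ Y) ω ∂P₀ = P₀.real (Y ⁻¹' {h}) * φ j h := by
      rw [setIntegral_congr_fun (g := fun _ => φ j h) (HG.measurable_Y (measurableSet_singleton h))
        (fun ω hω => by
          have : Y ω = h := hω
          simp [this])]
      simp
    have h3 : (fun ω => if Y ω = h then X ω j - popMean P₀ X j else 0)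
        = (Y ⁻¹' {h}).indicator (fun ω => X ω j - popMean P₀ X j) := by
      ext ω
      by_cases hω : Y ω = h <;> simp [hω]
    rw [sliceMoment, h3, integral_indicator (HG.measurable_Y (measurableSet_singleton h)),
      integral_sub (HG.integrable_coord j).integrableOn (integrable_const _).integrableOn, ← h1, h2]
    simp
    ring
  have hmean : ∀ j, ∫ ω, (φ j ∘ Y) ω ∂P₀ = popMean P₀ X j := by
    intro j
    rw [← hφ, integral_condExp hcomap]
    rfl
  have hcovij : sirKernel P₀ X Y i j
      = ∫ ω, (φ i (Y ω) - popMean P₀ X i) * (φ j (Y ω) - popMean P₀ X j) ∂P₀ := by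
    simp only [sirKernel, covMatrixOf, Matrix.of_apply, covariance, hφ, hmean]
    rfl
  rw [hcovij]
  have hmap := integral_map (μ := P₀) HG.measurable_Y.aemeasurable
    (f := fun h => (φ i h - popMean P₀ X i) * (φ j h - popMean P₀ X j))
    (Measurable.of_discrete).aestronglyMeasurable
  have : IsProbabilityMeasure (P₀.map Y) :=
    Measure.isProbabilityMeasure_map HG.measurable_Y.aemeasurable
  rw [← hmap, integral_fintype Integrable.of_finite]
  refine Finset.sum_congr rfl fun h _ => ?_
  rw [Measure.real, Measure.map_apply HG.measurable_Y (measurableSet_singleton h), ← Measure.real,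
    ← hφh, ← hφh, smul_eq_mul]
  have := (HG.slice_pos h).ne'
  field_simp

end IsSlicedGaussian

end Population

/-! ### Sample quadratic forms and grids of sparse vectors -/

section SampleForms

variable {n p H : ℕ}

/-- The normalised sum, over a slice, of the observations centred at `c`. -/
def sliceSum (x : Fin n → EuclideanSpace ℝ (Fin p)) (y : Fin n → Fin H) (c : Fin p → ℝ)
    (h : Fin H) : Fin p → ℝ :=
  fun j => (n : ℝ)⁻¹ * ∑ i, if y i = h then x i j - c j else 0

theorem toBilin'_vecMulVec (a u w : Fin p → ℝ) :
    Matrix.toBilin' (vecMulVec a a) u w = (u ⬝ᵥ a) * (w ⬝ᵥ a) := by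
  rw [Matrix.toBilin'_apply', Matrix.vecMulVec_mulVec, dotProduct_comm a w]
  simp [mul_comm]

theorem sum_sliceProp (hn : 0 < n) (y : Fin n → Fin H) : ∑ h, sliceProp y h = 1 := by
  simp only [sliceProp, ← Finset.mul_sum]
  rw [Finset.sum_comm]
  simp [hn.ne']

theorem sliceProp_nonneg (y : Fin n → Fin H) (h : Fin H) : 0 ≤ sliceProp y h :=
  mul_nonneg (by positivity) (Finset.sum_nonneg fun i _ => by split_ifs <;> simp)

theorem sampleMean_sub (hn : 0 < n) (x : Fin n → EuclideanSpace ℝ (Fin p)) (y : Fin n → Fin H)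
    (c : Fin p → ℝ) (j : Fin p) : sampleMean x j - c j = ∑ h, sliceSum x y c h j := by
  simp only [sliceSum, ← Finset.mul_sum]
  rw [Finset.sum_comm]
  have : (n : ℝ) ≠ 0 := by positivity
  simp [sampleMean, mul_sub, this]

theorem sliceMean_sub (x : Fin n → EuclideanSpace ℝ (Fin p)) (y : Fin n → Fin H)
    (c : Fin p → ℝ) {h : Fin H} (hh : sliceProp y h ≠ 0) (j : Fin p) :
    sliceMean x y h j - c j = (sliceProp y h)⁻¹ * sliceSum x y c h j := by
  have h1 : sliceSum x y c h j = (n : ℝ)⁻¹ * (∑ i, if y i = h then x i j else 0)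
      - sliceProp y h * c j := by
    rw [sliceSum, sliceProp, mul_assoc, ← mul_sub, Finset.sum_mul, ← Finset.sum_sub_distrib]
    congr 1
    refine Finset.sum_congr rfl fun i _ => ?_
    split_ifs <;> simp
  rw [h1, mul_sub, ← mul_assoc, ← mul_assoc, inv_mul_cancel₀ hh, one_mul, sliceMean]

theorem isSymm_vecMulVec (a : Fin p → ℝ) : (vecMulVec a a).IsSymm := by
  rw [Matrix.IsSymm, Matrix.transpose_vecMulVec]

theorem isSymm_sampleKernel (x : Fin n → EuclideanSpace ℝ (Fin p)) (y : Fin n → Fin H) :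
    (sampleKernel x y).IsSymm := by
  rw [Matrix.IsSymm, sampleKernel, Matrix.transpose_sum]
  simp only [Matrix.transpose_smul, (isSymm_vecMulVec _).eq]

theorem isSymm_sampleCov (x : Fin n → EuclideanSpace ℝ (Fin p)) : (sampleCov x).IsSymm := by
  rw [Matrix.IsSymm, sampleCov, Matrix.transpose_smul, Matrix.transpose_sum]
  simp only [(isSymm_vecMulVec _).eq]

theorem toBilin'_sampleKernel (x : Fin n → EuclideanSpace ℝ (Fin p)) (y : Fin n → Fin H)
    (u : Fin p → ℝ) : Matrix.toBilin' (sampleKernel x y) u u =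
      ∑ h, sliceProp y h * (u ⬝ᵥ fun j => sliceMean x y h j - sampleMean x j) ^ 2 := by
  rw [sampleKernel, map_sum, LinearMap.sum_apply, LinearMap.sum_apply]
  refine Finset.sum_congr rfl fun h _ => ?_
  rw [map_smul, LinearMap.smul_apply, LinearMap.smul_apply, toBilin'_vecMulVec, smul_eq_mul, pow_two]

theorem sampleKernel_nonneg (x : Fin n → EuclideanSpace ℝ (Fin p)) (y : Fin n → Fin H)
    (u : Fin p → ℝ) : 0 ≤ Matrix.toBilin' (sampleKernel x y) u u := by
  rw [toBilin'_sampleKernel]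
  exact Finset.sum_nonneg fun h _ => mul_nonneg (sliceProp_nonneg y h) (sq_nonneg _)

theorem dot_sampleMean_sub (hn : 0 < n) (x : Fin n → EuclideanSpace ℝ (Fin p)) (y : Fin n → Fin H)
    (c u : Fin p → ℝ) : u ⬝ᵥ sampleMean x - u ⬝ᵥ c = ∑ h, u ⬝ᵥ sliceSum x y c h := by
  rw [← dotProduct_sub, ← dotProduct_sum]
  congr 1
  ext j
  rw [Pi.sub_apply, sampleMean_sub hn x y c, Finset.sum_apply]

/-- Variance identity, mean of squares minus square of the mean, recentred at an arbitrary `c`. With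
`c` the population mean the kernel becomes a function of averages of independent terms. -/
theorem toBilin'_sampleKernel_eq (hn : 0 < n) (x : Fin n → EuclideanSpace ℝ (Fin p))
    (y : Fin n → Fin H) (c : Fin p → ℝ) (hy : ∀ h, sliceProp y h ≠ 0) (u : Fin p → ℝ) :
    Matrix.toBilin' (sampleKernel x y) u u =
      ∑ h, (u ⬝ᵥ sliceSum x y c h) ^ 2 / sliceProp y h - (∑ h, u ⬝ᵥ sliceSum x y c h) ^ 2 := by
  rw [toBilin'_sampleKernel]
  set a := ∑ h, u ⬝ᵥ sliceSum x y c h with ha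
  have h1 : ∀ h, u ⬝ᵥ (fun j => sliceMean x y h j - sampleMean x j)
      = (sliceProp y h)⁻¹ * (u ⬝ᵥ sliceSum x y c h) - a := by
    intro h
    rw [ha, ← dot_sampleMean_sub hn]
    have : (fun j => sliceMean x y h j - sampleMean x j)
        = (sliceProp y h)⁻¹ • sliceSum x y c h - (sampleMean x - c) := by
      ext j
      simp only [Pi.sub_apply, Pi.smul_apply, smul_eq_mul, ← sliceMean_sub x y c (hy h)]
      ring
    rw [this, dotProduct_sub, dotProduct_smul, dotProduct_sub, smul_eq_mul]
  have h2 : ∀ h, sliceProp y h * (u ⬝ᵥ fun j => sliceMean x y h j - sampleMean x j) ^ 2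
      = (u ⬝ᵥ sliceSum x y c h) ^ 2 / sliceProp y h - 2 * a * (u ⬝ᵥ sliceSum x y c h)
        + a ^ 2 * sliceProp y h := by
    intro h
    rw [h1]
    have := hy h
    field_simp
    ring
  simp only [h2]
  rw [Finset.sum_add_distrib, Finset.sum_sub_distrib, ← Finset.mul_sum, ← Finset.mul_sum,
    sum_sliceProp hn, ← ha]
  ring

/-- The slices are irrelevant to the covariance; the sample mean is written as a sum of slice sums
so that one estimate serves both sample matrices. -/
theorem toBilin'_sampleCov_eq (hn : 0 < n) (x : Fin n → EuclideanSpace ℝ (Fin p))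
    (y : Fin n → Fin H) (c u : Fin p → ℝ) : Matrix.toBilin' (sampleCov x) u u =
      (n : ℝ)⁻¹ * ∑ i, (u ⬝ᵥ (x i).ofLp - u ⬝ᵥ c) ^ 2 - (∑ h, u ⬝ᵥ sliceSum x y c h) ^ 2 := by
  rw [sampleCov, map_smul, map_sum, LinearMap.smul_apply, LinearMap.smul_apply,
    LinearMap.sum_apply, LinearMap.sum_apply, smul_eq_mul]
  simp only [toBilin'_vecMulVec]
  set a := ∑ h, u ⬝ᵥ sliceSum x y c h with ha
  have h1 : ∀ i, u ⬝ᵥ (fun j => x i j - sampleMean x j) = (u ⬝ᵥ (x i).ofLp - u ⬝ᵥ c) - a := by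
    intro i
    rw [ha, ← dot_sampleMean_sub hn]
    have : (fun j => x i j - sampleMean x j) = (x i).ofLp - sampleMean x := rfl
    rw [this, dotProduct_sub]
    ring
  have hn' : (n : ℝ) ≠ 0 := by positivity
  have h2 : ∑ i, (u ⬝ᵥ (x i).ofLp - u ⬝ᵥ c) = n * a := by
    rw [ha, ← dot_sampleMean_sub hn, Finset.sum_sub_distrib, ← dotProduct_sum]
    have : ∑ i, (x i).ofLp = (n : ℝ) • sampleMean x := by
      ext j
      simp [sampleMean, hn']
    rw [this, dotProduct_smul]
    simp
    ring
  have h3 : ∀ i, (u ⬝ᵥ fun j => x i j - sampleMean x j) * (u ⬝ᵥ fun j => x i j - sampleMean x j)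
      = (u ⬝ᵥ (x i).ofLp - u ⬝ᵥ c) ^ 2 - 2 * a * (u ⬝ᵥ (x i).ofLp - u ⬝ᵥ c) + a ^ 2 := by
    intro i
    rw [h1]
    ring
  simp only [h3]
  rw [Finset.sum_add_distrib, Finset.sum_sub_distrib, ← Finset.mul_sum, h2]
  simp
  field_simp
  ring

/-- A vector with at most `r` non-zero coordinates in a grid of mesh `1 / (4 p)`. -/
def gridVec {p r : ℕ} (q : Fin r → Fin p × Fin (8 * p + 1)) : Fin p → ℝ :=
  ∑ i, Pi.single (q i).1 (((q i).2 : ℝ) / (4 * p) - 1)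

/-- Up to an error `1/4`, vectors in the unit ball with `r`-element support are grid vectors. -/
theorem exists_gridVec {r : ℕ} {S : Finset (Fin p)} (hS : S.card = r) {u : Fin p → ℝ}
    (hu : u ∈ suppOn S) (hu1 : u ⬝ᵥ u ≤ 1) : ∃ q : Fin r → Fin p × Fin (8 * p + 1),
      gridVec q ∈ suppOn S ∧ (u - gridVec q) ⬝ᵥ (u - gridVec q) ≤ 1 / 16 := by
  rcases Nat.eq_zero_or_pos p with rfl | hp
  · refine ⟨fun _ => (Fin.elim0 (S.orderEmbOfFin hS ‹_›), 0), fun j => j.elim0, ?_⟩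
    simp [dotProduct]
  have hp' : (0 : ℝ) < p := by exact_mod_cast hp
  have hp1 : (1 : ℝ) ≤ p := by exact_mod_cast hp
  have hj : ∀ j, |u j| ≤ 1 := by
    intro j
    have h1 : u j * u j ≤ u ⬝ᵥ u :=
      Finset.single_le_sum (f := fun j => u j * u j) (fun i _ => mul_self_nonneg (u i))
        (Finset.mem_univ j)
    exact abs_le_one_iff_mul_self_le_one.2 (h1.trans hu1)
  -- The `8 * p + 1` nodes fill [-1, 1] with spacing 1/(4p). Rounding down in every coordinate costs
  -- at most p · (1/(4p))² = 1/(16p) in squared norm.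
  have hfl : ∀ j, ∃ a : Fin (8 * p + 1), |u j - ((a : ℝ) / (4 * p) - 1)| ≤ 1 / (4 * p) := by
    intro j
    obtain ⟨h1, h2⟩ := abs_le.1 (hj j)
    have h0 : 0 ≤ (u j + 1) * (4 * p) := by
      have : 0 ≤ u j + 1 := by linarith
      positivity
    have h3 := Nat.floor_le h0
    have h4 := Nat.lt_floor_add_one ((u j + 1) * (4 * p))
    refine ⟨⟨⌊(u j + 1) * (4 * p)⌋₊, ?_⟩, ?_⟩
    · have : (⌊(u j + 1) * (4 * p)⌋₊ : ℝ) ≤ (8 * p : ℕ) := by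
        push_cast
        nlinarith
      exact Nat.lt_succ_of_le (by exact_mod_cast this)
    · have h5 : u j - (((⌊(u j + 1) * (4 * p)⌋₊ : ℕ) : ℝ) / (4 * p) - 1)
          = ((u j + 1) * (4 * p) - (⌊(u j + 1) * (4 * p)⌋₊ : ℕ)) / (4 * p) := by
        field_simp
        ring
      rw [Fin.val_mk, h5, abs_of_nonneg (div_nonneg (by linarith) (by positivity))]
      gcongr
      linarith
  choose a ha using hfl
  have hval : ∀ j, gridVec (fun i : Fin r => (S.orderEmbOfFin hS i, a (S.orderEmbOfFin hS i))) j
      = if j ∈ S then (a j : ℝ) / (4 * p) - 1 else 0 := by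
    intro j
    simp only [gridVec, Finset.sum_apply, Pi.single_apply]
    split_ifs with hjS
    · obtain ⟨i, hi⟩ : ∃ i, S.orderEmbOfFin hS i = j := by
        have : j ∈ Set.range (S.orderEmbOfFin hS) := by
          rw [Finset.range_orderEmbOfFin]; exact hjS
        exact this
      rw [Finset.sum_eq_single i]
      · simp [hi]
      · intro i' _ hne
        rw [if_neg]
        rintro h
        exact hne ((S.orderEmbOfFin hS).injective (h.symm.trans hi.symm))
      · simp
    · refine Finset.sum_eq_zero fun i _ => if_neg ?_
      rintro rfl
      exact hjS (S.orderEmbOfFin_mem hS i)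
  refine ⟨_, fun j hjS => by rw [hval, if_neg hjS], ?_⟩
  calc _ ≤ (∑ _j : Fin p, (1 / (4 * (p : ℝ))) ^ 2 : ℝ) := by
        refine Finset.sum_le_sum fun j _ => ?_
        rw [Pi.sub_apply, hval, ← pow_two, ← sq_abs]
        refine pow_le_pow_left₀ (abs_nonneg _) ?_ 2
        split_ifs with hjS
        · exact ha j
        · rw [hu j hjS]
          simp
    _ = 1 / (16 * p) := by
        rw [Finset.sum_const, Finset.card_univ, Fintype.card_fin, nsmul_eq_mul]
        field_simp
        norm_num
    _ ≤ 1 / 16 := by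
        gcongr
        linarith

theorem exists_abs_toBilin'_le (M : Matrix (Fin p) (Fin p) ℝ) :
    ∃ R, 0 ≤ R ∧ ∀ u, |Matrix.toBilin' M u u| ≤ R * (u ⬝ᵥ u) := by
  refine ⟨∑ i, ∑ j, |M i j|, by positivity, fun u => ?_⟩
  rw [Matrix.toBilin'_apply, Finset.sum_mul]
  refine (Finset.abs_sum_le_sum_abs _ _).trans (Finset.sum_le_sum fun i _ => ?_)
  rw [Finset.sum_mul]
  refine (Finset.abs_sum_le_sum_abs _ _).trans (Finset.sum_le_sum fun j _ => ?_)
  have hle : ∀ i, |u i| ^ 2 ≤ u ⬝ᵥ u := fun i => by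
    rw [sq_abs, pow_two]
    exact Finset.single_le_sum (f := fun j => u j * u j) (fun i _ => mul_self_nonneg (u i))
      (Finset.mem_univ i)
  rw [abs_mul, abs_mul, mul_comm |u i|, mul_assoc]
  gcongr
  nlinarith [sq_nonneg (|u i| - |u j|), hle i, hle j]

/-- A quadratic form that is small on grid vectors is small on all vectors supported on a
set of the size in question. -/
theorem abs_toBilin'_le_of_grid {M : Matrix (Fin p) (Fin p) ℝ} (hM : M.IsSymm) {r : ℕ}
    {S : Finset (Fin p)} (hS : S.card = r) {τ : ℝ} (hτ : 0 ≤ τ)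
    (hgrid : ∀ q : Fin r → Fin p × Fin (8 * p + 1), gridVec q ⬝ᵥ gridVec q ≤ 2 →
      |Matrix.toBilin' M (gridVec q) (gridVec q)| ≤ τ) {u : Fin p → ℝ} (hu : u ∈ suppOn S) :
    |Matrix.toBilin' M u u| ≤ 16 / 5 * τ * (u ⬝ᵥ u) := by
  set D := Matrix.toBilin' M with hD
  -- The best constant ρ on `suppOn S` is finite by `exists_abs_toBilin'_le`, so it may be absorbed
  -- on the left of a self-referential inequality.
  set B : Set ℝ := {ρ | 0 ≤ ρ ∧ ∀ u ∈ suppOn S, |D u u| ≤ ρ * (u ⬝ᵥ u)} with hB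
  have hne : B.Nonempty := by
    obtain ⟨R, hR, h⟩ := exists_abs_toBilin'_le M
    exact ⟨R, hR, fun u _ => h u⟩
  have hbdd : BddBelow B := ⟨0, fun ρ hρ => hρ.1⟩
  set ρ := sInf B with hρ
  have hρ0 : 0 ≤ ρ := le_csInf hne fun ρ hρ => hρ.1
  have hmem : ∀ u ∈ suppOn S, |D u u| ≤ ρ * (u ⬝ᵥ u) := by
    intro u hu
    by_cases h0 : u = 0
    · simp [h0]
    have h1 := dot_self_pos h0
    rw [← div_le_iff₀ h1]
    exact le_csInf hne fun ρ hρ => (div_le_iff₀ h1).2 (hρ.2 u hu)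
  -- Split u = w + e with w on the grid, |e| ≤ 1/4 and |w| ≤ 5/4. The cross term and the e-term
  -- contribute (10/16 + 1/16)ρ, so ρ ≤ τ + 11ρ/16, that is ρ ≤ 16τ/5.
  have hunit : ∀ u ∈ suppOn S, u ⬝ᵥ u = 1 → |D u u| ≤ τ + 11 / 16 * ρ := by
    intro u hu hu1
    obtain ⟨q, hq, hq1⟩ := exists_gridVec hS hu hu1.le
    set w := gridVec q
    set e := u - w with he
    have heS : e ∈ suppOn S := (suppOn S).sub_mem hu hq
    have hwu : w = u - e := by simp [he]
    have hww : w ⬝ᵥ w ≤ 25 / 16 := by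
      have h1 := dot_sq_le u e
      rw [hu1, one_mul] at h1
      have h2 : -(1 / 4) ≤ u ⬝ᵥ e := (abs_le_of_sq_le_sq' (by linarith) (by norm_num)).1
      have h3 : w ⬝ᵥ w = u ⬝ᵥ u - 2 * (u ⬝ᵥ e) + e ⬝ᵥ e := by
        simp only [hwu, sub_dotProduct, dotProduct_sub, dotProduct_comm e u]
        ring
      rw [h3]
      linarith
    have h1 := hgrid q (hww.trans (by norm_num))
    have h2 := bilin_sq_le_of_abs_le (toBilin'_symm hM) hmem hq heS
    have h3 := hmem e heS
    have h4 : |D w e| ≤ ρ * (5 / 16) := by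
      refine abs_le_of_sq_le_sq (h2.trans ?_) (by positivity)
      have : (w ⬝ᵥ w) * (e ⬝ᵥ e) ≤ 25 / 16 * (1 / 16) :=
        mul_le_mul hww hq1 (dot_self_nonneg e) (by norm_num)
      nlinarith [sq_nonneg ρ]
    have h5 : D u u = D w w + 2 * D w e + D e e := by
      have : u = w + e := by simp [he]
      have h6 : D e w = D w e := toBilin'_symm hM e w
      simp only [this, map_add, LinearMap.add_apply, h6]
      ring
    have h6 : |D e e| ≤ ρ * (1 / 16) := h3.trans (by gcongr)
    rw [abs_le] at *
    rw [h5]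
    constructor <;> linarith [h1.1, h1.2, h4.1, h4.2, h6.1, h6.2]
  have hmem2 : τ + 11 / 16 * ρ ∈ B := by
    refine ⟨by positivity, fun u hu => ?_⟩
    by_cases h0 : u = 0
    · simp [h0]
    have h1 := dot_self_pos h0
    have h2 := hunit ((√(u ⬝ᵥ u))⁻¹ • u) ((suppOn S).smul_mem _ hu) (by
      rw [smul_dotProduct, dotProduct_smul, smul_eq_mul, smul_eq_mul, ← mul_assoc, ← pow_two,
        inv_pow, Real.sq_sqrt h1.le, inv_mul_cancel₀ h1.ne'])
    rw [map_smul, map_smul, LinearMap.smul_apply, smul_eq_mul, smul_eq_mul, ← mul_assoc, ← pow_two,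
      inv_pow, Real.sq_sqrt h1.le, abs_mul, abs_of_nonneg (inv_nonneg.2 h1.le), mul_comm,
      ← div_eq_mul_inv, div_le_iff₀ h1] at h2
    exact h2
  have h1 : ρ ≤ τ + 11 / 16 * ρ := csInf_le hbdd hmem2
  refine (hmem u hu).trans ?_
  gcongr
  · exact dot_self_nonneg u
  · linarith

end SampleForms

/-! ### Deterministic error bounds on good samples -/

section GoodSample

variable {n p H : ℕ}

/-- Closeness, up to `t`, of the slice proportions, of the slice sums and (up to `t √r`) of the
second moments of `r`-sparse grid vectors to the values `q`, `α` and those of the identity. -/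
structure IsGoodSample (q : Fin H → ℝ) (α : Fin H → Fin p → ℝ) (c : Fin p → ℝ) (r : ℕ) (t : ℝ)
    (x : Fin n → EuclideanSpace ℝ (Fin p)) (y : Fin n → Fin H) : Prop where
  prop : ∀ h, |sliceProp y h - q h| ≤ t
  sum : ∀ h j, |sliceSum x y c h j - α h j| ≤ t
  grid : ∀ g : Fin r → Fin p × Fin (8 * p + 1), gridVec g ⬝ᵥ gridVec g ≤ 2 →
    |(n : ℝ)⁻¹ * ∑ i, (gridVec g ⬝ᵥ (x i).ofLp - gridVec g ⬝ᵥ c) ^ 2 - gridVec g ⬝ᵥ gridVec g|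
      ≤ t * √r

/-- A constant for the errors of the sample matrices. -/
def sampleConst (H : ℕ) (pmin : ℝ) : ℝ := 6 * H / pmin + 2 * H / pmin ^ 2 + H ^ 2 + 4

theorem isSymm_secondMoment (x : Fin n → EuclideanSpace ℝ (Fin p)) (c : Fin p → ℝ) :
    ((n : ℝ)⁻¹ • ∑ i, vecMulVec ((x i).ofLp - c) ((x i).ofLp - c) - 1).IsSymm := by
  rw [Matrix.IsSymm, Matrix.transpose_sub, Matrix.transpose_smul, Matrix.transpose_sum,
    Matrix.transpose_one]
  simp only [(isSymm_vecMulVec _).eq]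

theorem toBilin'_secondMoment (x : Fin n → EuclideanSpace ℝ (Fin p)) (c u : Fin p → ℝ) :
    Matrix.toBilin' ((n : ℝ)⁻¹ • ∑ i, vecMulVec ((x i).ofLp - c) ((x i).ofLp - c) - 1) u u
      = (n : ℝ)⁻¹ * ∑ i, (u ⬝ᵥ (x i).ofLp - u ⬝ᵥ c) ^ 2 - u ⬝ᵥ u := by
  rw [map_sub, map_smul, map_sum, LinearMap.sub_apply, LinearMap.sub_apply, LinearMap.smul_apply,
    LinearMap.smul_apply, LinearMap.sum_apply, LinearMap.sum_apply, smul_eq_mul]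
  simp only [toBilin'_vecMulVec, dotProduct_sub, ← pow_two]
  simp [Matrix.toBilin'_apply']

namespace IsGoodSample

variable {q : Fin H → ℝ} {α : Fin H → Fin p → ℝ} {c : Fin p → ℝ} {r : ℕ} {t pmin : ℝ}
  {x : Fin n → EuclideanSpace ℝ (Fin p)} {y : Fin n → Fin H} {S : Finset (Fin p)}

/-- Cauchy–Schwarz over the `r` coordinates in `S` only, so that coordinatewise errors t accumulate
to t√r and not to t√p. -/
theorem sq_dot_sub_le (h : IsGoodSample q α c r t x y) (hS : S.card = r) {u : Fin p → ℝ}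
    (hu : u ∈ suppOn S) (k : Fin H) :
    (u ⬝ᵥ sliceSum x y c k - u ⬝ᵥ α k) ^ 2 ≤ (t * √r) ^ 2 * (u ⬝ᵥ u) := by
  have h1 : u ⬝ᵥ sliceSum x y c k - u ⬝ᵥ α k = ∑ j ∈ S, u j * (sliceSum x y c k j - α k j) := by
    rw [← dotProduct_sub, dotProduct]
    refine (Finset.sum_subset (Finset.subset_univ S) fun j _ hj => ?_).symm
    rw [hu j hj, zero_mul]
  have h2 : ∑ j ∈ S, u j ^ 2 ≤ u ⬝ᵥ u := by
    simp only [dotProduct, ← pow_two]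
    exact Finset.sum_le_univ_sum_of_nonneg fun j => sq_nonneg _
  have h3 : ∑ j ∈ S, (sliceSum x y c k j - α k j) ^ 2 ≤ r * t ^ 2 := by
    rw [← hS, ← nsmul_eq_mul]
    refine Finset.sum_le_card_nsmul _ _ _ fun j _ => ?_
    rw [← sq_abs]
    exact pow_le_pow_left₀ (abs_nonneg _) (h.sum k j) 2
  rw [h1, mul_pow, Real.sq_sqrt (by positivity), mul_comm (t ^ 2), mul_comm]
  refine (Finset.sum_mul_sq_le_sq_mul_sq _ _ _).trans ?_
  exact mul_le_mul h2 h3 (Finset.sum_nonneg fun _ _ => sq_nonneg _) (dot_self_nonneg u)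

theorem abs_dot_sub_le (h : IsGoodSample q α c r t x y) (ht : 0 ≤ t) (hS : S.card = r)
    {u : Fin p → ℝ} (hu : u ∈ suppOn S) (k : Fin H) :
    |u ⬝ᵥ sliceSum x y c k - u ⬝ᵥ α k| ≤ t * √r * √(u ⬝ᵥ u) := by
  refine abs_le_of_sq_le_sq ((h.sq_dot_sub_le hS hu k).trans ?_) (by positivity)
  rw [mul_pow _ (√(u ⬝ᵥ u)), Real.sq_sqrt (dot_self_nonneg u)]

/-- The population slice moments cancel in the sum, leaving H errors of size t√r |u|. The square is
of second order and t√r ≤ 1 relaxes it to first order, to match the other errors. -/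
theorem sq_sum_le (h : IsGoodSample q α c r t x y) (ht : 0 ≤ t) (hS : S.card = r)
    (ht1 : t * √r ≤ 1) (hα : ∀ j, ∑ k, α k j = 0) {u : Fin p → ℝ} (hu : u ∈ suppOn S) :
    (∑ k, u ⬝ᵥ sliceSum x y c k) ^ 2 ≤ H ^ 2 * (t * √r) * (u ⬝ᵥ u) := by
  have h1 : ∑ k, u ⬝ᵥ α k = 0 := by
    rw [← dotProduct_sum]
    have : ∑ k, α k = 0 := by
      ext j
      rw [Finset.sum_apply, hα, Pi.zero_apply]
    rw [this, dotProduct_zero]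
  have h2 : |∑ k, u ⬝ᵥ sliceSum x y c k| ≤ H * (t * √r * √(u ⬝ᵥ u)) := by
    have h3 : ∑ k, u ⬝ᵥ sliceSum x y c k = ∑ k, (u ⬝ᵥ sliceSum x y c k - u ⬝ᵥ α k) := by
      rw [Finset.sum_sub_distrib, h1, sub_zero]
    rw [h3]
    refine (Finset.abs_sum_le_sum_abs _ _).trans ?_
    refine (Finset.sum_le_card_nsmul _ _ _ fun k _ => h.abs_dot_sub_le ht hS hu k).trans ?_
    simp
  rw [← sq_abs]
  refine (pow_le_pow_left₀ (abs_nonneg _) h2 2).trans ?_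
  rw [mul_pow, mul_pow _ (√(u ⬝ᵥ u)), Real.sq_sqrt (dot_self_nonneg u), ← mul_assoc]
  have h4 : (t * √r) ^ 2 ≤ t * √r := by
    have : 0 ≤ t * √r := by positivity
    nlinarith
  have := dot_self_nonneg u
  gcongr

theorem abs_kernel_sub_le (h : IsGoodSample q α c r t x y) (hn : 0 < n) (ht : 0 ≤ t) (hr : 0 < r)
    (hp0 : 0 < pmin) (hq : ∀ k, pmin ≤ q k) (hS : S.card = r) (ht1 : t * √r ≤ 1)
    (ht2 : t * √r ≤ pmin / 2) (hα : ∀ j, ∑ k, α k j = 0)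
    (hα1 : ∀ (u : Fin p → ℝ) k, (u ⬝ᵥ α k) ^ 2 ≤ u ⬝ᵥ u) {u : Fin p → ℝ} (hu : u ∈ suppOn S) :
    |Matrix.toBilin' (sampleKernel x y) u u - ∑ k, (u ⬝ᵥ α k) ^ 2 / q k|
      ≤ sampleConst H pmin * (t * √r) * (u ⬝ᵥ u) := by
  set δ := t * √r with hδ
  set U := u ⬝ᵥ u with hU
  have hU0 : 0 ≤ U := dot_self_nonneg u
  have hδ0 : 0 ≤ δ := by positivity
  have htδ : t ≤ δ := le_mul_of_one_le_right ht (Real.one_le_sqrt.2 (by exact_mod_cast hr))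
  have hhat : ∀ k, pmin / 2 ≤ sliceProp y k := by
    intro k
    have h1 := (abs_le.1 (h.prop k)).1
    have h2 := hq k
    linarith
  -- The numerator error 3δU over a denominator of at least pmin/2 gives 6/pmin; the denominator
  -- error δ over pmin²/2 gives 2/pmin².
  have hterm : ∀ k, |(u ⬝ᵥ sliceSum x y c k) ^ 2 / sliceProp y k - (u ⬝ᵥ α k) ^ 2 / q k|
      ≤ (6 / pmin + 2 / pmin ^ 2) * δ * U := by
    intro k
    set A := u ⬝ᵥ sliceSum x y c k
    set a := u ⬝ᵥ α k
    have hP : 0 < sliceProp y k := by linarith [hhat k]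
    have hQ : 0 < q k := by linarith [hq k]
    have h1 : |A - a| ≤ δ * √U := h.abs_dot_sub_le ht hS hu k
    have h2 : |a| ≤ √U := Real.abs_le_sqrt (hα1 u k)
    have h3 : |A ^ 2 - a ^ 2| ≤ 3 * δ * U := by
      have h4 : A ^ 2 - a ^ 2 = (A - a) * (2 * a + (A - a)) := by ring
      have h5 : |2 * a + (A - a)| ≤ 3 * √U := by
        refine (abs_add_le _ _).trans ?_
        rw [abs_mul, abs_two]
        nlinarith [Real.sqrt_nonneg U]
      rw [h4, abs_mul]
      calc _ ≤ δ * √U * (3 * √U) := mul_le_mul h1 h5 (abs_nonneg _) (by positivity)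
        _ = 3 * δ * √U ^ 2 := by ring
        _ = 3 * δ * U := by rw [Real.sq_sqrt hU0]
    have h6 : A ^ 2 / sliceProp y k - a ^ 2 / q k = (A ^ 2 - a ^ 2) / sliceProp y k
        + a ^ 2 * ((q k - sliceProp y k) / (sliceProp y k * q k)) := by
      field_simp
      ring
    have h7 : |(A ^ 2 - a ^ 2) / sliceProp y k| ≤ 3 * δ * U / (pmin / 2) := by
      rw [abs_div, abs_of_pos hP]
      exact div_le_div₀ (by positivity) h3 (by positivity) (hhat k)
    have h8 : |a ^ 2 * ((q k - sliceProp y k) / (sliceProp y k * q k))|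
        ≤ U * (δ / (pmin / 2 * pmin)) := by
      rw [abs_mul, abs_of_nonneg (sq_nonneg a), abs_div, abs_of_pos (mul_pos hP hQ)]
      have h9 : |q k - sliceProp y k| ≤ δ := by
        rw [abs_sub_comm]
        exact (h.prop k).trans htδ
      have h10 := hα1 u k
      have h11 := hhat k
      have h12 := hq k
      gcongr
    rw [h6]
    refine (abs_add_le _ _).trans ((add_le_add h7 h8).trans (le_of_eq ?_))
    field_simp
    ring
  have hsum : |∑ k, (u ⬝ᵥ sliceSum x y c k) ^ 2 / sliceProp y k - ∑ k, (u ⬝ᵥ α k) ^ 2 / q k|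
      ≤ H * ((6 / pmin + 2 / pmin ^ 2) * δ * U) := by
    rw [← Finset.sum_sub_distrib]
    refine (Finset.abs_sum_le_sum_abs _ _).trans ?_
    refine (Finset.sum_le_card_nsmul _ _ _ fun k _ => hterm k).trans ?_
    simp
  have hmean := h.sq_sum_le ht hS ht1 hα hu
  rw [toBilin'_sampleKernel_eq hn x y c (fun k => (lt_of_lt_of_le (by positivity) (hhat k)).ne'), sub_right_comm]
  refine (abs_sub _ _).trans ?_
  rw [abs_of_nonneg (sq_nonneg (∑ k, u ⬝ᵥ sliceSum x y c k))]
  refine (add_le_add hsum hmean).trans ?_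
  have h0 : 0 ≤ δ * U := by positivity
  have h1 : sampleConst H pmin * δ * U
    = H * ((6 / pmin + 2 / pmin ^ 2) * δ * U) + H ^ 2 * δ * U + 4 * (δ * U) := by
    rw [sampleConst]
    ring
  rw [h1]
  linarith

theorem abs_cov_sub_le (h : IsGoodSample q α c r t x y) (hn : 0 < n) (ht : 0 ≤ t)
    (hp0 : 0 < pmin) (hS : S.card = r) (ht1 : t * √r ≤ 1) (hα : ∀ j, ∑ k, α k j = 0)
    {u : Fin p → ℝ} (hu : u ∈ suppOn S) :
    |Matrix.toBilin' (sampleCov x) u u - u ⬝ᵥ u| ≤ sampleConst H pmin * (t * √r) * (u ⬝ᵥ u) := by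
  have hmean := h.sq_sum_le ht hS ht1 hα hu
  have hgrid := abs_toBilin'_le_of_grid (isSymm_secondMoment x c) hS (τ := t * √r) (by positivity)
    (fun g hg => by rw [toBilin'_secondMoment]; exact h.grid g hg) hu
  rw [toBilin'_secondMoment] at hgrid
  rw [toBilin'_sampleCov_eq hn x y c, sub_right_comm]
  refine (abs_sub _ _).trans ?_
  rw [abs_of_nonneg (sq_nonneg (∑ k, u ⬝ᵥ sliceSum x y c k))]
  refine (add_le_add hgrid hmean).trans ?_
  have h0 : 0 ≤ t * √r * (u ⬝ᵥ u) := mul_nonneg (by positivity) (dot_self_nonneg u)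
  have h1 : 0 ≤ 6 * H / pmin + 2 * H / pmin ^ 2 := by positivity
  -- The summand 4 in the constant covers the factor 16/5 of the grid argument, and `H ^ 2` covers
  -- the squared mean.
  rw [sampleConst]
  nlinarith [mul_nonneg h1 h0]

end IsGoodSample

end GoodSample

/-! ### Probability of good samples -/

section GoodProbability

variable {n p H : ℕ}

theorem measurableSet_isGoodSample (q : Fin H → ℝ) (α : Fin H → Fin p → ℝ) (c : Fin p → ℝ) (r : ℕ)
    (t : ℝ) : MeasurableSet {z : Fin n → EuclideanSpace ℝ (Fin p) × Fin H |
      IsGoodSample q α c r t (fun i => (z i).1) (fun i => (z i).2)} := by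
  have hx : ∀ i j, Measurable fun z : Fin n → EuclideanSpace ℝ (Fin p) × Fin H => (z i).1 j :=
    fun i j => by fun_prop
  have hy : ∀ i h, MeasurableSet {z : Fin n → EuclideanSpace ℝ (Fin p) × Fin H | (z i).2 = h} :=
    fun i h => (measurable_snd.comp (measurable_pi_apply i)) (measurableSet_singleton h)
  have hprop : ∀ h, Measurable fun z : Fin n → EuclideanSpace ℝ (Fin p) × Fin H =>
      sliceProp (fun i => (z i).2) h := fun h =>
    (Finset.measurable_sum _ fun i _ =>
      Measurable.ite (hy i h) measurable_const measurable_const).const_mul _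
  have hsum : ∀ h j, Measurable fun z : Fin n → EuclideanSpace ℝ (Fin p) × Fin H =>
      sliceSum (fun i => (z i).1) (fun i => (z i).2) c h j := fun h j =>
    (Finset.measurable_sum _ fun i _ =>
      Measurable.ite (hy i h) ((hx i j).sub_const _) measurable_const).const_mul _
  have hdot : ∀ (w : Fin p → ℝ) i, Measurable fun z : Fin n → EuclideanSpace ℝ (Fin p) × Fin H =>
      w ⬝ᵥ (z i).1.ofLp := fun w i => Finset.measurable_sum _ fun j _ => (hx i j).const_mul _
  have heq : {z : Fin n → EuclideanSpace ℝ (Fin p) × Fin H |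
      IsGoodSample q α c r t (fun i => (z i).1) (fun i => (z i).2)} =
      (⋂ h, {z | |sliceProp (fun i => (z i).2) h - q h| ≤ t}) ∩
      ((⋂ h, ⋂ j, {z | |sliceSum (fun i => (z i).1) (fun i => (z i).2) c h j - α h j| ≤ t}) ∩
      (⋂ g : Fin r → Fin p × Fin (8 * p + 1), ⋂ _ : gridVec g ⬝ᵥ gridVec g ≤ 2,
        {z | |(n : ℝ)⁻¹ * ∑ i, (gridVec g ⬝ᵥ (z i).1.ofLp - gridVec g ⬝ᵥ c) ^ 2
          - gridVec g ⬝ᵥ gridVec g| ≤ t * √r})) := by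
    ext z
    simp only [Set.mem_ofPred_eq, Set.mem_inter_iff, Set.mem_iInter]
    exact ⟨fun h => ⟨h.prop, h.sum, h.grid⟩, fun h => ⟨h.1, h.2.1, h.2.2⟩⟩
  rw [heq]
  refine MeasurableSet.inter ?_ (MeasurableSet.inter ?_ ?_)
  · exact MeasurableSet.iInter fun h =>
      measurableSet_le ((hprop h).sub_const _).abs measurable_const
  · exact MeasurableSet.iInter fun h => MeasurableSet.iInter fun j =>
      measurableSet_le ((hsum h j).sub_const _).abs measurable_const
  · exact MeasurableSet.iInter fun g => MeasurableSet.iInter fun _ =>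
      measurableSet_le (((Finset.measurable_sum _ fun i _ =>
        ((hdot _ i).sub_const _).pow_const 2).const_mul _).sub_const _).abs measurable_const

variable {Ω₀ Ω : Type*} [MeasurableSpace Ω₀] [MeasurableSpace Ω] {P₀ : Measure Ω₀}
  [IsProbabilityMeasure P₀] {P : Measure Ω} [IsProbabilityMeasure P]
  {X : Ω₀ → EuclideanSpace ℝ (Fin p)} {Y : Ω₀ → Fin H} {m : Fin H → EuclideanSpace ℝ (Fin p)}
  {C : Fin H → Matrix (Fin p) (Fin p) ℝ} {Xs : Fin n → Ω → EuclideanSpace ℝ (Fin p)}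
  {Ys : Fin n → Ω → Fin H}

/-- Room for the union bounds over slices, coordinates and grid vectors. There are at most (p(8p +
1))^r grid vectors; p(8p + 1) ≤ 16p² ≤ p⁶ for p ≥ 2, so tails p⁻⁹ per unit of r leave p⁻³. -/
theorem pow_nine_bounds {z : ℝ} (hz : 2 ≤ z) {r : ℕ} (hr : 0 < r) :
    (z ^ 9)⁻¹ ≤ (z ^ 3)⁻¹ ∧ z * (z ^ 9)⁻¹ ≤ (z ^ 3)⁻¹ ∧
      (z * (8 * z + 1)) ^ r * ((z ^ 9)⁻¹) ^ r ≤ (z ^ 3)⁻¹ := by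
  have hz1 : 1 ≤ z := by linarith
  have h6 : (z ^ 3)⁻¹ ≤ 1 := inv_le_one_of_one_le₀ (one_le_pow₀ hz1)
  have h5 : 16 ≤ z ^ 4 := by
    calc (16 : ℝ) = 2 ^ 4 := by norm_num
      _ ≤ z ^ 4 := by gcongr
  have key : ∀ b : ℝ, b ≤ 16 * z ^ 2 → b * (z ^ 9)⁻¹ ≤ (z ^ 3)⁻¹ := by
    intro b hb
    rw [← div_eq_mul_inv, div_le_iff₀ (by positivity), ← div_eq_inv_mul, le_div_iff₀ (by positivity)]
    calc b * z ^ 3 ≤ 16 * z ^ 2 * z ^ 3 := by gcongr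
      _ ≤ z ^ 4 * z ^ 2 * z ^ 3 := by gcongr
      _ = z ^ 9 := by ring
  refine ⟨by simpa using key 1 (by nlinarith), key z (by nlinarith), ?_⟩
  rw [← mul_pow]
  calc _ ≤ ((z ^ 3)⁻¹) ^ r := pow_le_pow_left₀ (by positivity) (key _ (by nlinarith)) r
    _ ≤ ((z ^ 3)⁻¹) ^ 1 := pow_le_pow_of_le_one (by positivity) h6 hr
    _ = _ := pow_one _

namespace IsSlicedGaussian

/-- One Bernstein bound for all averages in `IsGoodSample`: each summand is dominated by 1 plus the
square of a centred linear functional with |w|² ≤ 2. -/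
theorem measure_abs_mean_sub_ge_le (HG : IsSlicedGaussian P₀ X Y m C)
    (hcov : covMatrixOf P₀ (fun ω j => X ω j) = 1) {pmin : ℝ} (hp0 : 0 < pmin)
    (hpmin : ∀ h, pmin ≤ P₀.real (Y ⁻¹' {h})) {τ Cg : ℝ} (hτ0 : 0 < τ) (hCg : 0 < Cg)
    (hτ : ∀ (m : ℝ) (v : NNReal) (c : ℝ), 0 ≤ c → c * (m ^ 2 + v) ≤ τ →
      Integrable (fun x => Real.exp (c * x ^ 2)) (gaussianReal m v) ∧
      ∫ x, Real.exp (c * x ^ 2) ∂gaussianReal m v ≤ Cg)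
    (hn : 0 < n) (hXs : ∀ i, Measurable (Xs i)) (hYs : ∀ i, Measurable (Ys i))
    (hid : ∀ i, IdentDistrib (fun ω => (Xs i ω, Ys i ω)) (fun ω => (X ω, Y ω)) P P₀)
    (hind : iIndepFun (fun i ω => (Xs i ω, Ys i ω)) P)
    {a : ℝ} (ha : a = τ * pmin / 2) {V : ℝ} (hV : V = bernsteinVar a (Real.exp a * Cg))
    {g : EuclideanSpace ℝ (Fin p) × Fin H → ℝ} (hg : Measurable g) {w : Fin p → ℝ}
    (hw : w ⬝ᵥ w ≤ 2) (hgw : ∀ z, |g z| ≤ 1 + (w ⬝ᵥ z.1.ofLp - w ⬝ᵥ popMean P₀ X) ^ 2)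
    {e s : ℝ} (he : ∫ ω, g (X ω, Y ω) ∂P₀ = e) (hs0 : 0 ≤ s) (hs : s ≤ a * V) :
    P.real {ω | s ≤ |(n : ℝ)⁻¹ * ∑ i, g (Xs i ω, Ys i ω) - e|}
      ≤ 2 * Real.exp (-(n * s ^ 2 / (4 * V))) := by
  have ha0 : 0 < a := by rw [ha]; positivity
  -- The factor 1/2 in `a` compensates |w|² ≤ 2.
  obtain ⟨h1, h2⟩ := HG.exp_sq_le hcov hp0 hpmin hτ (w := w) ha0.le (by
    rw [ha]
    nlinarith [mul_le_mul_of_nonneg_left hw (by positivity : 0 ≤ τ * pmin / 2)])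
  have hle : ∀ ω, Real.exp (a * |g (X ω, Y ω)|)
      ≤ Real.exp a * Real.exp (a * (w ⬝ᵥ (X ω).ofLp - w ⬝ᵥ popMean P₀ X) ^ 2) := by
    intro ω
    rw [← Real.exp_add, Real.exp_le_exp, ← mul_one_add]
    exact mul_le_mul_of_nonneg_left (hgw (X ω, Y ω)) ha0.le
  have hgm : Measurable fun ω => g (X ω, Y ω) := hg.comp (HG.measurable_X.prodMk HG.measurable_Y)
  have hint : Integrable (fun ω => Real.exp (a * |g (X ω, Y ω)|)) P₀ := by
    refine (h1.const_mul (Real.exp a)).mono'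
      (Real.measurable_exp.comp (hgm.abs.const_mul a)).aestronglyMeasurable (ae_of_all _ fun ω => ?_)
    rw [Real.norm_of_nonneg (Real.exp_pos _).le]
    exact hle ω
  have hC : ∫ ω, Real.exp (a * |g (X ω, Y ω)|) ∂P₀ ≤ Real.exp a * Cg := by
    refine (integral_mono hint (h1.const_mul (Real.exp a)) hle).trans ?_
    rw [integral_const_mul]
    exact mul_le_mul_of_nonneg_left h2 (Real.exp_pos _).le
  have := measure_abs_mean_ge_le (P := P₀) (P' := P) (U := fun i ω => g (Xs i ω, Ys i ω)) hn
    (by positivity : 0 < Real.exp a * Cg) ha0 hgm.aemeasurable hint hC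
    (fun i => hg.comp ((hXs i).prodMk (hYs i)))
    (hind.comp (fun _ => g) fun _ => hg) (fun i => (hid i).comp hg) hs0 (hV ▸ hs)
  rw [hV, ← he]
  exact this

theorem measure_not_isGoodSample_le (HG : IsSlicedGaussian P₀ X Y m C)
    (hcov : covMatrixOf P₀ (fun ω j => X ω j) = 1) {pmin : ℝ} (hp0 : 0 < pmin)
    (hpmin : ∀ h, pmin ≤ P₀.real (Y ⁻¹' {h})) {τ Cg : ℝ} (hτ0 : 0 < τ) (hCg : 0 < Cg)
    (hτ : ∀ (m : ℝ) (v : NNReal) (c : ℝ), 0 ≤ c → c * (m ^ 2 + v) ≤ τ →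
      Integrable (fun x => Real.exp (c * x ^ 2)) (gaussianReal m v) ∧
      ∫ x, Real.exp (c * x ^ 2) ∂gaussianReal m v ≤ Cg)
    (hn : 0 < n) (hXs : ∀ i, Measurable (Xs i)) (hYs : ∀ i, Measurable (Ys i))
    (hid : ∀ i, IdentDistrib (fun ω => (Xs i ω, Ys i ω)) (fun ω => (X ω, Y ω)) P P₀)
    (hind : iIndepFun (fun i ω => (Xs i ω, Ys i ω)) P)
    {a : ℝ} (ha : a = τ * pmin / 2) {V : ℝ} (hV : V = bernsteinVar a (Real.exp a * Cg))
    (hp : 2 ≤ p) {r : ℕ} (hr : 0 < r) {t : ℝ} (ht : t = 6 * √V * √(Real.log p / n))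
    (htr : t * √r ≤ a * V) :
    P.real {ω | ¬ IsGoodSample (fun h => P₀.real (Y ⁻¹' {h})) (sliceMoment P₀ X Y) (popMean P₀ X) r t
      (fun i => Xs i ω) (fun i => Ys i ω)} ≤ (4 * H + 2) * ((p : ℝ) ^ 3)⁻¹ := by
  have ha0 : 0 < a := by rw [ha]; positivity
  have hV0 : 0 < V := by rw [hV, bernsteinVar]; positivity
  have hp' : (2 : ℝ) ≤ p := by exact_mod_cast hp
  have hlog : 0 < Real.log p := Real.log_pos (by linarith)
  have hn' : (0 : ℝ) < n := by exact_mod_cast hn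
  have ht0 : 0 ≤ t := by rw [ht]; positivity
  have hta : t ≤ a * V :=
    (le_mul_of_one_le_right ht0 (Real.one_le_sqrt.2 (by exact_mod_cast hr))).trans htr
  have tail := fun {g : EuclideanSpace ℝ (Fin p) × Fin H → ℝ} => HG.measure_abs_mean_sub_ge_le
    (g := g) hcov hp0 hpmin hτ0 hCg hτ hn hXs hYs hid hind ha hV
  -- The constant 6√V in `t` is chosen so that 36/4 = 9.
  have hsq : (n : ℝ) * t ^ 2 / (4 * V) = 9 * Real.log p := by
    rw [ht, mul_pow, mul_pow, Real.sq_sqrt hV0.le, Real.sq_sqrt (by positivity)]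
    field_simp
    norm_num
  have hexp : Real.exp (-(n * t ^ 2 / (4 * V))) = ((p : ℝ) ^ 9)⁻¹ := by
    rw [hsq, Real.exp_neg, ← Real.exp_log (by positivity : 0 < (p : ℝ) ^ 9), Real.log_pow]
    norm_num
  -- The larger tolerance t√r for grid vectors raises the tail to the power r, matching the size of
  -- the grid.
  have hexpr : Real.exp (-(n * (t * √r) ^ 2 / (4 * V))) = (((p : ℝ) ^ 9)⁻¹) ^ r := by
    rw [← hexp, ← Real.exp_nat_mul, mul_pow, Real.sq_sqrt (by positivity)]
    congr 1
    ring
  have hYh : ∀ h, MeasurableSet {z : EuclideanSpace ℝ (Fin p) × Fin H | z.2 = h} := fun h =>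
    measurable_snd (measurableSet_singleton h)
  have hdot : ∀ w : Fin p → ℝ, Measurable fun z : EuclideanSpace ℝ (Fin p) × Fin H =>
      w ⬝ᵥ z.1.ofLp := fun w => Finset.measurable_sum _ fun j _ => by fun_prop
  have h1 : ∀ h, P.real {ω | t ≤ |sliceProp (fun i => Ys i ω) h - P₀.real (Y ⁻¹' {h})|}
      ≤ 2 * ((p : ℝ) ^ 9)⁻¹ := by
    intro h
    rw [← hexp]
    -- An indicator is dominated by the constant 1 alone, hence `w = 0`; the slice sums below use `w
    -- = Pi.single j 1` and |x| ≤ 1 + x².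
    refine tail (g := fun z => if z.2 = h then 1 else 0)
      (Measurable.ite (hYh h) measurable_const measurable_const) (w := 0) (by simp) (fun z => ?_)
      ?_ ht0 hta
    · split_ifs <;> simp
    · rw [integral_ite_slice HG.measurable_Y h (HG.slice_pos h)]
      have : IsProbabilityMeasure (P₀[|Y ⁻¹' {h}]) := cond_isProbabilityMeasure fun h0 => by
        have := HG.slice_pos h
        simp [Measure.real, h0] at this
      simp
  have h2 : ∀ h j, P.real {ω | t ≤ |sliceSum (fun i => Xs i ω) (fun i => Ys i ω) (popMean P₀ X) h j
      - sliceMoment P₀ X Y h j|} ≤ 2 * ((p : ℝ) ^ 9)⁻¹ := by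
    intro h j
    rw [← hexp]
    refine tail (g := fun z => if z.2 = h then z.1 j - popMean P₀ X j else 0)
      (Measurable.ite (hYh h) (by fun_prop) measurable_const) (w := Pi.single j 1)
      (by simp) (fun z => ?_) rfl ht0 hta
    have h3 : ∀ x : ℝ, |x| ≤ 1 + x ^ 2 := fun x => by
      rw [← sq_abs]
      nlinarith [sq_nonneg (|x| - 1), abs_nonneg x]
    simp only [single_one_dotProduct]
    split_ifs
    · exact h3 _
    · simp
      positivity
  have h3 : ∀ g : Fin r → Fin p × Fin (8 * p + 1), P.real {ω | gridVec g ⬝ᵥ gridVec g ≤ 2 ∧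
      t * √r ≤ |(n : ℝ)⁻¹ * ∑ i, (gridVec g ⬝ᵥ (Xs i ω).ofLp - gridVec g ⬝ᵥ popMean P₀ X) ^ 2
        - gridVec g ⬝ᵥ gridVec g|} ≤ 2 * (((p : ℝ) ^ 9)⁻¹) ^ r := by
    intro g
    by_cases hg : gridVec g ⬝ᵥ gridVec g ≤ 2
    · simp only [hg, true_and]
      rw [← hexpr]
      refine tail (g := fun z => (gridVec g ⬝ᵥ z.1.ofLp - gridVec g ⬝ᵥ popMean P₀ X) ^ 2)
        (((hdot _).sub_const _).pow_const 2) hg (fun z => ?_) (HG.integral_dot_sq hcov _)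
        (by positivity) htr
      rw [abs_of_nonneg (sq_nonneg _)]
      linarith
    · simp only [hg, false_and, Set.ofPred_false, measureReal_empty]
      positivity
  have hsub : {ω | ¬ IsGoodSample (fun h => P₀.real (Y ⁻¹' {h})) (sliceMoment P₀ X Y) (popMean P₀ X)
      r t (fun i => Xs i ω) (fun i => Ys i ω)} ⊆
      (⋃ h, {ω | t ≤ |sliceProp (fun i => Ys i ω) h - P₀.real (Y ⁻¹' {h})|}) ∪
      ((⋃ h, ⋃ j, {ω | t ≤ |sliceSum (fun i => Xs i ω) (fun i => Ys i ω) (popMean P₀ X) h j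
        - sliceMoment P₀ X Y h j|}) ∪
      (⋃ g : Fin r → Fin p × Fin (8 * p + 1), {ω | gridVec g ⬝ᵥ gridVec g ≤ 2 ∧
        t * √r ≤ |(n : ℝ)⁻¹ * ∑ i, (gridVec g ⬝ᵥ (Xs i ω).ofLp - gridVec g ⬝ᵥ popMean P₀ X) ^ 2
          - gridVec g ⬝ᵥ gridVec g|})) := by
    intro ω hω
    by_contra hcon
    simp only [Set.mem_union, Set.mem_iUnion, Set.mem_ofPred_eq, not_or, not_exists, not_and,
      not_le] at hcon
    exact hω ⟨fun h => (hcon.1 h).le, fun h j => (hcon.2.1 h j).le, fun g hg => (hcon.2.2 g hg).le⟩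
  refine (measureReal_mono hsub).trans ?_
  refine (measureReal_union_le _ _).trans ?_
  have b1 : P.real (⋃ h, {ω | t ≤ |sliceProp (fun i => Ys i ω) h - P₀.real (Y ⁻¹' {h})|})
      ≤ H * (2 * ((p : ℝ) ^ 9)⁻¹) := by
    refine (measureReal_iUnion_fintype_le _).trans ?_
    refine (Finset.sum_le_card_nsmul _ _ _ fun h _ => h1 h).trans ?_
    simp
  have b2 : P.real (⋃ h, ⋃ j, {ω | t ≤ |sliceSum (fun i => Xs i ω) (fun i => Ys i ω)
      (popMean P₀ X) h j - sliceMoment P₀ X Y h j|}) ≤ H * (p * (2 * ((p : ℝ) ^ 9)⁻¹)) := by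
    refine (measureReal_iUnion_fintype_le _).trans ?_
    refine (Finset.sum_le_card_nsmul _ _ (p * (2 * ((p : ℝ) ^ 9)⁻¹)) fun h _ => ?_).trans ?_
    · refine (measureReal_iUnion_fintype_le _).trans ?_
      refine (Finset.sum_le_card_nsmul _ _ _ fun j _ => h2 h j).trans ?_
      simp
    · simp
  have b3 : P.real (⋃ g : Fin r → Fin p × Fin (8 * p + 1), {ω | gridVec g ⬝ᵥ gridVec g ≤ 2 ∧
      t * √r ≤ |(n : ℝ)⁻¹ * ∑ i, (gridVec g ⬝ᵥ (Xs i ω).ofLp - gridVec g ⬝ᵥ popMean P₀ X) ^ 2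
        - gridVec g ⬝ᵥ gridVec g|}) ≤ (p * (8 * p + 1)) ^ r * (2 * (((p : ℝ) ^ 9)⁻¹) ^ r) := by
    refine (measureReal_iUnion_fintype_le _).trans ?_
    refine (Finset.sum_le_card_nsmul _ _ _ fun g _ => h3 g).trans ?_
    simp
  have hp1 : (1 : ℝ) ≤ p := by linarith
  obtain ⟨c1, c2, c3⟩ := pow_nine_bounds hp' hr
  have hH : (0 : ℝ) ≤ H := by positivity
  refine (add_le_add b1 ((measureReal_union_le _ _).trans (add_le_add b2 b3))).trans ?_
  nlinarith [mul_le_mul_of_nonneg_left c1 hH, mul_le_mul_of_nonneg_left c2 hH]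

end IsSlicedGaussian

end GoodProbability

/-! ### Selection frequencies when the criterion depends on the data -/

section SelectionEvent

variable {p A B k : ℕ}

theorem measurableSet_isSargmax {𝓓 : Type*} [MeasurableSpace 𝓓] {F : 𝓓 → Fin B → ℝ}
    (hF : ∀ b, Measurable fun z => F z b) (b : Fin B) : MeasurableSet {z | IsSargmax (F z) b} := by
  have hmax : ∀ c, Measurable fun z => ∀ b', F z b' ≤ F z c := fun c =>
    Measurable.forall fun b' => measurableSet_setOfPred.1 (measurableSet_le (hF b') (hF c))
  have h : {z | IsSargmax (F z) b} =
      {z | (∀ b', F z b' ≤ F z b) ∧ ∀ c, (∀ b', F z b' ≤ F z c) → b ≤ c} := rfl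
  rw [h, measurableSet_setOfPred]
  exact (hmax b).and (Measurable.forall fun c => (hmax c).imp measurable_const)

theorem measurable_selInd {𝓓 : Type*} [MeasurableSpace 𝓓] {f : 𝓓 → Finset (Fin p) → ℝ}
    (hf : ∀ T, Measurable fun z => f z T) (j : Fin p) (σ : Fin B → Finset (Fin p)) :
    Measurable fun z => selInd (f z) j σ := by
  refine Finset.measurable_sum _ fun b _ => Measurable.ite ?_ measurable_const measurable_const
  by_cases hj : j ∈ σ b
  · simp only [hj, and_true]
    exact measurableSet_isSargmax (F := fun z b => f z (σ b)) (fun b => hf (σ b)) b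
  · simp [hj]

/-- When the criterion is a measurable function of data that are independent of the random sets,
every element of `J` is, with high probability, selected at least a third as often as any other
element. -/
theorem exists_selection_event {Ω 𝓓 : Type*} [MeasurableSpace Ω] [MeasurableSpace 𝓓]
    {P : Measure Ω} [IsProbabilityMeasure P] (hA : 0 < A) (hB : 0 < B) (hk : k ≤ p)
    {J : Finset (Fin p)} (hJ : J.card ≤ k) (hJne : J.Nonempty) {Z : Ω → 𝓓} (hZ : Measurable Z)
    {S : Fin A → Fin B → Ω → Finset (Fin p)} (hS : ∀ a b, Measurable (S a b))
    (hu : ∀ a b, P.map (S a b) = unifSets p k)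
    (hind : iIndepFun (fun (ab : Fin A × Fin B) ω => S ab.1 ab.2 ω) P)
    (hZS : IndepFun Z (fun ω (ab : Fin A × Fin B) => S ab.1 ab.2 ω) P)
    {f : 𝓓 → Finset (Fin p) → ℝ} (hfm : ∀ T, Measurable fun z => f z T) {D : Set 𝓓}
    (hD : MeasurableSet D) (hf : ∀ z ∈ D, ∀ j ∈ J, ∀ j' ∉ J, ∀ T : Finset (Fin p), T.card = k →
      j ∉ T → j' ∈ T → f z T ≤ f z (swapSet j j' T)) :
    ∃ E : Set Ω, MeasurableSet E ∧
      (∀ ω ∈ E, Z ω ∈ D ∧ (∀ a b, (S a b ω).card = k) ∧ ∀ j ∈ J, ∀ j' ∉ J,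
        ∑ a, selInd (f (Z ω)) j' (fun b => S a b ω)
          < 3 * ∑ a, selInd (f (Z ω)) j (fun b => S a b ω)) ∧
      1 - P.real {ω | Z ω ∉ D} - p * Real.exp (-(A / (2 * (p : ℝ) ^ 2))) ≤ P.real E := by
  classical
  have := isProbabilityMeasure_unifSets hk
  set ν := Measure.pi fun _ : Fin A => groupLaw p B k with hν
  set Bad : Set (𝓓 × (Fin A → Fin B → Finset (Fin p))) := {zσ | zσ.1 ∈ D ∧
    ¬ ∀ j ∈ J, ∀ j' ∉ J, ∑ a, selInd (f zσ.1) j' (zσ.2 a) < 3 * ∑ a, selInd (f zσ.1) j (zσ.2 a)}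
    with hBad
  have hBadm : MeasurableSet Bad := by
    rw [hBad, measurableSet_setOfPred]
    refine (measurableSet_setOfPred.1 (measurable_fst hD)).and (Measurable.not ?_)
    -- The configurations σ are finitely many, so joint measurability reduces to measurability in
    -- the data for each fixed σ.
    refine Measurable.forall fun j => Measurable.imp measurable_const <| Measurable.forall fun j' =>
      Measurable.imp measurable_const <| measurable_from_prod_countable_left fun σ => ?_
    have hm : ∀ j, Measurable fun z => ∑ a, selInd (f z) j (σ a) := fun j =>
      Finset.measurable_sum _ fun a _ => measurable_selInd hfm j (σ a)
    exact measurableSet_setOfPred.1 (measurableSet_lt (hm j') ((hm j).const_mul 3))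
  set Ssets : Ω → Fin A → Fin B → Finset (Fin p) := fun ω a b => S a b ω with hSsets
  have hSm : Measurable Ssets := measurable_pi_lambda _ fun a => measurable_pi_lambda _ fun b => hS a b
  have hZSs : IndepFun Z Ssets P := by
    have h := hZS.comp (φ := id) (ψ := fun (s : Fin A × Fin B → Finset (Fin p)) a b => s (a, b))
      measurable_id (measurable_pi_lambda _ fun a => measurable_pi_lambda _ fun b =>
        measurable_pi_apply (a, b))
    exact h
  have hmap : P.map (fun ω => (Z ω, Ssets ω)) = (P.map Z).prod ν := by
    rw [(indepFun_iff_map_prod_eq_prod_map_map hZ.aemeasurable hSm.aemeasurable).1 hZSs,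
      map_sets_eq hA hB hS hu hind]
  have hpZ : IsProbabilityMeasure (P.map Z) := Measure.isProbabilityMeasure_map hZ.aemeasurable
  have hbound : P.real ((fun ω => (Z ω, Ssets ω)) ⁻¹' Bad)
      ≤ p * Real.exp (-(A / (2 * (p : ℝ) ^ 2))) := by
    rw [← map_measureReal_apply (hZ.prodMk hSm) hBadm, hmap]
    refine ENNReal.toReal_le_of_le_ofReal (by positivity) ?_
    -- Fubini with the data fixed: a section over `D` is bounded by `measure_selection_fails_le`,
    -- and a section outside `D` is empty.
    rw [Measure.prod_apply hBadm]
    calc _ ≤ ∫⁻ _z, ENNReal.ofReal (p * Real.exp (-(A / (2 * (p : ℝ) ^ 2)))) ∂P.map Z := by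
          refine lintegral_mono fun z => ?_
          by_cases hz : z ∈ D
          · rw [← ofReal_measureReal]
            refine ENNReal.ofReal_le_ofReal ?_
            have h1 : Prod.mk z ⁻¹' Bad = {σ | ¬ ∀ j ∈ J, ∀ j' ∉ J,
                ∑ a, selInd (f z) j' (σ a) < 3 * ∑ a, selInd (f z) j (σ a)} := by
              ext σ
              simp [hBad, hz]
            rw [h1]
            exact measure_selection_fails_le hk hB hJ hJne (hf z hz)
          · have h1 : Prod.mk z ⁻¹' Bad = ∅ := by
              ext σ
              simp [hBad, hz]
            simp [h1]
      _ = _ := by simp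
  have hcard : ∀ᵐ ω ∂P, ∀ a b, (S a b ω).card = k := by
    rw [ae_all_iff]
    intro a
    rw [ae_all_iff]
    intro b
    exact ae_of_ae_map (hS a b).aemeasurable ((hu a b).symm ▸ ae_card_unifSets k)
  have hcardm : MeasurableSet {ω | ∀ a b, (S a b ω).card = k} := by
    have : {ω | ∀ a b, (S a b ω).card = k} = ⋂ a, ⋂ b, S a b ⁻¹' {T | T.card = k} := by
      ext ω
      simp
    rw [this]
    exact MeasurableSet.iInter fun a => MeasurableSet.iInter fun b => hS a b MeasurableSet.of_discrete
  -- A null event, removed so that the cardinalities hold everywhere on the final event.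
  set N := {ω | ∀ a b, (S a b ω).card = k}ᶜ with hN
  have hN0 : P.real N = 0 := by
    rw [Measure.real, show P N = 0 from hcard, ENNReal.toReal_zero]
  set F := (Z ⁻¹' Dᶜ ∪ (fun ω => (Z ω, Ssets ω)) ⁻¹' Bad) ∪ N with hF
  have hFm : MeasurableSet F :=
    ((hZ hD.compl).union ((hZ.prodMk hSm) hBadm)).union hcardm.compl
  refine ⟨Fᶜ, hFm.compl, fun ω hω => ?_, ?_⟩
  · simp only [hF, hN, hBad, Set.mem_compl_iff, Set.mem_union, Set.mem_preimage, Set.mem_ofPred_eq,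
      not_or, not_not, not_and] at hω
    exact ⟨hω.1.1, hω.2, hω.1.2 hω.1.1⟩
  · rw [measureReal_compl hFm, probReal_univ]
    have h1 : P.real F ≤ P.real {ω | Z ω ∉ D} + p * Real.exp (-(A / (2 * (p : ℝ) ^ 2))) := by
      refine (measureReal_union_le _ _).trans ?_
      rw [hN0, add_zero]
      exact (measureReal_union_le _ _).trans (add_le_add le_rfl hbound)
    linarith

end SelectionEvent

/-! ### From selection frequencies to the set of largest scores -/

section Deterministic

variable {p d : ℕ} {lam₀ : Fin d → ℝ} {β : Matrix (Fin p) (Fin d) ℝ}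
  {M G : Matrix (Fin p) (Fin p) ℝ}

/-- The diagonal entries of the spiked matrix. -/
def spikeDiag (lam : Fin d → ℝ) (β : Matrix (Fin p) (Fin d) ℝ) (j : Fin p) : ℝ :=
  ∑ k, lam k * β j k ^ 2

theorem spikeForm_single (lam : Fin d → ℝ) (β : Matrix (Fin p) (Fin d) ℝ) (j : Fin p) :
    spikeForm lam (fun k i => β i k) (Pi.single j 1) (Pi.single j 1) = spikeDiag lam β j := by
  simp [spikeForm_apply, spikeDiag, pow_two]

theorem exists_isTopGenEigen (hM : M.IsSymm) (hG : G.IsSymm) {S : Finset (Fin p)} {ε : ℝ}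
    (H : NearSpiked lam₀ (fun k j => β j k) (Matrix.toBilin' M) (Matrix.toBilin' G) (suppOn S) ε)
    {r : ℕ} (hr : r ≤ S.card) :
    ∃ (lam : Fin r → ℝ) (v : Fin r → Fin p → ℝ), IsTopGenEigen M G S lam v := by
  obtain ⟨lam, v, h⟩ := exists_topPairs (toBilin'_symm hM) (toBilin'_symm hG)
    (fun u hu hu0 => H.G_pos hu hu0) r (hr.trans (card_le_finrank_suppOn S))
  exact ⟨lam, v, (isTopGenEigen_iff hM hG fun u hu hu0 => H.G_pos hu hu0).2 h⟩

/-- The vectors `b'` are the columns of β with the rows outside `S` set to zero; their mass is the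
trace of the compressed spiked matrix. -/
theorem abs_topSum_sub_le (hM : M.IsSymm) (hG : G.IsSymm) {S : Finset (Fin p)} {ε : ℝ}
    (H : NearSpiked lam₀ (fun k j => β j k) (Matrix.toBilin' M) (Matrix.toBilin' G) (suppOn S) ε)
    (hS : d + 1 ≤ S.card) : |topSum d M G S - ∑ j ∈ S, spikeDiag lam₀ β j| ≤ 4 * d * ε := by
  obtain ⟨lam, v, h⟩ := exists_isTopGenEigen hM hG H hS
  have hpos := fun u hu hu0 => H.G_pos (u := u) hu hu0
  rw [topSum_eq hM hG hpos H.psd h]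
  have h1 := H.abs_sum_lam_sub_le ((isTopGenEigen_iff hM hG hpos).1 h)
    (b' := fun k j => if j ∈ S then β j k else 0) (fun k j hj => if_neg hj) (fun k u hu => by
      refine Finset.sum_congr rfl fun j _ => ?_
      by_cases hj : j ∈ S
      · simp [hj]
      · simp [hj, hu j hj])
  have h2 : NearSpiked.spikeMass lam₀ (fun k j => if j ∈ S then β j k else 0)
      = ∑ j ∈ S, spikeDiag lam₀ β j := by
    simp only [NearSpiked.spikeMass, spikeDiag]
    rw [Finset.sum_comm]
    refine Finset.sum_congr rfl fun k _ => ?_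
    rw [← Finset.mul_sum, dotProduct]
    congr 1
    simp [pow_two]
  rwa [h2] at h1

/-- The trace term grows by exactly the diagonal entry at `j`, as the entry at `j'` vanishes; the
two approximation errors of 4dε do not outweigh it. -/
theorem topSum_le_swapSet (hM : M.IsSymm) (hG : G.IsSymm) {k : ℕ} {ε : ℝ} (hdk : d + 1 ≤ k)
    (H : ∀ S : Finset (Fin p), S.card = k → NearSpiked lam₀ (fun k j => β j k) (Matrix.toBilin' M)
      (Matrix.toBilin' G) (suppOn S) ε) {j j' : Fin p} (hj' : β j' = 0)
    (hj : 8 * d * ε ≤ spikeDiag lam₀ β j) {T : Finset (Fin p)} (hT : T.card = k) (hjT : j ∉ T)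
    (hj'T : j' ∈ T) : topSum d M G T ≤ topSum d M G (swapSet j j' T) := by
  have hT' : (swapSet j j' T).card = k := by simp [swapSet, hT]
  have h1 := abs_topSum_sub_le hM hG (H T hT) (hdk.trans hT.ge)
  have h2 := abs_topSum_sub_le hM hG (H _ hT') (hdk.trans hT'.ge)
  have h3 : ∑ i ∈ swapSet j j' T, spikeDiag lam₀ β i
      = ∑ i ∈ T, spikeDiag lam₀ β i + spikeDiag lam₀ β j := by
    rw [swapSet, Equiv.finsetCongr_apply, Finset.sum_map,
      ← Finset.add_sum_erase T (fun i => spikeDiag lam₀ β i) hj'T,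
      ← Finset.add_sum_erase T _ hj'T]
    have h4 : spikeDiag lam₀ β j' = 0 := by simp [spikeDiag, hj']
    have h5 : ∑ i ∈ T.erase j', spikeDiag lam₀ β ((Equiv.swap j j').toEmbedding i)
        = ∑ i ∈ T.erase j', spikeDiag lam₀ β i := by
      refine Finset.sum_congr rfl fun i hi => ?_
      rw [Equiv.coe_toEmbedding, Equiv.swap_apply_of_ne_of_ne]
      · rintro rfl
        exact hjT (Finset.mem_of_mem_erase hi)
      · exact Finset.ne_of_mem_erase hi
    rw [h4, h5]
    simp
    ring
  rw [h3] at h2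
  linarith [(abs_le.1 h1).2, (abs_le.1 h2).1]

/-- If the sets selected in the groups contain each element of `J` at least a third as often as
any other element, and the diagonal entries on `J` are large, then the largest scores are on `J`. -/
theorem subset_of_isTopIndexSet (hM : M.IsSymm) (hG : G.IsSymm) {A B k l : ℕ} (hA : 0 < A) {ε : ℝ}
    (H : ∀ S : Finset (Fin p), S.card = k → NearSpiked lam₀ (fun k j => β j k) (Matrix.toBilin' M)
      (Matrix.toBilin' G) (suppOn S) ε) {J : Finset (Fin p)} (hJ0 : ∀ j ∉ J, β j = 0)
    (hJ : ∀ j ∈ J, 52 * ε ≤ spikeDiag lam₀ β j) (hJl : J.card ≤ l) (hε : 0 < ε)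
    {S : Fin A → Fin B → Finset (Fin p)} (hS : ∀ a b, (S a b).card = k)
    {f : Finset (Fin p) → ℝ} (hf : ∀ T, T.card = k → f T = topSum d M G T)
    (hsel : ∀ j ∈ J, ∀ j' ∉ J, ∑ a, selInd f j' (S a) < 3 * ∑ a, selInd f j (S a))
    {lam : Fin A → Fin B → Fin (d + 1) → ℝ} {v : Fin A → Fin B → Fin (d + 1) → Fin p → ℝ}
    {bstar : Fin A → Fin B} (hlam : ∀ a b, IsTopGenEigen M G (S a b) (lam a b) (v a b))
    (hb : ∀ a, IsSargmax (fun b => ∑ i : Fin d, lam a b i.castSucc) (bstar a))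
    {T : Finset (Fin p)} (hT : IsTopIndexSet l
      (importanceScore (fun a => lam a (bstar a)) (fun a => v a (bstar a))) T) : J ⊆ T := by
  classical
  have hpos := fun a b u hu hu0 => (H (S a b) (hS a b)).G_pos (u := u) hu hu0
  have hb' : ∀ a, IsSargmax (fun b => f (S a b)) (bstar a) := by
    intro a
    have : (fun b => f (S a b)) = fun b => ∑ i : Fin d, lam a b i.castSucc := by
      ext b
      rw [hf _ (hS a b), topSum_eq hM hG (hpos a b) (H _ (hS a b)).psd (hlam a b)]
    rw [this]
    exact hb a
  set N : Fin p → ℝ := fun j => ∑ a, selInd f j (S a) with hN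
  -- If `j` lies in the selected set, the diagonal approximation applies to the unit vector at `j`;
  -- otherwise the loadings vanish by support and both sides are zero.
  have hscore : ∀ a j, |∑ i : Fin d, (lam a (bstar a) i.castSucc - lam a (bstar a) (Fin.last d)) *
      v a (bstar a) i.castSucc j ^ 2 - spikeDiag lam₀ β j * selInd f j (S a)|
      ≤ 13 * ε * selInd f j (S a) := by
    intro a j
    rw [selInd_eq (hb' a)]
    split_ifs with hj
    · have h1 := (H _ (hS a (bstar a))).abs_score_sub_le
        ((isTopGenEigen_iff hM hG (hpos a (bstar a))).1 (hlam a (bstar a)))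
        (single_mem_suppOn hj 1) (by simp)
      rw [spikeForm_single] at h1
      simpa using h1
    · simp [(hlam a (bstar a)).supp _ j hj]
  have hw : ∀ j, |A * importanceScore (fun a => lam a (bstar a)) (fun a => v a (bstar a)) j
      - spikeDiag lam₀ β j * N j| ≤ 13 * ε * N j := by
    intro j
    have hA' : (A : ℝ) ≠ 0 := by positivity
    rw [importanceScore, ← mul_assoc, mul_inv_cancel₀ hA', one_mul, hN, Finset.mul_sum,
      ← Finset.sum_sub_distrib, Finset.mul_sum]
    exact (Finset.abs_sum_le_sum_abs _ _).trans (Finset.sum_le_sum fun a _ => hscore a j)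
  have hB : Fin A → 0 < B := fun a => (bstar a).pos
  have hN0 : ∀ j, 0 ≤ N j := fun j =>
    Finset.sum_nonneg fun a _ => (selInd_mem_Icc (hB a) f j (S a)).1
  intro j hj
  by_contra hjT
  obtain ⟨j', hj'T, hj'J⟩ : ∃ j' ∈ T, j' ∉ J := by
    by_contra hcon
    push Not at hcon
    have h2 : T ⊆ J.erase j := fun x hx =>
      Finset.mem_erase.2 ⟨fun h => hjT (h ▸ hx), hcon x hx⟩
    have h3 := Finset.card_le_card h2
    rw [hT.1, Finset.card_erase_of_mem hj] at h3
    have h4 : 0 < J.card := Finset.card_pos.2 ⟨j, hj⟩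
    omega
  have h1 := hT.2 j' hj'T j hjT
  have h2 := (abs_le.1 (hw j)).1
  have h3 := (abs_le.1 (hw j')).2
  have h4 : spikeDiag lam₀ β j' = 0 := by simp [spikeDiag, hJ0 j' hj'J]
  have h5 := hsel j hj j' hj'J
  have h6 : (A : ℝ) * importanceScore (fun a => lam a (bstar a)) (fun a => v a (bstar a)) j
      ≤ A * importanceScore (fun a => lam a (bstar a)) (fun a => v a (bstar a)) j' :=
    mul_le_mul_of_nonneg_left h1 (by positivity)
  rw [h4] at h3
  -- 52 = 13 · (1 + 3): A times the score of `j` is at least (52 - 13)ε N_j = 39ε N_j > 13ε N_j',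
  -- which bounds A times the score of `j'`.
  have h7 := mul_le_mul_of_nonneg_right (hJ j hj) (hN0 j)
  have h8 : ε * N j' < ε * (3 * N j) := mul_lt_mul_of_pos_left h5 hε
  linarith

end Deterministic

/-! ### Row norms of incoherent matrices -/

section Incoherence

variable {p d s : ℕ} {μ : ℝ} {β : Matrix (Fin p) (Fin d) ℝ}

theorem HasOrthonormalColumns.dot_eq (h : HasOrthonormalColumns β) (i j : Fin d) :
    (fun a => β a i) ⬝ᵥ (fun a => β a j) = if i = j then 1 else 0 := by
  have h1 := congrFun (congrFun h i) j
  rw [Matrix.one_apply] at h1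
  exact h1

theorem HasOrthonormalColumns.sum_sq (h : HasOrthonormalColumns β) :
    ∑ j, ∑ k, β j k ^ 2 = d := by
  rw [Finset.sum_comm]
  have h1 : ∀ k, ∑ j, β j k ^ 2 = 1 := fun k => by
    have h2 := h.dot_eq k k
    rw [if_pos rfl] at h2
    simpa [dotProduct, pow_two] using h2
  simp [h1]

theorem HasOrthonormalColumns.row_sq_le (h : HasOrthonormalColumns β) (j : Fin p) :
    ∑ k, β j k ^ 2 ≤ 1 := by
  simpa using sum_sq_dot_le (b := fun k a => β a k) h.dot_eq (Pi.single j 1)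

theorem rowNorm_pos {j : Fin p} (hj : β j ≠ 0) : 0 < rowNorm β j := by
  refine Real.sqrt_pos.2 ?_
  obtain ⟨k, hk⟩ := Function.ne_iff.1 hj
  exact Finset.sum_pos' (fun _ _ => sq_nonneg _) ⟨k, Finset.mem_univ _, sq_pos_of_ne_zero hk⟩

/-- The number of non-zero rows of a matrix with orthonormal columns is at least the number
of columns. -/
theorem HasOrthonormalColumns.le_card (h : HasOrthonormalColumns β) {J : Finset (Fin p)}
    (hJ : ∀ j, j ∈ J ↔ β j ≠ 0) : d ≤ J.card := by
  have h1 : (d : ℝ) ≤ J.card := by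
    rw [← h.sum_sq, ← Finset.sum_subset (Finset.subset_univ J) fun j _ hj => by
      have : β j = 0 := by simpa using (hJ j).not.1 hj
      simp [this]]
    refine (Finset.sum_le_card_nsmul _ _ 1 fun j _ => h.row_sq_le j).trans ?_
    simp
  exact_mod_cast h1

theorem IsIncoherent.card_le (h : IsIncoherent s μ β) {J : Finset (Fin p)}
    (hJ : ∀ j, j ∈ J ↔ β j ≠ 0) : J.card ≤ s := by
  have h1 : {j | β j ≠ 0} = (J : Set (Fin p)) := by
    ext j
    simp [hJ]
  have h2 := h.sparse
  rwa [h1, Set.ncard_coe_finset] at h2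

theorem IsIncoherent.one_le (h : IsIncoherent s μ β) {j : Fin p} (hj : β j ≠ 0) : 1 ≤ μ := by
  have := h.ratio j j hj hj
  rwa [div_self (rowNorm_pos hj).ne'] at this

/-- The squared row norms sum to d over at most s non-zero rows, each at most μ² times that of row
`j`. -/
theorem IsIncoherent.le_row (h : IsIncoherent s μ β) {J : Finset (Fin p)}
    (hJ : ∀ j, j ∈ J ↔ β j ≠ 0) {j : Fin p} (hj : j ∈ J) :
    (d : ℝ) ≤ s * μ ^ 2 * ∑ k, β j k ^ 2 := by
  have hj0 := (hJ j).1 hj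
  have hsq : ∀ i, rowNorm β i ^ 2 = ∑ k, β i k ^ 2 := fun i =>
    Real.sq_sqrt (Finset.sum_nonneg fun _ _ => sq_nonneg _)
  have h1 : ∀ i ∈ J, ∑ k, β i k ^ 2 ≤ μ ^ 2 * ∑ k, β j k ^ 2 := by
    intro i hi
    have h2 := (div_le_iff₀ (rowNorm_pos hj0)).1 (h.ratio i j ((hJ i).1 hi) hj0)
    rw [← hsq, ← hsq, ← mul_pow]
    exact pow_le_pow_left₀ (Real.sqrt_nonneg _) h2 2
  calc (d : ℝ) = ∑ i ∈ J, ∑ k, β i k ^ 2 := by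
        rw [← h.orthonormal.sum_sq]
        refine (Finset.sum_subset (Finset.subset_univ J) fun i _ hi => ?_).symm
        have : β i = 0 := by simpa using (hJ i).not.1 hi
        simp [this]
    _ ≤ J.card • (μ ^ 2 * ∑ k, β j k ^ 2) := Finset.sum_le_card_nsmul _ _ _ h1
    _ = J.card * (μ ^ 2 * ∑ k, β j k ^ 2) := nsmul_eq_mul _ _
    _ ≤ s * (μ ^ 2 * ∑ k, β j k ^ 2) := by
        have := h.card_le hJ
        gcongr
    _ = _ := by ring

/-- Incoherence bounds the diagonal entries of the spiked matrix from below. -/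
theorem IsIncoherent.le_spikeDiag (h : IsIncoherent s μ β) (hd : 0 < d) {J : Finset (Fin p)}
    (hJ : ∀ j, j ∈ J ↔ β j ≠ 0) {j : Fin p} (hj : j ∈ J) {lam : Fin d → ℝ} {lmin : ℝ}
    (hl0 : 0 ≤ lmin) (hl : ∀ k, lmin ≤ lam k) : lmin / (s * μ ^ 2) ≤ spikeDiag lam β j := by
  have h1 := h.le_row hJ hj
  have h2 : (1 : ℝ) ≤ d := by exact_mod_cast hd
  have hμ := h.one_le ((hJ j).1 hj)
  have hs : 0 < s := (Finset.card_pos.2 ⟨j, hj⟩).trans_le (h.card_le hJ)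
  have hs' : (0 : ℝ) < s := by exact_mod_cast hs
  rw [div_le_iff₀ (by positivity)]
  have h3 : lmin * ∑ k, β j k ^ 2 ≤ spikeDiag lam β j := by
    rw [spikeDiag, Finset.mul_sum]
    exact Finset.sum_le_sum fun k _ => mul_le_mul_of_nonneg_right (hl k) (sq_nonneg _)
  calc lmin = lmin * 1 := (mul_one _).symm
    _ ≤ lmin * (s * μ ^ 2 * ∑ k, β j k ^ 2) := by gcongr; linarith
    _ = (lmin * ∑ k, β j k ^ 2) * (s * μ ^ 2) := by ring
    _ ≤ _ := by gcongr

/-- A set of size `l` with maximal total score: exchanging two elements cannot increase the total.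
-/
theorem exists_isTopIndexSet {l : ℕ} (hl : l ≤ p) (w : Fin p → ℝ) : ∃ T, IsTopIndexSet l w T := by
  obtain ⟨T, hT, hmax⟩ := Finset.exists_max_image
    (Finset.powersetCard l (Finset.univ : Finset (Fin p))) (fun T => ∑ j ∈ T, w j)
    (Finset.powersetCard_nonempty.2 (by simpa using hl))
  have hTl := (Finset.mem_powersetCard.1 hT).2
  refine ⟨T, hTl, fun j hj j' hj' => ?_⟩
  have h1 : j' ∉ T.erase j := fun h => hj' (Finset.mem_of_mem_erase h)
  have h2 := hmax (insert j' (T.erase j)) (Finset.mem_powersetCard.2 ⟨Finset.subset_univ _, by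
    rw [Finset.card_insert_of_notMem h1, Finset.card_erase_of_mem hj, hTl]
    have : 0 < T.card := Finset.card_pos.2 ⟨j, hj⟩
    omega⟩)
  rw [Finset.sum_insert h1, ← Finset.add_sum_erase T w hj] at h2
  linarith

end Incoherence

/-! ### The population model and closeness of the sample matrices to it -/

section Model

variable {Ω₀ : Type*} [MeasurableSpace Ω₀] {p d H n : ℕ} {P₀ : Measure Ω₀} [IsProbabilityMeasure P₀]
  {X : Ω₀ → EuclideanSpace ℝ (Fin p)} {Y : Ω₀ → Fin H} {m : Fin H → EuclideanSpace ℝ (Fin p)}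
  {C : Fin H → Matrix (Fin p) (Fin p) ℝ} {β : Matrix (Fin p) (Fin d) ℝ} {lam : Fin d → ℝ}

namespace IsSlicedGaussian

/-- Variance decomposition: within each slice a² ≤ a² + v, so the between-slice variance is at most
the total variance |u|². Its use is that the eigenvalues are at most 1. -/
theorem sum_sq_dot_sliceMoment_le (HG : IsSlicedGaussian P₀ X Y m C)
    (hcov : covMatrixOf P₀ (fun ω j => X ω j) = 1) (u : Fin p → ℝ) :
    ∑ h, (u ⬝ᵥ sliceMoment P₀ X Y h) ^ 2 / P₀.real (Y ⁻¹' {h}) ≤ u ⬝ᵥ u := by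
  choose a v hlaw hint hint2 ha hv using HG.exists_slice_moments u (u ⬝ᵥ popMean P₀ X)
  rw [← HG.integral_dot_sq hcov u, integral_eq_sum_slices HG.measurable_Y hint2]
  refine Finset.sum_le_sum fun h _ => ?_
  have hq := HG.slice_pos h
  rw [HG.dot_sliceMoment, ha, hv, div_le_iff₀ hq]
  nlinarith [mul_nonneg (sq_nonneg (P₀.real (Y ⁻¹' {h}))) (v h).coe_nonneg]

theorem spikeForm_eq (HG : IsSlicedGaussian P₀ X Y m C)
    (hM : sirKernel P₀ X Y = β * Matrix.diagonal lam * βᵀ) (u : Fin p → ℝ) :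
    spikeForm lam (fun k j => β j k) u u
      = ∑ h, (u ⬝ᵥ sliceMoment P₀ X Y h) ^ 2 / P₀.real (Y ⁻¹' {h}) := by
  have h1 : u ⬝ᵥ sirKernel P₀ X Y *ᵥ u = spikeForm lam (fun k j => β j k) u u := by
    rw [hM, ← Matrix.mulVec_mulVec, ← Matrix.mulVec_mulVec, Matrix.dotProduct_mulVec,
      ← Matrix.mulVec_transpose, spikeForm_apply, dotProduct]
    refine Finset.sum_congr rfl fun k _ => ?_
    rw [Matrix.mulVec_diagonal]
    have h2 : (βᵀ *ᵥ u) k = (fun j => β j k) ⬝ᵥ u := rfl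
    rw [h2]
    ring
  have h2 : sirKernel P₀ X Y = ∑ h, (P₀.real (Y ⁻¹' {h}))⁻¹ •
      vecMulVec (sliceMoment P₀ X Y h) (sliceMoment P₀ X Y h) := by
    ext i j
    rw [HG.sirKernel_apply, Matrix.sum_apply]
    refine Finset.sum_congr rfl fun h _ => ?_
    rw [Matrix.smul_apply, Matrix.vecMulVec_apply, smul_eq_mul, div_eq_inv_mul]
  rw [← h1, ← Matrix.toBilin'_apply', h2, map_sum, LinearMap.sum_apply, LinearMap.sum_apply]
  refine Finset.sum_congr rfl fun h _ => ?_
  rw [map_smul, LinearMap.smul_apply, LinearMap.smul_apply, toBilin'_vecMulVec, smul_eq_mul,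
    div_eq_inv_mul, pow_two]

theorem eigenvalue_le_one (HG : IsSlicedGaussian P₀ X Y m C)
    (hcov : covMatrixOf P₀ (fun ω j => X ω j) = 1) (hβ : HasOrthonormalColumns β)
    (hM : sirKernel P₀ X Y = β * Matrix.diagonal lam * βᵀ) (k : Fin d) : lam k ≤ 1 := by
  have h1 := HG.sum_sq_dot_sliceMoment_le hcov fun j => β j k
  rw [← HG.spikeForm_eq hM, spikeForm_apply] at h1
  simp only [hβ.dot_eq] at h1
  simpa using h1

/-- On good samples, the sample matrices are close to the population model. -/
theorem nearSpiked (HG : IsSlicedGaussian P₀ X Y m C)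
    (hcov : covMatrixOf P₀ (fun ω j => X ω j) = 1) {pmin : ℝ} (hp0 : 0 < pmin)
    (hpmin : ∀ h, pmin ≤ P₀.real (Y ⁻¹' {h})) (hβ : HasOrthonormalColumns β)
    (hM : sirKernel P₀ X Y = β * Matrix.diagonal lam * βᵀ) (hlam : ∀ k, 0 ≤ lam k) (hn : 0 < n)
    {x : Fin n → EuclideanSpace ℝ (Fin p)} {y : Fin n → Fin H} {r : ℕ} (hr : 0 < r) {t : ℝ}
    (ht : 0 < t) (ht1 : sampleConst H pmin * (t * √r) ≤ 1 / 2)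
    (hgood : IsGoodSample (fun h => P₀.real (Y ⁻¹' {h})) (sliceMoment P₀ X Y) (popMean P₀ X) r t x y)
    {G : Matrix (Fin p) (Fin p) ℝ} (hG : G = sampleCov x ∨ G = 1) {S : Finset (Fin p)}
    (hS : S.card = r) :
    NearSpiked lam (fun k j => β j k) (Matrix.toBilin' (sampleKernel x y)) (Matrix.toBilin' G)
      (suppOn S) (sampleConst H pmin * (t * √r)) := by
  have hH : (1 : ℝ) ≤ H := by
    obtain ⟨ω⟩ := P₀.nonempty_of_neZero
    exact_mod_cast (Y ω).pos
  -- The constant is large enough that an error of at most 1/2 already implies t√r ≤ 1 and t√r ≤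
  -- pmin/2.
  have hC : 6 / pmin + 4 ≤ sampleConst H pmin := by
    have h1 : 6 / pmin ≤ 6 * H / pmin := by
      gcongr
      linarith
    have h2 : 0 ≤ 2 * H / pmin ^ 2 + (H : ℝ) ^ 2 := by positivity
    rw [sampleConst]
    linarith
  have hr' : (0 : ℝ) < r := by exact_mod_cast hr
  have hδ : 0 < t * √r := by positivity
  have h6 : 0 < 6 / pmin := by positivity
  have hδ1 : t * √r ≤ 1 := by nlinarith
  have hδ2 : t * √r ≤ pmin / 2 := by
    have h1 : 6 / pmin * (t * √r) ≤ 1 / 2 := by nlinarith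
    rw [div_mul_eq_mul_div, div_le_iff₀ hp0] at h1
    linarith
  have hGs : G.IsSymm := by
    rcases hG with rfl | rfl
    · exact isSymm_sampleCov x
    · exact Matrix.transpose_one
  refine ⟨toBilin'_symm (isSymm_sampleKernel x y), toBilin'_symm hGs, hβ.dot_eq, hlam,
    HG.eigenvalue_le_one hcov hβ hM, fun u _ => sampleKernel_nonneg x y u, fun u hu => ?_,
    fun u hu => ?_, mul_pos (by linarith) hδ, ht1⟩
  · rw [HG.spikeForm_eq hM]
    exact hgood.abs_kernel_sub_le hn ht.le hr hp0 hpmin hS hδ1 hδ2 HG.sum_sliceMoment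
      (HG.sq_dot_sliceMoment_le hcov) hu
  · rcases hG with rfl | rfl
    · exact hgood.abs_cov_sub_le hn ht.le hp0 hS hδ1 HG.sum_sliceMoment hu
    · rw [Matrix.toBilin'_apply', Matrix.one_mulVec, sub_self, abs_zero]
      exact mul_nonneg (mul_nonneg (by linarith) hδ.le) (dot_self_nonneg u)

end IsSlicedGaussian

theorem measurable_sampleCov : Measurable fun (z : Fin n → EuclideanSpace ℝ (Fin p) × Fin H) i j =>
    sampleCov (fun a => (z a).1) i j := by
  have hmean : ∀ j, Measurable fun z : Fin n → EuclideanSpace ℝ (Fin p) × Fin H =>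
      sampleMean (fun a => (z a).1) j := fun j => by
    unfold sampleMean
    fun_prop
  refine measurable_pi_lambda _ fun i => measurable_pi_lambda _ fun j => ?_
  simp only [sampleCov, Matrix.smul_apply, Matrix.sum_apply, Matrix.vecMulVec_apply, smul_eq_mul]
  fun_prop

theorem measurable_sampleKernel :
    Measurable fun (z : Fin n → EuclideanSpace ℝ (Fin p) × Fin H) i j =>
      sampleKernel (fun a => (z a).1) (fun a => (z a).2) i j := by
  have hy : ∀ i h, MeasurableSet {z : Fin n → EuclideanSpace ℝ (Fin p) × Fin H | (z i).2 = h} :=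
    fun i h => (measurable_snd.comp (measurable_pi_apply i)) (measurableSet_singleton h)
  have hmean : ∀ j, Measurable fun z : Fin n → EuclideanSpace ℝ (Fin p) × Fin H =>
      sampleMean (fun a => (z a).1) j := fun j => by
    unfold sampleMean
    fun_prop
  have hprop : ∀ h, Measurable fun z : Fin n → EuclideanSpace ℝ (Fin p) × Fin H =>
      sliceProp (fun i => (z i).2) h := fun h =>
    (Finset.measurable_sum _ fun i _ =>
      Measurable.ite (hy i h) measurable_const measurable_const).const_mul _
  have hslice : ∀ h j, Measurable fun z : Fin n → EuclideanSpace ℝ (Fin p) × Fin H =>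
      sliceMean (fun i => (z i).1) (fun i => (z i).2) h j := fun h j =>
    ((hprop h).inv.mul_const _).mul (Finset.measurable_sum _ fun i _ =>
      Measurable.ite (hy i h) (by fun_prop) measurable_const)
  refine measurable_pi_lambda _ fun i => measurable_pi_lambda _ fun j => ?_
  simp only [sampleKernel, Matrix.smul_apply, Matrix.sum_apply, Matrix.vecMulVec_apply, smul_eq_mul]
  fun_prop

end Model

/-! ### Outputs of the algorithm on good samples -/

section Output

variable {p d : ℕ} {lam₀ : Fin d → ℝ} {β : Matrix (Fin p) (Fin d) ℝ}
  {M G : Matrix (Fin p) (Fin p) ℝ}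

/-- If the pair is close to the spiked model on sets of the sizes `k` and `l`, and the selection
counts favour the signal set `J`, then outputs of the algorithm exist, and their loss is small. -/
theorem output_of_nearSpiked (hd : 0 < d) (hM : M.IsSymm) (hG : G.IsSymm) {A B k l : ℕ} (hA : 0 < A)
    (hB : 0 < B) (hdk : d + 1 ≤ k) (hlp : l ≤ p) {ε ε' : ℝ}
    (H : ∀ S : Finset (Fin p), S.card = k → NearSpiked lam₀ (fun k j => β j k) (Matrix.toBilin' M)
      (Matrix.toBilin' G) (suppOn S) ε)
    (H' : ∀ S : Finset (Fin p), S.card = l → NearSpiked lam₀ (fun k j => β j k) (Matrix.toBilin' M)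
      (Matrix.toBilin' G) (suppOn S) ε') (hβ : HasOrthonormalColumns β)
    {J : Finset (Fin p)} (hJ0 : ∀ j, j ∈ J ↔ β j ≠ 0)
    (hJ : ∀ j ∈ J, 52 * ε ≤ spikeDiag lam₀ β j) (hJl : J.card ≤ l) (hε : 0 < ε)
    {S : Fin A → Fin B → Finset (Fin p)} (hS : ∀ a b, (S a b).card = k)
    {f : Finset (Fin p) → ℝ} (hf : ∀ T, T.card = k → f T = topSum d M G T)
    (hsel : ∀ j ∈ J, ∀ j' ∉ J, ∑ a, selInd f j' (S a) < 3 * ∑ a, selInd f j (S a))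
    {lmin : ℝ} (hlmin0 : 0 < lmin) (hlmin : ∀ i, lmin ≤ lam₀ i) (hε' : ε' ≤ lmin / 4) :
    (∃ b : Matrix (Fin p) (Fin d) ℝ, IsSSIRvRPOutput M G l S b) ∧
      ∀ b, IsSSIRvRPOutput M G l S b → sinThetaLoss b β ≤ 6 * d * ε' / lmin := by
  have hJc : ∀ j ∉ J, β j = 0 := fun j hj => by simpa using (hJ0 j).not.1 hj
  constructor
  · choose lam v hlam using fun a b =>
      exists_isTopGenEigen hM hG (H (S a b) (hS a b)) (hdk.trans (hS a b).ge)
    choose bstar hb using fun a => exists_isSargmax hB fun b => ∑ i : Fin d, lam a b i.castSucc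
    obtain ⟨T, hT⟩ := exists_isTopIndexSet hlp
      (importanceScore (fun a => lam a (bstar a)) (fun a => v a (bstar a)))
    obtain ⟨lamhat, vhat, hhat⟩ := exists_isTopGenEigen hM hG (H' T hT.1) (r := d)
      (((hβ.le_card hJ0).trans hJl).trans hT.1.ge)
    exact ⟨Matrix.of fun j i => vhat i j, lam, v, bstar, T, lamhat, hlam, hb, hT, hhat⟩
  · rintro b ⟨lam, v, bstar, T, lamhat, hlam, hb, hT, hhat⟩
    have hJT : J ⊆ T :=
      subset_of_isTopIndexSet hM hG hA H hJc hJ hJl hε hS hf hsel hlam hb hT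
    have HT := H' T hT.1
    refine HT.sinThetaLoss_le hd hβ
      ((isTopGenEigen_iff hM hG fun u hu hu0 => HT.G_pos hu hu0).1 hhat) (fun k j hj => ?_)
      hlmin hlmin0 hε'
    exact congrFun (hJc j fun h => hj (hJT h)) k

end Output

/-- The exponents of the two forms of the probability bound for the selection. -/
theorem selection_exponent_le {A p : ℕ} {l L μ : ℝ} (hl0 : 0 < l) (hlL : l ≤ L) (hμ : 1 ≤ μ) :
    A * l ^ 2 / (50 * (p : ℝ) ^ 2 * μ ^ 8 * L ^ 2) ≤ A / (2 * (p : ℝ) ^ 2) := by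
  rcases Nat.eq_zero_or_pos p with rfl | hp
  · simp
  have hp' : (0 : ℝ) < p := by exact_mod_cast hp
  have hL : 0 < L := hl0.trans_le hlL
  have h1 : l ^ 2 ≤ L ^ 2 := pow_le_pow_left₀ hl0.le hlL 2
  have h2 : 1 ≤ μ ^ 8 := one_le_pow₀ hμ
  rw [div_le_div_iff₀ (by positivity) (by positivity)]
  calc (A : ℝ) * l ^ 2 * (2 * (p : ℝ) ^ 2) ≤ A * L ^ 2 * (2 * (p : ℝ) ^ 2) := by gcongr
    _ = A * (2 * (p : ℝ) ^ 2 * 1 * L ^ 2) := by ring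
    _ ≤ A * (50 * (p : ℝ) ^ 2 * μ ^ 8 * L ^ 2) := by
      gcongr
      norm_num

end

/-! ### The main theorem -/

theorem theorem1 (H d : ℕ) (hd : 0 < d) (κ lam₀ μ pmin : ℝ) (hκ : 1 < κ) (hlam₀ : 0 < lam₀)
    (hpmin : 0 < pmin) :
    ∃ K c : ℝ, 0 < K ∧ 0 < c ∧
      ∀ (n p s k l A B : ℕ), 0 < n → 0 < A → 0 < B →
      ∀ (Ω₀ : Type*) [MeasurableSpace Ω₀] (P₀ : Measure Ω₀) [IsProbabilityMeasure P₀]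
        (X : Ω₀ → EuclideanSpace ℝ (Fin p)) (Y : Ω₀ → Fin H)
        (m : Fin H → EuclideanSpace ℝ (Fin p)) (C : Fin H → Matrix (Fin p) (Fin p) ℝ)
        (β : Matrix (Fin p) (Fin d) ℝ) (lam : Fin d → ℝ)
        (Ω : Type*) [MeasurableSpace Ω] (P : Measure Ω) [IsProbabilityMeasure P]
        (Xs : Fin n → Ω → EuclideanSpace ℝ (Fin p)) (Ys : Fin n → Ω → Fin H)
        (S : Fin A → Fin B → Ω → Finset (Fin p))
        (G : Ω → Matrix (Fin p) (Fin p) ℝ) (βhat : Ω → Matrix (Fin p) (Fin d) ℝ),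
        -- the population
        IsSlicedGaussian P₀ X Y m C →
        (∀ h, pmin ≤ P₀.real (Y ⁻¹' {h})) →
        covMatrixOf P₀ (fun ω j => X ω j) = 1 →
        -- `β` collects the eigenvectors for the non-zero eigenvalues `lam` of `Cov(E(X | Y))`
        HasOrthonormalColumns β → Antitone lam →
        sirKernel P₀ X Y = β * Matrix.diagonal lam * βᵀ →
        -- eigenvalue bounds and incoherence
        (∀ i, lam₀ ≤ lam i ∧ lam i ≤ κ * lam₀) →
        IsIncoherent s μ β →
        -- the tuning parameters
        k ≤ p → l ≤ p → max (d + 1) s ≤ k → s ≤ l →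
        16 * K * √(k * Real.log p / n) ≤ lam ⟨d - 1, by omega⟩ / (s * μ ^ 2) →
        -- the data and the random projections
        IsSamplingScheme P₀ P X Y k Xs Ys S →
        -- the second input matrix is the sample covariance matrix, or the known `Cov(X) = I`
        ((∀ ω, G ω = sampleCov fun i => Xs i ω) ∨ (∀ ω, G ω = 1)) →
        -- `βhat` is the output of the algorithm, and arbitrary wherever there is no output
        (∀ ω, (∃ b : Matrix (Fin p) (Fin d) ℝ, IsSSIRvRPOutput
              (sampleKernel (fun i => Xs i ω) (fun i => Ys i ω)) (G ω) l (fun a b => S a b ω) b) →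
          IsSSIRvRPOutput
              (sampleKernel (fun i => Xs i ω) (fun i => Ys i ω)) (G ω) l (fun a b => S a b ω)
              (βhat ω)) →
        -- a measurable event, of the asserted probability, on which the bound holds
        ∃ E : Set Ω, MeasurableSet E ∧
          (∀ ω ∈ E, sinThetaLoss (βhat ω) β
            ≤ 2 * K * √(d * l * Real.log p / (n * lam ⟨d - 1, by omega⟩ ^ 2))) ∧
          1 - c * ((p : ℝ) ^ 3)⁻¹
              - p * Real.exp (-(A * lam ⟨d - 1, by omega⟩ ^ 2
                  / (50 * p ^ 2 * μ ^ 8 * lam ⟨0, hd⟩ ^ 2)))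
            ≤ P.real E := by
  obtain ⟨τ, hτ0, Cg, hCg, hτ⟩ := exists_exp_sq_gaussianReal_le
  obtain ⟨a, ha⟩ : ∃ a, a = τ * pmin / 2 := ⟨_, rfl⟩
  have ha0 : 0 < a := by rw [ha]; positivity
  obtain ⟨V, hV⟩ : ∃ V, V = bernsteinVar a (Real.exp a * Cg) := ⟨_, rfl⟩
  have hV0 : 0 < V := by rw [hV, bernsteinVar]; positivity
  obtain ⟨K₁, hK₁⟩ : ∃ K₁, K₁ = 6 * √V := ⟨_, rfl⟩
  have hK₁0 : 0 < K₁ := by rw [hK₁]; positivity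
  obtain ⟨Q, hQ⟩ : ∃ Q, Q = sampleConst H pmin := ⟨_, rfl⟩
  have hQ0 : 4 ≤ Q := by
    rw [hQ, sampleConst]
    have : 0 ≤ 6 * H / pmin + 2 * H / pmin ^ 2 + (H : ℝ) ^ 2 := by positivity
    linarith
  have hd1 : (1 : ℝ) ≤ d := by exact_mod_cast hd
  -- The first summand turns smallness of K√(r log p / n) into the multiples of ε_r required for the
  -- selection, the scores and the loss; the second keeps the deviations t√r in the range t√r ≤ aV
  -- of Bernstein's inequality.
  obtain ⟨K, hK⟩ : ∃ K, K = Q * K₁ * (4 + 3 * d) + K₁ / (a * V) := ⟨_, rfl⟩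
  have hQK : 0 < Q * K₁ := by positivity
  have hKQ : Q * K₁ * (4 + 3 * d) ≤ K := by
    have : 0 < K₁ / (a * V) := by positivity
    linarith
  have hKV : K₁ ≤ K * (a * V) := by
    have h1 : K₁ / (a * V) ≤ K := by
      have : 0 < Q * K₁ * (4 + 3 * d) := by positivity
      linarith
    exact (div_le_iff₀ (by positivity)).1 h1
  have hK0 : 0 < K := lt_of_lt_of_le (by positivity) hKQ
  -- Twice 4H + 2: good samples are needed at both sizes k and l.
  refine ⟨K, 8 * H + 4, hK0, by positivity, ?_⟩
  intro n p s k l A B hn hA hB Ω₀ _ P₀ _ X Y m C β lam Ω _ P _ Xs Ys S G βhat HG hpm hcov hβ hanti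
    hM hbd hinc hkp hlp hmax hsl hsmall hsch hGcases hout
  classical
  have hdk : d + 1 ≤ k := (le_max_left _ _).trans hmax
  have hsk : s ≤ k := (le_max_right _ _).trans hmax
  have hp2 : 2 ≤ p := by omega
  have hp2' : (2 : ℝ) ≤ p := by exact_mod_cast hp2
  have hn' : (0 : ℝ) < n := by exact_mod_cast hn
  have hlog : 0 < Real.log p := Real.log_pos (by linarith)
  set lmin := lam ⟨d - 1, by omega⟩ with hlmin_def
  have hlmin : ∀ i, lmin ≤ lam i := fun i => hanti (by
    rw [Fin.le_def]
    have := i.2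
    simp only
    omega)
  have hlmin0 : 0 < lmin := hlam₀.trans_le (hbd _).1
  have hlam0 : ∀ i, 0 ≤ lam i := fun i => hlmin0.le.trans (hlmin i)
  have hlmin1 : lmin ≤ 1 := HG.eigenvalue_le_one hcov hβ hM _
  obtain ⟨J, hJ⟩ : ∃ J : Finset (Fin p), ∀ j, j ∈ J ↔ β j ≠ 0 :=
    ⟨Finset.univ.filter fun j => β j ≠ 0, by simp⟩
  have hdJ : d ≤ J.card := hβ.le_card hJ
  have hJs : J.card ≤ s := hinc.card_le hJ
  obtain ⟨j₀, hj₀⟩ : J.Nonempty := Finset.card_pos.1 (by omega)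
  have hμ : 1 ≤ μ := hinc.one_le ((hJ j₀).1 hj₀)
  have hs1 : (1 : ℝ) ≤ s := by exact_mod_cast (by omega : 1 ≤ s)
  obtain ⟨θ, hθ⟩ : ∃ θ, θ = lmin / (s * μ ^ 2) := ⟨_, rfl⟩
  have hθJ : ∀ j ∈ J, θ ≤ spikeDiag lam β j := fun j hj => by
    rw [hθ]
    exact hinc.le_spikeDiag hd hJ hj hlmin0.le hlmin
  have hsμ : 1 ≤ s * μ ^ 2 := one_le_mul_of_one_le_of_one_le hs1 (one_le_pow₀ hμ)
  have hθ1 : θ ≤ 1 := by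
    rw [hθ]
    exact (div_le_self hlmin0.le hsμ).trans hlmin1
  rw [← hθ] at hsmall
  set t := K₁ * √(Real.log p / n) with ht
  have ht0 : 0 < t := by positivity
  have hroot : ∀ r : ℕ, t * √r = K₁ * √(r * Real.log p / n) := by
    intro r
    rw [ht, mul_assoc, ← Real.sqrt_mul (by positivity)]
    congr 2
    ring
  -- If the asserted bound is at least √d it holds always. Otherwise 2K√(l log p / n) < λ_d, which
  -- is the only source of closeness at size l, since the hypothesis constrains k alone.
  by_cases htriv : √d ≤ 2 * K * √(d * l * Real.log p / (n * lmin ^ 2))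
  · refine ⟨Set.univ, MeasurableSet.univ,
      fun ω _ => (sinThetaLoss_le_sqrt _ _).trans htriv, ?_⟩
    rw [probReal_univ, sub_sub]
    exact sub_le_self _ (by positivity)
  have hloss : √(d * l * Real.log p / (n * lmin ^ 2)) = √d * √(l * Real.log p / n) / lmin := by
    rw [← Real.sqrt_mul (by positivity), eq_div_iff hlmin0.ne']
    nth_rewrite 2 [← Real.sqrt_sq hlmin0.le]
    rw [← Real.sqrt_mul (by positivity)]
    congr 1
    field_simp
  have hl1 : 2 * K * √(l * Real.log p / n) < lmin := by
    rw [not_le, hloss] at htriv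
    have hd0 : 0 < √(d : ℝ) := by positivity
    have h1 : √(d : ℝ) * (2 * K * √(l * Real.log p / n) / lmin) < √d * 1 := by
      calc _ = 2 * K * (√d * √(l * Real.log p / n) / lmin) := by ring
        _ < √d * 1 := by rwa [mul_one]
    have h2 := lt_of_mul_lt_mul_left h1 hd0.le
    rwa [div_lt_one hlmin0] at h2
  set ρk := √(k * Real.log p / n) with hρk
  set ρl := √(l * Real.log p / n) with hρl
  have hρk0 : 0 ≤ ρk := Real.sqrt_nonneg _
  have hρl0 : 0 ≤ ρl := Real.sqrt_nonneg _
  -- This covers 52ε ≤ θ for the scores, 8dε ≤ θ for the exchange and, as θ ≤ 1, also ε ≤ 1/2.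
  have hεk : Q * (t * √k) * (64 + 48 * d) ≤ θ := by
    rw [hroot]
    calc Q * (K₁ * ρk) * (64 + 48 * d) = 16 * (Q * K₁ * (4 + 3 * d)) * ρk := by ring
      _ ≤ 16 * K * ρk := by gcongr
      _ ≤ θ := hsmall
  have hεl : Q * (t * √l) * (8 + 6 * d) ≤ lmin := by
    rw [hroot]
    calc Q * (K₁ * ρl) * (8 + 6 * d) = 2 * (Q * K₁ * (4 + 3 * d)) * ρl := by ring
      _ ≤ 2 * K * ρl := by gcongr
      _ ≤ lmin := hl1.le
  have hεk0 : 0 < Q * (t * √k) := by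
    have : (0 : ℝ) < k := by exact_mod_cast (by omega : 0 < k)
    positivity
  have hεl0 : 0 ≤ Q * (t * √l) := by positivity
  have hεkd : 0 ≤ Q * (t * √k) * d := by positivity
  have hεld : 0 ≤ Q * (t * √l) * d := by positivity
  have htk : t * √k ≤ a * V := by
    rw [hroot]
    have h1 : K * ρk ≤ 1 := by linarith [mul_nonneg hK0.le hρk0]
    calc K₁ * ρk ≤ K * (a * V) * ρk := by gcongr
      _ = K * ρk * (a * V) := by ring
      _ ≤ a * V := mul_le_of_le_one_left (by positivity) h1
  have htl : t * √l ≤ a * V := by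
    rw [hroot]
    have h1 : K * ρl ≤ 1 := by linarith [mul_nonneg hK0.le hρl0]
    calc K₁ * ρl ≤ K * (a * V) * ρl := by gcongr
      _ = K * ρl * (a * V) := by ring
      _ ≤ a * V := mul_le_of_le_one_left (by positivity) h1
  -- Both choices of the second matrix become measurable functions of the data, so that independence
  -- from the random sets can be used.
  obtain ⟨Gd, hGdm, hGds, hGd, hGω⟩ : ∃ Gd : (Fin n → EuclideanSpace ℝ (Fin p) × Fin H) →
      Matrix (Fin p) (Fin p) ℝ, (Measurable fun z i j => Gd z i j) ∧ (∀ z, (Gd z).IsSymm) ∧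
      (∀ z, Gd z = sampleCov (fun i => (z i).1) ∨ Gd z = 1) ∧
      ∀ ω, G ω = Gd fun i => (Xs i ω, Ys i ω) := by
    rcases hGcases with h | h
    · exact ⟨fun z => sampleCov fun i => (z i).1, measurable_sampleCov,
        fun z => isSymm_sampleCov _, fun z => Or.inl rfl, h⟩
    · exact ⟨fun _ => 1, measurable_const, fun _ => Matrix.transpose_one, fun _ => Or.inr rfl, h⟩
  set Mz : (Fin n → EuclideanSpace ℝ (Fin p) × Fin H) → Matrix (Fin p) (Fin p) ℝ :=
    fun z => sampleKernel (fun i => (z i).1) (fun i => (z i).2) with hMz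
  have hMs : ∀ z, (Mz z).IsSymm := fun z => isSymm_sampleKernel _ _
  set D : Set (Fin n → EuclideanSpace ℝ (Fin p) × Fin H) :=
    {z | IsGoodSample (fun h => P₀.real (Y ⁻¹' {h})) (sliceMoment P₀ X Y) (popMean P₀ X) k t
        (fun i => (z i).1) (fun i => (z i).2)} ∩
    {z | IsGoodSample (fun h => P₀.real (Y ⁻¹' {h})) (sliceMoment P₀ X Y) (popMean P₀ X) l t
        (fun i => (z i).1) (fun i => (z i).2)} with hD
  have hDm : MeasurableSet D :=
    (measurableSet_isGoodSample _ _ _ _ _).inter (measurableSet_isGoodSample _ _ _ _ _)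
  have hnk : ∀ z ∈ D, ∀ T : Finset (Fin p), T.card = k → NearSpiked lam (fun k j => β j k)
      (Matrix.toBilin' (Mz z)) (Matrix.toBilin' (Gd z)) (suppOn T) (Q * (t * √k)) := by
    intro z hz T hT
    rw [hQ]
    exact HG.nearSpiked hcov hpmin hpm hβ hM hlam0 hn (by omega) ht0 (by rw [← hQ]; linarith) hz.1
      (hGd z) hT
  have hnl : ∀ z ∈ D, ∀ T : Finset (Fin p), T.card = l → NearSpiked lam (fun k j => β j k)
      (Matrix.toBilin' (Mz z)) (Matrix.toBilin' (Gd z)) (suppOn T) (Q * (t * √l)) := by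
    intro z hz T hT
    rw [hQ]
    exact HG.nearSpiked hcov hpmin hpm hβ hM hlam0 hn (by omega) ht0 (by rw [← hQ]; linarith) hz.2
      (hGd z) hT
  -- The criterion is cut off outside the good data and for sets of the wrong size, which makes it
  -- measurable everywhere; on `D` and for k-sets it is the true one.
  set f : (Fin n → EuclideanSpace ℝ (Fin p) × Fin H) → Finset (Fin p) → ℝ := fun z T =>
    if T.card = k then D.indicator (fun z => topSum d (Mz z) (Gd z) T) z else 0 with hf
  have hfk : ∀ z ∈ D, ∀ T : Finset (Fin p), T.card = k → f z T = topSum d (Mz z) (Gd z) T := by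
    intro z hz T hT
    simp only [hf, if_pos hT, Set.indicator_of_mem hz]
  have hfm : ∀ T, Measurable fun z => f z T := by
    intro T
    by_cases hT : T.card = k
    · simp only [hf, if_pos hT]
      exact measurable_topSum measurable_sampleKernel hGdm hDm (fun z _ => hMs z)
        (fun z _ => hGds z) (fun z hz u hu hu0 => (hnk z hz T hT).G_pos hu hu0)
        (fun z hz => (hnk z hz T hT).psd) (hdk.trans hT.ge)
    · simp only [hf, if_neg hT]
      exact measurable_const
  have hswap : ∀ z ∈ D, ∀ j ∈ J, ∀ j' ∉ J, ∀ T : Finset (Fin p), T.card = k → j ∉ T → j' ∈ T →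
      f z T ≤ f z (swapSet j j' T) := by
    intro z hz j hj j' hj' T hT hjT hj'T
    rw [hfk z hz T hT, hfk z hz _ (by simp [swapSet, hT])]
    refine topSum_le_swapSet (hMs z) (hGds z) hdk (hnk z hz) (by simpa using (hJ j').not.1 hj') ?_
      hT hjT hj'T
    linarith [hθJ j hj]
  set Z : Ω → Fin n → EuclideanSpace ℝ (Fin p) × Fin H := fun ω i => (Xs i ω, Ys i ω) with hZ
  have hZm : Measurable Z := measurable_pi_lambda _ fun i =>
    (hsch.measurable_Xs i).prodMk (hsch.measurable_Ys i)
  obtain ⟨E, hEm, hE, hPE⟩ := exists_selection_event hA hB hkp (hJs.trans hsk) ⟨j₀, hj₀⟩ hZm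
    hsch.measurable_S hsch.uniform hsch.indep_proj hsch.indep_data_proj hfm hDm hswap
  refine ⟨E, hEm, fun ω hω => ?_, ?_⟩
  · obtain ⟨hzD, hcard, hsel⟩ := hE ω hω
    have hfin := output_of_nearSpiked hd (hMs (Z ω)) (hGds (Z ω)) hA hB hdk hlp (hnk _ hzD)
      (hnl _ hzD) hβ hJ (fun j hj => by linarith [hθJ j hj]) (hJs.trans hsl) hεk0 hcard
      (hfk _ hzD) hsel hlmin0 hlmin (by linarith)
    -- On the event an output exists, so the arbitrary convention for `βhat` does not intervene.
    have hω' := hout ω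
    rw [hGω ω] at hω'
    refine (hfin.2 _ (hω' hfin.1)).trans ?_
    rw [hloss, div_le_iff₀ hlmin0, hroot]
    have hsd : 1 ≤ √(d : ℝ) := Real.one_le_sqrt.2 hd1
    have h1 : 2 * K * (√d * ρl / lmin) * lmin = 2 * K * ρl * √d := by
      field_simp
    rw [h1]
    calc 6 * d * (Q * (K₁ * ρl)) ≤ 2 * (Q * K₁ * (4 + 3 * d)) * ρl * 1 := by
          linarith [mul_nonneg hQK.le hρl0]
      _ ≤ 2 * K * ρl * √d := by gcongr
  · have hbad : P.real {ω | Z ω ∉ D} ≤ (8 * H + 4) * ((p : ℝ) ^ 3)⁻¹ := by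
      have hone : ∀ r : ℕ, 0 < r → t * √r ≤ a * V → P.real {ω | ¬ IsGoodSample
          (fun h => P₀.real (Y ⁻¹' {h})) (sliceMoment P₀ X Y) (popMean P₀ X) r t
          (fun i => Xs i ω) (fun i => Ys i ω)} ≤ (4 * H + 2) * ((p : ℝ) ^ 3)⁻¹ := fun r hr htr =>
        HG.measure_not_isGoodSample_le hcov hpmin hpm hτ0 hCg hτ hn hsch.measurable_Xs
          hsch.measurable_Ys hsch.identDistrib hsch.indep_data ha hV hp2 hr
          (by rw [ht, hK₁]) htr
      have hsub : {ω | Z ω ∉ D} ⊆ {ω | ¬ IsGoodSample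
          (fun h => P₀.real (Y ⁻¹' {h})) (sliceMoment P₀ X Y) (popMean P₀ X) k t
          (fun i => Xs i ω) (fun i => Ys i ω)} ∪ {ω | ¬ IsGoodSample
          (fun h => P₀.real (Y ⁻¹' {h})) (sliceMoment P₀ X Y) (popMean P₀ X) l t
          (fun i => Xs i ω) (fun i => Ys i ω)} := by
        intro ω hω
        by_contra hcon
        simp only [Set.mem_union, Set.mem_ofPred_eq, not_or, not_not] at hcon
        exact hω hcon
      refine (measureReal_mono hsub).trans ((measureReal_union_le _ _).trans ?_)
      linarith [hone k (by omega) htk, hone l (by omega) htl]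
    have hexp : Real.exp (-(A / (2 * (p : ℝ) ^ 2))) ≤ Real.exp (-(A * lmin ^ 2
        / (50 * (p : ℝ) ^ 2 * μ ^ 8 * lam ⟨0, hd⟩ ^ 2))) :=
      Real.exp_le_exp.2 (neg_le_neg (selection_exponent_le hlmin0 (hlmin _) hμ))
    have := mul_le_mul_of_nonneg_left hexp (by positivity : (0 : ℝ) ≤ p)
    linarith
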